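/- **Conventions.** Fix integers $d,r\ge 1$ and $s\ge 0$. A *dilation matrix* is a $d\times d$ integer matrix all of whose eigenvalues are greater than $1$ in modulus; let $M_0,\dots,M_s$ be dilation matrices. Write $\overline{A}^{T}$ for the conjugate transpose of $A$, and $A\le B$ for square matrices when $B-A$ is positive semi-definite. The Fourier transform is $\hat f(\xi)=\int_{\mathbb R^d}f(x)e^{-ix\cdot\xi}\,dx$, extended to $L_2(\mathbb R^d)$ and applied entrywise; $\langle f,g\rangle=\int_{\mathbb R^d} f(x)\overline{g(x)}^{T}dx$. For a finitely supported matrix- or vector-valued sequence $u$ on $\mathbb Z^d$ put $\hat u(\xi)=\sum_{k\in\mathbb Z^d}u(k)e^{-ik\cdot\xi}$. Let $b_0,\tilde b_0$ be finitely supported filters on $\mathbb Z^d$ with values in $\mathbb C^{r\times r}$, and $b_1,\dots,b_s,\tilde b_1,\dots,\tilde b_s$ finitely supported filters with values in $\mathbb C^{1\times r}$. *Dual framelet filter bank.* Let $\Omega_l=(M_l^{-T}\mathbb Z^d)\cap[0,1)^d$. The pair $(\{b_l!M_l\}_{l=0}^s,\{\tilde b_l!M_l\}_{l=0}^s)$ is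 a dual framelet filter bank with mixed dilation factors if, for every $\omega\in\bigcup_{l=0}^s\Omega_l$ and almost every $\xi\in\mathbb R^d$, $$\sum_{l=0}^s\chi_{\Omega_l}(\omega)\,\overline{\hat b_l(\xi)}^{T}\,\hat{\tilde b}_l(\xi+2\pi\omega)=\boldsymbol\delta(\omega)I_r,$$ where $\boldsymbol\delta(0)=1$ and $\boldsymbol\delta(\omega)=0$ for $\omega\ne0$. *Stability.* For a sequence $v:\mathbb Z^d\to\mathbb C^{1\times r}$ let $v_{0,0}=v$ and $$v_{l,j}(n)=|\det M_l|^{1/2}\sum_{k\in\mathbb Z^d}v_{0,j-1}(k)\,\overline{b_l(k-M_ln)}^{T},\qquad j\ge1,\ 0\le l\le s.$$ The filter bank $\{b_l!M_l\}_{l=0}^s$ has stability in $l_2$ if there are $C_1,C_2>0$ such that $$C_1\|v\|_{l_2}^2\le\|v_{0,J}\|_{l_2}^2+\sum_{j=1}^J\sum_{l=1}^s\|v_{l,j}\|_{l_2}^2\le C_2\|v\|_{l_2}^2$$ for all $J\ge1$ and all $v\in l_2(\mathbb Z^d)^{1\times r}$. Stability of $\{\tilde b_l!M_l\}_{l=0}^s$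 is defined in the same way. *Standard refinable vector functions.* A compactly supported $\psi^0\in(L_2(\mathbb R^d))^r$ is a standard $M_0$-refinable vector function associated to $b_0$ if there are a (submultiplicative) matrix norm $|||\cdot|||$ on $\mathbb C^{r\times r}$, constants $C_0,C_b,\tau>0$ and a finitely supported $u:\mathbb Z^d\to\mathbb C^{r}$ with $$\log_2\big(|||\hat b_0(0)|||+C_0\big)\le\tau,\qquad \|\hat b_0(\xi)\hat u(\xi)-\hat u(M_0^T\xi)\|\le C_b\|\xi\|^\tau\quad(\xi\in[-\pi,\pi]^d),$$ $$\widehat{\psi^0}(\xi)=\lim_{n\to\infty}\Big(\prod_{j=1}^n\hat b_0\big((M_0^{-T})^j\xi\big)\Big)\hat u\big((M_0^{-T})^n\xi\big)\quad(\xi\in\mathbb R^d),$$ where the factors of the product are ordered from left to right by increasing $j$. *Dual framelets.* For $\psi^0=(\psi^0_1,\dots,\psi^0_r)^T\in(L_2(\mathbb R^d))^r$ and $\psi^1,\dots,\psi^s\in L_2(\mathbb R^d)$, the affine system $\mathsf{AS}(\{\psi^l!M_l\}_{l=0}^s)$ consists of the functions $\psi^0_q(\cdot-k)$ ($1\le q\le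 r$, $k\in\mathbb Z^d$) and $$\psi^{l}_{j,k}:=|\det(M_0^{-1}M_l)|^{1/2}\,|\det M_0|^{j/2}\,\psi^l(M_0^j\cdot-M_0^{-1}M_lk)\qquad(1\le l\le s,\ j\ge0,\ k\in\mathbb Z^d).$$ The pair $(\{\psi^l!M_l\}_{l=0}^s,\{\tilde\psi^l!M_l\}_{l=0}^s)$ is a dual framelet in $L_2(\mathbb R^d)$ with mixed dilation factors if both affine systems are frames of $L_2(\mathbb R^d)$ and $$\langle f,g\rangle=\sum_{k\in\mathbb Z^d}\langle f,\psi^0(\cdot-k)\rangle\langle\tilde\psi^0(\cdot-k),g\rangle+\sum_{l=1}^s\sum_{j=0}^\infty\sum_{k\in\mathbb Z^d}\langle f,\psi^l_{j,k}\rangle\langle\tilde\psi^l_{j,k},g\rangle$$ for all $f,g\in L_2(\mathbb R^d)$, with absolute convergence. *Bracket product.* $[\hat f,\hat g](\xi)=\sum_{k\in\mathbb Z^d}\hat f(\xi+2\pi k)\,\overline{\hat g(\xi+2\pi k)}^{T}$ for $f,g\in (L_2(\mathbb R^d))^r$. **Theorem.** Let $\psi^0,\tilde\psi^0\in(L_2(\mathbb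 R^d))^r$ be compactly supported standard $M_0$-refinable vector functions associated to $b_0$ and $\tilde b_0$ respectively, so that for all $\xi\in\mathbb R^d$ $$\widehat{\psi^0}(M_0^T\xi)=\hat b_0(\xi)\widehat{\psi^0}(\xi),\qquad\widehat{\tilde\psi^0}(M_0^T\xi)=\hat{\tilde b}_0(\xi)\widehat{\tilde\psi^0}(\xi),$$ and assume $\overline{\widehat{\psi^0}(0)}^{T}\,\widehat{\tilde\psi^0}(0)=1$. Let $\psi^1,\dots,\psi^s,\tilde\psi^1,\dots,\tilde\psi^s\in L_2(\mathbb R^d)$ be defined by $$\widehat{\psi^l}(\xi)=\hat b_l(M_0^{-T}\xi)\widehat{\psi^0}(M_0^{-T}\xi),\qquad\widehat{\tilde\psi^l}(\xi)=\hat{\tilde b}_l(M_0^{-T}\xi)\widehat{\tilde\psi^0}(M_0^{-T}\xi).$$ Consider the statements (i) $(\{b_l!M_l\}_{l=0}^s,\{\tilde b_l!M_l\}_{l=0}^s)$ is a dual framelet filter bank with mixed dilation factors, and both $\{b_l!M_l\}_{l=0}^s$ and $\{\tilde b_l!M_l\}_{l=0}^s$ have stability in $l_2$; (ii) $(\{\psi^l!M_l\}_{l=0}^s,\{\tilde\psi^l!M_l\}_{l=0}^s)$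 is a dual framelet in $L_2(\mathbb R^d)$ with mixed dilation factors, and there is $C>0$ with $[\widehat{\psi^0},\widehat{\psi^0}](\xi)+[\widehat{\tilde\psi^0},\widehat{\tilde\psi^0}](\xi)\le C I_r$ for almost every $\xi\in\mathbb R^d$. Then (i) implies (ii). Conversely, if in addition there is $C'>0$ with $[\widehat{\psi^0},\widehat{\psi^0}](\xi)\ge C'I_r$ and $[\widehat{\tilde\psi^0},\widehat{\tilde\psi^0}](\xi)\ge C'I_r$ for almost every $\xi\in\mathbb R^d$, then (ii) implies (i). -/

import Mathlib

open MeasureTheory Filter Topology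
open scoped FourierTransform ENNReal

namespace MixedFramelet

noncomputable section

/-! ### The ambient spaces -/

/-- The Euclidean space of dimension `d`. -/
abbrev E (d : ℕ) : Type := EuclideanSpace ℝ (Fin d)

/-- The integer lattice. -/
abbrev Z (d : ℕ) : Type := Fin d → ℤ

/-- Square integrable complex functions on `E d`. -/
abbrev L2 (d : ℕ) : Type := Lp ℂ 2 (volume : Measure (E d))

/-- A lattice point, as a point of Euclidean space. -/
def pt {d : ℕ} (k : Z d) : E d := WithLp.toLp 2 (fun i => (k i : ℝ))

/-- An integer matrix, as a real matrix. -/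
def re {d : ℕ} (M : Matrix (Fin d) (Fin d) ℤ) : Matrix (Fin d) (Fin d) ℝ :=
  M.map (fun n : ℤ => (n : ℝ))

/-- The matrix-vector product `A x`. -/
def act {d : ℕ} (A : Matrix (Fin d) (Fin d) ℝ) (x : E d) : E d := Matrix.toEuclideanLin A x

/-- A dilation matrix: an integer matrix all of whose (complex) eigenvalues are greater than `1`
in modulus. -/
def IsDilationMatrix {d : ℕ} (M : Matrix (Fin d) (Fin d) ℤ) : Prop :=
  ∀ z ∈ spectrum ℂ (M.map (fun n : ℤ => (n : ℂ))), 1 < ‖z‖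

/-- The real matrix of a dilation matrix is invertible. -/
theorem IsDilationMatrix.det_re_ne_zero {d : ℕ} {M : Matrix (Fin d) (Fin d) ℤ}
    (hM : IsDilationMatrix M) : (re M).det ≠ 0 := by
  intro h
  have h1 : ((M.det : ℤ) : ℝ) = 0 := by
    rw [← h]; exact Int.cast_det M
  have h2 : (M.map (fun n : ℤ => (n : ℂ))).det = 0 := by
    have h3 : ((M.det : ℤ) : ℂ) = 0 := by exact_mod_cast h1
    rw [← h3]; exact (Int.cast_det M).symm
  have h4 : (0 : ℂ) ∈ spectrum ℂ (M.map (fun n : ℤ => (n : ℂ))) := by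
    rw [spectrum.zero_mem_iff, Matrix.isUnit_iff_isUnit_det, h2]
    simp
  have := hM 0 h4
  simp at this
  linarith

/-! ### Filters, discrete framelet transforms and filter banks -/

/-- A finitely supported filter on the integer lattice with `t × r` matrix values. -/
abbrev Filt (d t r : ℕ) : Type := Z d →₀ Matrix (Fin t) (Fin r) ℂ

/-- The Fourier series `∑ₖ u(k) exp(-i k·ξ)` of a finitely supported sequence. -/
def fourierSeries {d : ℕ} {V : Type*} [AddCommMonoid V] [Module ℂ V]
    (u : Z d →₀ V) (ξ : E d) : V :=
  u.sum fun k c => Complex.exp (-(Complex.I * ((inner ℝ (pt k) ξ : ℝ) : ℂ))) • c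

/-- The transition operator
`u ↦ (n ↦ |det M|^{1/2} ∑ₖ u(k) b(k - M n)ᴴ)`; the finite sum is written over `m = k - M n`. -/
def transition {d t r q : ℕ} (M : Matrix (Fin d) (Fin d) ℤ) (b : Filt d t r)
    (u : Z d → Matrix (Fin q) (Fin r) ℂ) (n : Z d) : Matrix (Fin q) (Fin t) ℂ :=
  ((Real.sqrt |(M.det : ℝ)| : ℝ) : ℂ) •
    b.sum fun m B => u (m + M.mulVec n) * B.conjTranspose

/-- The low-pass part `v_{0,j}` of the discrete framelet decomposition of `v`:
`v_{0,0} = v` and `v_{0,j+1} = T_{b₀,M₀} v_{0,j}`. -/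
def lowPass {d r : ℕ} (M₀ : Matrix (Fin d) (Fin d) ℤ) (b₀ : Filt d r r)
    (v : Z d → Matrix (Fin 1) (Fin r) ℂ) : ℕ → Z d → Matrix (Fin 1) (Fin r) ℂ
  | 0 => v
  | j + 1 => transition M₀ b₀ (lowPass M₀ b₀ v j)

/-- The `J`-level discrete framelet analysis operator of a filter bank: it maps `v` to the
family `v_{l,j}` (`l = 1,…,s`, `j = 1,…,J`; here `j : Fin J` stands for the level `j + 1`)
together with `v_{0,J}`. -/
def analysis {d r s : ℕ} (M : Fin (s + 1) → Matrix (Fin d) (Fin d) ℤ)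
    (b₀ : Filt d r r) (b : Fin s → Filt d 1 r) (J : ℕ) (v : Z d → Matrix (Fin 1) (Fin r) ℂ) :
    (Fin J → Fin s → Z d → Matrix (Fin 1) (Fin 1) ℂ) × (Z d → Matrix (Fin 1) (Fin r) ℂ) :=
  (fun j l => transition (M l.succ) (b l) (lowPass (M 0) b₀ v j), lowPass (M 0) b₀ v J)

/-- The squared `l₂` norm, with values in `[0, ∞]`, of a sequence of matrices. -/
def sqNorm {d q t : ℕ} (v : Z d → Matrix (Fin q) (Fin t) ℂ) : ℝ≥0∞ :=
  ∑' k, ∑ i, ∑ j, ‖v k i j‖ₑ ^ 2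

/-- The squared `l₂` norm of the output of the analysis operator. -/
def analysisSqNorm {d r s J : ℕ}
    (w : (Fin J → Fin s → Z d → Matrix (Fin 1) (Fin 1) ℂ) × (Z d → Matrix (Fin 1) (Fin r) ℂ)) :
    ℝ≥0∞ :=
  (∑ j, ∑ l, sqNorm (w.1 j l)) + sqNorm w.2

/-- Stability of a filter bank in `l₂`. -/
def HasStability {d r s : ℕ} (M : Fin (s + 1) → Matrix (Fin d) (Fin d) ℤ)
    (b₀ : Filt d r r) (b : Fin s → Filt d 1 r) : Prop :=
  ∃ C₁ C₂ : ℝ, 0 < C₁ ∧ 0 < C₂ ∧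
    ∀ J : ℕ, 1 ≤ J → ∀ v : Z d → Matrix (Fin 1) (Fin r) ℂ, sqNorm v < ∞ →
      ENNReal.ofReal C₁ * sqNorm v ≤ analysisSqNorm (analysis M b₀ b J v) ∧
      analysisSqNorm (analysis M b₀ b J v) ≤ ENNReal.ofReal C₂ * sqNorm v

/-- The set `Ω_M = M^{-ᵀ} ℤᵈ ∩ [0,1)ᵈ`. -/
def Omega {d : ℕ} (M : Matrix (Fin d) (Fin d) ℤ) : Set (E d) :=
  {ω | (∃ k : Z d, ω = act ((re M).transpose)⁻¹ (pt k)) ∧ ∀ i, 0 ≤ ω i ∧ ω i < 1}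

open Classical in
/-- Dual framelet filter banks with mixed dilation factors. -/
def IsDualFrameletFilterBank {d r s : ℕ} (M : Fin (s + 1) → Matrix (Fin d) (Fin d) ℤ)
    (b₀ : Filt d r r) (b : Fin s → Filt d 1 r)
    (b₀' : Filt d r r) (b' : Fin s → Filt d 1 r) : Prop :=
  ∀ ω ∈ ⋃ l, Omega (M l), ∀ᵐ ξ : E d,
    (if ω ∈ Omega (M 0) then
        (fourierSeries b₀ ξ).conjTranspose * fourierSeries b₀' (ξ + (2 * Real.pi) • ω)
      else 0) +
    ∑ l : Fin s, (if ω ∈ Omega (M l.succ) then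
        (fourierSeries (b l) ξ).conjTranspose * fourierSeries (b' l) (ξ + (2 * Real.pi) • ω)
      else 0)
    = if ω = 0 then (1 : Matrix (Fin r) (Fin r) ℂ) else 0

/-! ### Fourier transforms and standard refinable vector functions -/

/-- Functions in `L₂` of compact support. -/
def IsCompactlySupported {d : ℕ} (f : L2 d) : Prop :=
  ∃ K : Set (E d), IsCompact K ∧ ∀ᵐ x : E d, x ∉ K → f x = 0

/-- The Fourier integral `∫ f(x) exp(-i x·ξ) dx` (for integrable `f`, such as compactly supported
square integrable functions). -/
def fourierIntegralHat {d : ℕ} (f : E d → ℂ) (ξ : E d) : ℂ :=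
  ∫ x : E d, f x * Complex.exp (-(Complex.I * ((inner ℝ x ξ : ℝ) : ℂ)))

/-- The extension to `L₂` of the Fourier transform `∫ f(x) exp(-i x·ξ) dx`. Mathlib's `𝓕` has the
kernel `exp(-2πi x·ξ)`, hence the rescaling. -/
def fourierL2Hat {d : ℕ} (f : L2 d) (ξ : E d) : ℂ :=
  (𝓕 f : L2 d) ((2 * Real.pi)⁻¹ • ξ)

/-- The entrywise Fourier transform of a vector function of compact support. -/
def vecHat {d r : ℕ} (φ : Fin r → L2 d) (ξ : E d) : Fin r → ℂ :=
  fun q => fourierIntegralHat (φ q) ξ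

/-- `φ` is (the Fourier transform of) a standard `M₀`-refinable vector function associated to the
filter `b₀`: for some matrix norm `N`, some constants `C₀, C_b, τ > 0` and some finitely supported
`u`, the two conditions below hold, and
`φ(ξ) = lim_n (∏_{j=1}^n b̂₀((M₀^{-ᵀ})^j ξ)) û((M₀^{-ᵀ})^n ξ)` for all `ξ`. -/
def IsStandardRefinableHat {d r : ℕ} (M₀ : Matrix (Fin d) (Fin d) ℤ) (b₀ : Filt d r r)
    (φ : E d → Fin r → ℂ) : Prop :=
  ∃ (N : AlgebraNorm ℂ (Matrix (Fin r) (Fin r) ℂ)) (C₀ C_b τ : ℝ) (u : Z d →₀ (Fin r → ℂ)),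
    0 < C₀ ∧ 0 < C_b ∧ 0 < τ ∧
    Real.logb 2 (N (fourierSeries b₀ 0) + C₀) ≤ τ ∧
    (∀ ξ : E d, (∀ i, |ξ i| ≤ Real.pi) →
      ‖(fourierSeries b₀ ξ).mulVec (fourierSeries u ξ) - fourierSeries u (act (re M₀).transpose ξ)‖
        ≤ C_b * ‖ξ‖ ^ τ) ∧
    ∀ ξ : E d, Tendsto (fun n : ℕ =>
      (((List.range n).map fun j =>
          fourierSeries b₀ (act (((re M₀).transpose)⁻¹ ^ (j + 1)) ξ)).prod).mulVec
        (fourierSeries u (act (((re M₀).transpose)⁻¹ ^ n) ξ))) atTop (𝓝 (φ ξ))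

/-- The bracket product `[f,g](ξ) = ∑ₖ f(ξ + 2πk) g(ξ + 2πk)ᴴ`. The series converges absolutely
almost everywhere when the entries of `f` and `g` are square integrable. -/
def bracket {d r : ℕ} (f g : E d → Fin r → ℂ) (ξ : E d) : Matrix (Fin r) (Fin r) ℂ :=
  Matrix.of fun p q =>
    ∑' k : Z d, f (ξ + (2 * Real.pi) • pt k) p * star (g (ξ + (2 * Real.pi) • pt k) q)

section

open scoped ComplexOrder

/-- `[φ,φ](ξ) + [φ',φ'](ξ) ≤ C I_r` for almost every `ξ`, for some `C > 0`, where `A ≤ B` means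
that `B - A` is positive semi-definite. -/
def BracketsBoundedAbove {d r : ℕ} (φ φ' : E d → Fin r → ℂ) : Prop :=
  ∃ C : ℝ, 0 < C ∧ ∀ᵐ ξ : E d,
    ((C : ℂ) • (1 : Matrix (Fin r) (Fin r) ℂ) - (bracket φ φ ξ + bracket φ' φ' ξ)).PosSemidef

/-- `[φ,φ](ξ) ≥ C' I_r` and `[φ',φ'](ξ) ≥ C' I_r` for almost every `ξ`, for some `C' > 0`. -/
def BracketsBoundedBelow {d r : ℕ} (φ φ' : E d → Fin r → ℂ) : Prop :=
  ∃ C' : ℝ, 0 < C' ∧ ∀ᵐ ξ : E d,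
    (bracket φ φ ξ - (C' : ℂ) • (1 : Matrix (Fin r) (Fin r) ℂ)).PosSemidef ∧
    (bracket φ' φ' ξ - (C' : ℂ) • (1 : Matrix (Fin r) (Fin r) ℂ)).PosSemidef

end

/-! ### Affine systems and dual framelets -/

theorem memLp_dilate {d : ℕ} {U : Matrix (Fin d) (Fin d) ℝ} (hU : U.det ≠ 0) (t : E d)
    (f : L2 d) :
    MemLp (fun x : E d => ((Real.sqrt |U.det| : ℝ) : ℂ) * f (act U x - t)) 2 volume := by
  have hdet : LinearMap.det (Matrix.toEuclideanLin U) ≠ 0 := by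
    have : LinearMap.det (Matrix.toEuclideanLin U) = U.det := by
      change LinearMap.det (Matrix.toLpLin 2 2 U) = U.det
      rw [Matrix.toLpLin_eq_toLin, LinearMap.det_toLin]
    rwa [this]
  have hlin : MemLp (fun x : E d => f (x - t)) 2 volume :=
    (Lp.memLp f).comp_measurePreserving (measurePreserving_sub_right volume t)
  have hcont : Continuous (Matrix.toEuclideanLin U) := LinearMap.continuous_of_finiteDimensional _
  have hmap : MemLp (fun x : E d => f (x - t)) 2
      (Measure.map (Matrix.toEuclideanLin U) (volume : Measure (E d))) := by
    rw [Measure.map_linearMap_addHaar_eq_smul_addHaar volume hdet]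
    exact hlin.smul_measure ENNReal.ofReal_ne_top
  exact (hmap.comp_of_map hcont.aemeasurable).const_mul _

open Classical in
/-- The function `f_{U;t} = |det U|^{1/2} f(U · - t)` in `L₂`, for an invertible matrix `U`
(and `0` if the matrix is singular). -/
def dilate {d : ℕ} (U : Matrix (Fin d) (Fin d) ℝ) (t : E d) (f : L2 d) : L2 d :=
  if h : U.det ≠ 0 then (memLp_dilate h t f).toLp else 0

/-- The affine system generated by `ψ⁰ = (ψ⁰_1,…,ψ⁰_r)` and `ψ¹,…,ψˢ` with mixed dilation factors
`M 0, …, M s`: the functions `ψ⁰_q(· - k)` and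
`|det(M₀⁻¹ M_l)|^{1/2} ψˡ_{M₀^j; M₀⁻¹ M_l k}` with `j ≥ 0`. -/
def affineSystem {d r s : ℕ} (M : Fin (s + 1) → Matrix (Fin d) (Fin d) ℤ)
    (ψ₀ : Fin r → L2 d) (ψ : Fin s → L2 d) :
    (Fin r × Z d) ⊕ (Fin s × ℕ × Z d) → L2 d
  | Sum.inl (q, k) => dilate 1 (pt k) (ψ₀ q)
  | Sum.inr (l, j, k) =>
      ((Real.sqrt |((re (M 0))⁻¹ * re (M l.succ)).det| : ℝ) : ℂ) •
        dilate (re (M 0) ^ j) (act ((re (M 0))⁻¹ * re (M l.succ)) (pt k)) (ψ l)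

/-- Frames of a Hilbert space. -/
def IsFrame {ι H : Type*} [NormedAddCommGroup H] [InnerProductSpace ℂ H] (e : ι → H) : Prop :=
  ∃ C₁ C₂ : ℝ, 0 < C₁ ∧ 0 < C₂ ∧ ∀ f : H,
    Summable (fun i => ‖inner ℂ (e i) f‖ ^ 2) ∧
    C₁ * ‖f‖ ^ 2 ≤ ∑' i, ‖inner ℂ (e i) f‖ ^ 2 ∧
    ∑' i, ‖inner ℂ (e i) f‖ ^ 2 ≤ C₂ * ‖f‖ ^ 2

/-- Dual framelets in `L₂` with mixed dilation factors: both affine systems are frames, and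
`⟨f,g⟩ = ∑ᵢ ⟨f,eᵢ⟩ ⟨e'ᵢ,g⟩` with absolute convergence. (Mathlib's `inner` is conjugate linear in
its first argument, so the pairing `∫ f ḡ` is `inner ℂ g f`.) -/
def IsDualFramelet {d r s : ℕ} (M : Fin (s + 1) → Matrix (Fin d) (Fin d) ℤ)
    (ψ₀ : Fin r → L2 d) (ψ : Fin s → L2 d) (ψ₀' : Fin r → L2 d) (ψ' : Fin s → L2 d) : Prop :=
  IsFrame (affineSystem M ψ₀ ψ) ∧ IsFrame (affineSystem M ψ₀' ψ') ∧
  ∀ f g : L2 d,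
    Summable (fun i => ‖inner ℂ (affineSystem M ψ₀ ψ i) f *
      inner ℂ g (affineSystem M ψ₀' ψ' i)‖) ∧
    inner ℂ g f = ∑' i, inner ℂ (affineSystem M ψ₀ ψ i) f * inner ℂ g (affineSystem M ψ₀' ψ' i)

end

end MixedFramelet

open MixedFramelet

/-!
The refinement equations turn the theorem into Hilbert space geometry. Let `D` be the unitary dilation
by `M₀`, let `φ_{q,k}` be the integer shifts of the refinable functions, and let `V f` be the sequence
of coefficients `⟨f, φ_{q,k}⟩` (`coef`). The refinement equations say that the transition operators of
the filters act on coefficients by `T₀ V f = V (D f)`, and that `T_l V f` is the sequence of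
coefficients of `D f` with respect to the wavelets of the coarsest level
(`IsRefined.transition_coef`). So the `J`-level analysis of `V (D⁻ᴶ f)` is the part of the affine
coefficients of `f` below level `J` (`analysisSqNorm_coef`).

*Filter banks.* On the level of sequences, a dual framelet filter bank is the same as perfect
reconstruction, `⟨u, v⟩ = ∑_l ⟨T_l u, T̃_l v⟩` for square summable `u, v`
(`isDualFrameletFilterBank_iff`). This uses the orthogonality of the characters indexed by `Ω_l`, which
expands membership in the lattice `M_l ℤᵈ` (`sum_Omega_expo`), and the linear independence of
characters with distinct frequencies (`eq_zero_of_sum_expo_eq_zero`), which separates the frequencies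
`ω` although the sets `Ω_l` differ.

*Compact support.* For compactly supported `f` the series `∑ₖ |f̂(ξ + 2πk)|²` is bounded in `ξ`, since
`f̂(ξ + 2πk)` are the Fourier coefficients of a locally finite periodization
(`exists_tsum_hat_sq_le`). Hence the brackets are bounded above (`bracketsBoundedAbove`) and the shifts
form a Bessel family (`isBessel_shifts`).

*From filter banks to framelets* (`dualFrame_of_filterBank`). Iterating perfect reconstruction expands
`⟨V D⁻ᴶ f, Ṽ D⁻ᴶ g⟩` into the affine coefficients below level `J`. As `J → ∞` the left-hand side tends to
`⟨f, g⟩` (`tendsto_pair_coef`): for continuous `f, g` of compact support it is the integral of a step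
function converging to `f ḡ` times the normalisation `∑_q conj φ̂_q(0) φ̃^_q(0) = 1`, and the Bessel
property allows passage to all of `L₂`. Stability gives the upper frame bounds, and duality the lower
ones.

*From framelets to filter banks.* A lower bound for the bracket makes the synthesis operator bounded
below (`le_enorm_synth_sq`), so by the Hahn–Banach and Riesz theorems every square summable sequence is
`V f` for some `f` of controlled norm (`hasBoundedInterpolation_of_le`). The upper frame bound then
becomes the upper stability bound (`upperStability_of_isFrame`), and comparison of the expansions of
`⟨f, g⟩` and `⟨D f, D g⟩` gives perfect reconstruction (`perfectReconstruction_of_dualFrame`). The lower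
stability bounds again follow by duality (`PerfectReconstruction.hasStability`).
-/

namespace MixedFramelet

/-! ### The action of matrices on Euclidean space -/

section LinearAction

variable {d : ℕ}

lemma act_apply (A : Matrix (Fin d) (Fin d) ℝ) (x : E d) (i : Fin d) :
    act A x i = ∑ j, A i j * x j := by
  simp [act, Matrix.toLpLin_apply, Matrix.mulVec, dotProduct]

lemma act_eq_toLp (A : Matrix (Fin d) (Fin d) ℝ) (x : E d) :
    act A x = WithLp.toLp 2 (A.mulVec x.ofLp) := by
  simp [act, Matrix.toLpLin_apply]

lemma act_add (A : Matrix (Fin d) (Fin d) ℝ) (x y : E d) : act A (x + y) = act A x + act A y :=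
  map_add _ _ _

lemma act_sub (A : Matrix (Fin d) (Fin d) ℝ) (x y : E d) : act A (x - y) = act A x - act A y :=
  map_sub _ _ _

lemma act_smul (A : Matrix (Fin d) (Fin d) ℝ) (c : ℝ) (x : E d) : act A (c • x) = c • act A x :=
  map_smul _ _ _

lemma act_zero (A : Matrix (Fin d) (Fin d) ℝ) : act A (0 : E d) = 0 := map_zero _

lemma act_one (x : E d) : act 1 x = x := by
  simp [act_eq_toLp]

lemma act_act (A B : Matrix (Fin d) (Fin d) ℝ) (x : E d) : act A (act B x) = act (A * B) x := by
  simp [act_eq_toLp, Matrix.mulVec_mulVec]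

lemma continuous_act (A : Matrix (Fin d) (Fin d) ℝ) : Continuous (act A) :=
  LinearMap.continuous_of_finiteDimensional _

lemma inner_act (A : Matrix (Fin d) (Fin d) ℝ) (x y : E d) :
    inner ℝ (act A x) y = inner ℝ x (act A.transpose y) := by
  simp only [act_eq_toLp, EuclideanSpace.inner_eq_star_dotProduct, star_trivial]
  rw [Matrix.mulVec_transpose, Matrix.dotProduct_mulVec]

lemma pt_apply (k : Z d) (i : Fin d) : pt k i = (k i : ℝ) := rfl

lemma pt_add (k l : Z d) : pt (k + l) = pt k + pt l := by
  ext i; simp [pt_apply]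

lemma pt_neg (k : Z d) : pt (-k) = -pt k := by
  ext i; simp [pt_apply]

lemma pt_sub (k l : Z d) : pt (k - l) = pt k - pt l := by
  ext i; simp [pt_apply]

lemma pt_zero : pt (0 : Z d) = 0 := by
  ext i; simp [pt_apply]

lemma pt_injective : Function.Injective (pt : Z d → E d) := by
  intro k l h
  ext i
  have := congrArg (fun x : E d => x i) h
  simpa [pt_apply] using this

lemma act_re_pt (M : Matrix (Fin d) (Fin d) ℤ) (k : Z d) :
    act (re M) (pt k) = pt (M.mulVec k) := by
  ext i
  simp [act_apply, pt_apply, re, Matrix.mulVec, dotProduct]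

lemma det_re (M : Matrix (Fin d) (Fin d) ℤ) : (re M).det = (M.det : ℝ) :=
  (Int.cast_det M).symm

lemma inner_pt (k : Z d) (x : E d) : (inner ℝ (pt k) x : ℝ) = ∑ i, (k i : ℝ) * x i := by
  simp [PiLp.inner_apply, pt_apply, mul_comm]

lemma exists_int_inner_pt (k l : Z d) : (inner ℝ (pt k) (pt l) : ℝ) = ((∑ i, k i * l i : ℤ) : ℝ) := by
  simp [inner_pt, pt_apply]

lemma det_toEuclideanLin (A : Matrix (Fin d) (Fin d) ℝ) :
    LinearMap.det (Matrix.toEuclideanLin A) = A.det := by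
  change LinearMap.det (Matrix.toLpLin 2 2 A) = A.det
  rw [Matrix.toLpLin_eq_toLin, LinearMap.det_toLin]

lemma measurableEmbedding_act {A : Matrix (Fin d) (Fin d) ℝ} (hA : A.det ≠ 0) :
    MeasurableEmbedding (act A : E d → E d) := by
  have h1 : ∀ x : E d, act A⁻¹ (act A x) = x := fun x => by
    rw [act_act, Matrix.nonsing_inv_mul _ (isUnit_iff_ne_zero.2 hA), act_one]
  have h2 : ∀ x : E d, act A (act A⁻¹ x) = x := fun x => by
    rw [act_act, Matrix.mul_nonsing_inv _ (isUnit_iff_ne_zero.2 hA), act_one]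
  let e : E d ≃ₜ E d := ⟨⟨act A, act A⁻¹, h1, h2⟩, continuous_act A, continuous_act A⁻¹⟩
  exact e.measurableEmbedding

lemma map_act {A : Matrix (Fin d) (Fin d) ℝ} (hA : A.det ≠ 0) :
    Measure.map (act A) (volume : Measure (E d)) = ENNReal.ofReal |A.det|⁻¹ • volume := by
  have := Measure.map_linearMap_addHaar_eq_smul_addHaar (volume : Measure (E d))
    (f := Matrix.toEuclideanLin A) (by rwa [det_toEuclideanLin])
  rw [det_toEuclideanLin, abs_inv] at this
  exact this

lemma lintegral_comp_act {A : Matrix (Fin d) (Fin d) ℝ} (hA : A.det ≠ 0) (f : E d → ℝ≥0∞) :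
    ∫⁻ x, f (act A x) = ENNReal.ofReal |A.det|⁻¹ * ∫⁻ x, f x := by
  rw [← (measurableEmbedding_act hA).lintegral_map, map_act hA, lintegral_smul_measure, smul_eq_mul]

lemma integral_comp_act {F : Type*} [NormedAddCommGroup F] [NormedSpace ℝ F]
    {A : Matrix (Fin d) (Fin d) ℝ} (hA : A.det ≠ 0) (f : E d → F) :
    ∫ x, f (act A x) = |A.det|⁻¹ • ∫ x, f x := by
  rw [← (measurableEmbedding_act hA).integral_map, map_act hA, integral_smul_measure,
    ENNReal.toReal_ofReal (by positivity)]

lemma quasiMeasurePreserving_act {A : Matrix (Fin d) (Fin d) ℝ} (hA : A.det ≠ 0) :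
    Measure.QuasiMeasurePreserving (act A) (volume : Measure (E d)) volume :=
  ⟨(continuous_act A).measurable, by rw [map_act hA]; exact Measure.smul_absolutelyContinuous⟩

/-- The powers of the inverse of a dilation matrix tend to zero: its spectral radius is less
than one. -/
lemma IsDilationMatrix.tendsto_inv_pow {M : Matrix (Fin d) (Fin d) ℤ} (hM : IsDilationMatrix M) :
    Tendsto (fun n : ℕ => ((re M)⁻¹ ^ n : Matrix (Fin d) (Fin d) ℝ)) atTop (𝓝 0) := by
  rcases Nat.eq_zero_or_pos d with rfl | hd
  · have : ∀ n : ℕ, ((re M)⁻¹ ^ n : Matrix (Fin 0) (Fin 0) ℝ) = 0 := fun n => Subsingleton.elim _ _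
    exact tendsto_const_nhds.congr fun n => (this n).symm
  have : Nonempty (Fin d) := ⟨⟨0, hd⟩⟩
  let : NormedRing (Matrix (Fin d) (Fin d) ℂ) := Matrix.linftyOpNormedRing
  let : NormedAlgebra ℂ (Matrix (Fin d) (Fin d) ℂ) := Matrix.linftyOpNormedAlgebra
  have : CompleteSpace (Matrix (Fin d) (Fin d) ℂ) := FiniteDimensional.complete ℂ _
  set A : Matrix (Fin d) (Fin d) ℂ := M.map (fun n : ℤ => (n : ℂ)) with hA
  set B : Matrix (Fin d) (Fin d) ℂ := ((re M)⁻¹).map (algebraMap ℝ ℂ) with hB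
  have hdet := hM.det_re_ne_zero
  have hAre : A = (re M).map (algebraMap ℝ ℂ) := by
    ext i j; simp [hA, re]
  have hBA : B * A = 1 := by
    rw [hAre, hB, ← Matrix.map_mul, Matrix.nonsing_inv_mul _ (isUnit_iff_ne_zero.2 hdet)]
    simp
  have hAB : A * B = 1 := by
    rw [hAre, hB, ← Matrix.map_mul, Matrix.mul_nonsing_inv _ (isUnit_iff_ne_zero.2 hdet)]
    simp
  let u : (Matrix (Fin d) (Fin d) ℂ)ˣ := ⟨B, A, hBA, hAB⟩
  have hspec : ∀ z ∈ spectrum ℂ B, ‖z‖₊ < 1 := by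
    intro z hz
    have h0 : z ≠ 0 := by
      rintro rfl
      exact (spectrum.zero_notMem ℂ (⟨u, rfl⟩ : IsUnit B)) hz
    have h1 : z⁻¹ ∈ spectrum ℂ A := by
      have h2 := spectrum.inv_mem_iff (r := Units.mk0 z h0) (a := u)
      have h3 := h2.1 (by simpa [u] using hz)
      simpa [u] using h3
    have h2 := hM _ h1
    rw [norm_inv] at h2
    have hz0 : 0 < ‖z‖ := norm_pos_iff.2 h0
    have : ‖z‖ < 1 := by
      by_contra hcon
      have := inv_le_one_of_one_le₀ (not_lt.1 hcon)
      linarith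
    exact_mod_cast this
  -- the spectrum is compact, so the supremum defining the spectral radius is attained
  have hrad : spectralRadius ℂ B < 1 := by
    have := spectrum.spectralRadius_lt_of_forall_lt B (r := 1) hspec
    simpa using this
  have hlim : Tendsto (fun n : ℕ => B ^ n) atTop (𝓝 0) := by
    obtain ⟨c, hc1, hc2⟩ := exists_between hrad
    -- Gelfand's formula: eventually `‖Bⁿ‖ ≤ cⁿ`
    have hg := spectrum.pow_nnnorm_pow_one_div_tendsto_nhds_spectralRadius B
    have hev := hg.eventually_lt_const hc1
    have hc0 : Tendsto (fun n : ℕ => c ^ n) atTop (𝓝 0) := ENNReal.tendsto_pow_atTop_nhds_zero_of_lt_one hc2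
    have h3 : Tendsto (fun n : ℕ => (‖B ^ n‖₊ : ℝ≥0∞)) atTop (𝓝 0) := by
      refine tendsto_of_tendsto_of_tendsto_of_le_of_le' tendsto_const_nhds hc0
        (Eventually.of_forall fun _ => bot_le) ?_
      filter_upwards [hev, eventually_gt_atTop 0] with n hn hn0
      have h4 : ((‖B ^ n‖₊ : ℝ≥0∞) ^ (1 / n : ℝ)) ^ n ≤ c ^ n := pow_le_pow_left' hn.le n
      have h5 : ((‖B ^ n‖₊ : ℝ≥0∞) ^ (1 / n : ℝ)) ^ n = ‖B ^ n‖₊ := by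
        rw [← ENNReal.rpow_natCast, ← ENNReal.rpow_mul]
        have : (n : ℝ) ≠ 0 := by positivity
        simp [this]
      rwa [h5] at h4
    have h6 := (ENNReal.tendsto_toReal ENNReal.zero_ne_top).comp h3
    have h7 : Tendsto (fun n : ℕ => ‖B ^ n‖) atTop (𝓝 0) := by simpa [Function.comp_def] using h6
    exact tendsto_zero_iff_norm_tendsto_zero.2 h7
  have hre : ∀ n : ℕ, ((re M)⁻¹ ^ n : Matrix (Fin d) (Fin d) ℝ) = (B ^ n).map Complex.re := by
    intro n
    rw [hB, ← Matrix.map_pow]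
    ext i j
    simp
  simp_rw [hre]
  have hcont : Continuous (fun X : Matrix (Fin d) (Fin d) ℂ => X.map Complex.re) :=
    continuous_id.matrix_map Complex.continuous_re
  have := (hcont.tendsto 0).comp hlim
  simpa [Function.comp_def] using this

end LinearAction


/-! ### Exponentials and the unit cube -/

section Cube

variable {d : ℕ}

/-- The exponential `exp(-i x·ξ)`. -/
noncomputable def expo (x ξ : E d) : ℂ :=
  Complex.exp (-(Complex.I * ((inner ℝ x ξ : ℝ) : ℂ)))

lemma norm_expo (x ξ : E d) : ‖expo x ξ‖ = 1 := by
  rw [expo, Complex.norm_exp]; simp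

lemma expo_ne_zero (x ξ : E d) : expo x ξ ≠ 0 := Complex.exp_ne_zero _

lemma expo_add_left (x y ξ : E d) : expo (x + y) ξ = expo x ξ * expo y ξ := by
  simp only [expo, inner_add_left, ← Complex.exp_add]; congr 1; push_cast; ring

lemma expo_add_right (x ξ η : E d) : expo x (ξ + η) = expo x ξ * expo x η := by
  simp only [expo, inner_add_right, ← Complex.exp_add]; congr 1; push_cast; ring

lemma expo_zero_left (ξ : E d) : expo 0 ξ = 1 := by simp [expo]

lemma expo_zero_right (x : E d) : expo x 0 = 1 := by simp [expo]

lemma star_expo (x ξ : E d) : star (expo x ξ) = expo (-x) ξ := by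
  simp only [expo, inner_neg_left, Complex.star_def, ← Complex.exp_conj]
  simp

lemma expo_comm (x ξ : E d) : expo x ξ = expo ξ x := by
  simp only [expo, real_inner_comm]

lemma expo_smul (c : ℝ) (x ξ : E d) : expo x (c • ξ) = expo (c • x) ξ := by
  simp only [expo, real_inner_smul_left, real_inner_smul_right]

lemma expo_act (A : Matrix (Fin d) (Fin d) ℝ) (x ξ : E d) :
    expo (act A x) ξ = expo x (act A.transpose ξ) := by
  simp only [expo, inner_act]

lemma expo_pt_two_pi (k l : Z d) : expo (pt k) ((2 * Real.pi) • pt l) = 1 := by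
  rw [expo, real_inner_smul_right, exists_int_inner_pt, Complex.exp_eq_one_iff]
  refine ⟨-(∑ i, k i * l i), ?_⟩
  push_cast; ring

lemma continuous_expo_left (ξ : E d) : Continuous (fun x : E d => expo x ξ) := by
  unfold expo; fun_prop

lemma continuous_expo_right (x : E d) : Continuous (fun ξ : E d => expo x ξ) := by
  unfold expo; fun_prop

/-- The half-open unit cube centred at the origin, a fundamental domain for the integer lattice. -/
def cube (d : ℕ) : Set (E d) := {x | ∀ i, x i ∈ Set.Ioc (-1 / 2 : ℝ) (-1 / 2 + 1)}

/-- The lattice point `k` such that `x` lies in the translate of the cube by `k`. -/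
noncomputable def rnd (x : E d) : Z d := fun i => ⌈x i - 1 / 2⌉

lemma measurable_rnd : Measurable (rnd : E d → Z d) := by
  unfold rnd
  refine measurable_pi_lambda _ fun i => ?_
  exact Int.measurable_ceil.comp (by fun_prop)

lemma measurableSet_cube : MeasurableSet (cube d) := by
  have : cube d = ⋂ i, (fun x : E d => x i) ⁻¹' Set.Ioc (-1 / 2 : ℝ) (-1 / 2 + 1) := by
    ext x; simp [cube]
  rw [this]
  refine MeasurableSet.iInter fun i => ?_
  have : Measurable (fun x : E d => x i) := by fun_prop
  exact this measurableSet_Ioc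

lemma sub_pt_mem_cube_iff (x : E d) (k : Z d) : x - pt k ∈ cube d ↔ rnd x = k := by
  constructor
  · intro h
    ext i
    have := h i
    simp only [PiLp.sub_apply, pt_apply, Set.mem_Ioc] at this
    simp only [rnd]
    rw [Int.ceil_eq_iff]
    constructor <;> linarith [this.1, this.2]
  · rintro rfl i
    simp only [PiLp.sub_apply, pt_apply, Set.mem_Ioc, rnd]
    have h1 := Int.ceil_lt_add_one (x i - 1 / 2)
    have h2 := Int.le_ceil (x i - 1 / 2)
    constructor <;> linarith

lemma norm_le_of_mem_cube {x : E d} (hx : x ∈ cube d) : ‖x‖ ≤ Real.sqrt d := by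
  rw [EuclideanSpace.norm_eq]
  apply Real.sqrt_le_sqrt
  calc ∑ i, ‖x i‖ ^ 2 ≤ ∑ i : Fin d, (1 : ℝ) := by
        refine Finset.sum_le_sum fun i _ => ?_
        have := hx i
        simp only [Set.mem_Ioc] at this
        rw [Real.norm_eq_abs, sq_abs]
        nlinarith [this.1, this.2]
    _ = d := by simp

/-- The integral over the space is the sum of the integrals over the translates of the cube. -/
lemma lintegral_eq_tsum_cube (f : E d → ℝ≥0∞) :
    ∫⁻ x, f x = ∑' k : Z d, ∫⁻ x in cube d, f (x + pt k) := by
  have hU : (⋃ k : Z d, {x : E d | rnd x = k}) = Set.univ := by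
    ext x; simp
  have hm : ∀ k : Z d, MeasurableSet {x : E d | rnd x = k} := fun k =>
    measurable_rnd (measurableSet_singleton k)
  have hd : Pairwise (Function.onFun Disjoint fun k : Z d => {x : E d | rnd x = k}) := by
    intro k l hkl
    rw [Function.onFun, Set.disjoint_left]
    rintro x rfl h
    exact hkl h
  rw [← setLIntegral_univ, ← hU, lintegral_iUnion hm hd]
  refine tsum_congr fun k => ?_
  have hmp := measurePreserving_add_right (volume : Measure (E d)) (pt k)
  have h1 := hmp.setLIntegral_comp_preimage_emb (MeasurableEquiv.addRight (pt k)).measurableEmbedding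
    f {x : E d | rnd x = k}
  rw [← h1]
  congr 2
  ext x
  have := sub_pt_mem_cube_iff (x + pt k) k
  simp only [add_sub_cancel_right] at this
  simp [this]

lemma cube_eq_preimage : cube d = (WithLp.ofLp) ⁻¹'
    {x : Fin d → ℝ | ∀ i, x i ∈ Set.Ioc ((fun _ => (-1 / 2 : ℝ)) i) ((fun _ => (-1 / 2 : ℝ)) i + 1)} :=
  rfl

lemma volume_cube : volume (cube d) = 1 := by
  rw [cube_eq_preimage, (PiLp.volume_preserving_ofLp (Fin d)).measure_preimage_emb
    (MeasurableEquiv.toLp 2 (Fin d → ℝ)).symm.measurableEmbedding]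
  have : {x : Fin d → ℝ | ∀ i, x i ∈ Set.Ioc ((fun _ => (-1 / 2 : ℝ)) i) ((fun _ => (-1 / 2 : ℝ)) i + 1)}
      = Set.pi Set.univ fun _ => Set.Ioc (-1 / 2 : ℝ) (-1 / 2 + 1) := by
    ext x; simp
  rw [this, volume_pi_pi]
  simp

instance : IsProbabilityMeasure ((volume : Measure (E d)).restrict (cube d)) :=
  ⟨by simp [volume_cube]⟩

end Cube


/-! ### Fourier series on the cube -/

section Torus

variable {d : ℕ}

/-- The torus carries the normalised Haar measure. -/
noncomputable local instance : MeasureSpace UnitAddCircle := ⟨AddCircle.haarAddCircle⟩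

local instance : Measure.IsAddHaarMeasure (volume : Measure UnitAddCircle) :=
  inferInstanceAs (Measure.IsAddHaarMeasure AddCircle.haarAddCircle)

local instance : IsProbabilityMeasure (volume : Measure UnitAddCircle) :=
  inferInstanceAs (IsProbabilityMeasure AddCircle.haarAddCircle)

/-- The bijection between the torus and the cube. -/
noncomputable def torusToCube (t : UnitAddTorus (Fin d)) : E d :=
  WithLp.toLp 2 (UnitAddTorus.measurableEquivPiIoc (fun _ : Fin d => (-1 / 2 : ℝ)) t).1

lemma measurable_torusToCube : Measurable (torusToCube : UnitAddTorus (Fin d) → E d) :=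
  (MeasurableEquiv.toLp 2 (Fin d → ℝ)).measurable.comp
    (measurable_subtype_coe.comp (UnitAddTorus.measurableEquivPiIoc _).measurable)

lemma torusToCube_coe {x : E d} (hx : x ∈ cube d) :
    torusToCube (fun i => ((x i : ℝ) : UnitAddCircle)) = x := by
  have h := (UnitAddTorus.measurableEquivPiIoc (fun _ : Fin d => (-1 / 2 : ℝ))).apply_symm_apply
    ⟨x.ofLp, hx⟩
  rw [UnitAddTorus.coe_symm_measurableEquivPiIoc_apply] at h
  simp only at h
  rw [torusToCube, h]

lemma lintegral_torusToCube (g : E d → ℝ≥0∞) :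
    ∫⁻ t, g (torusToCube t) = ∫⁻ x in cube d, g x := by
  rw [UnitAddTorus.lintegral_preimage _ (fun _ => (-1 / 2 : ℝ))]
  rw [← (PiLp.volume_preserving_ofLp (Fin d)).setLIntegral_comp_preimage_emb
    (MeasurableEquiv.toLp 2 (Fin d → ℝ)).symm.measurableEmbedding]
  rw [← cube_eq_preimage]
  exact setLIntegral_congr_fun measurableSet_cube fun x hx => by
    change g (torusToCube (fun i => ((x i : ℝ) : UnitAddCircle))) = g x
    rw [torusToCube_coe hx]

lemma integral_torusToCube {F : Type*} [NormedAddCommGroup F] [NormedSpace ℝ F] (g : E d → F) :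
    ∫ t, g (torusToCube t) = ∫ x in cube d, g x := by
  rw [UnitAddTorus.integral_preimage _ (fun _ => (-1 / 2 : ℝ))]
  rw [← (PiLp.volume_preserving_ofLp (Fin d)).setIntegral_preimage_emb
    (MeasurableEquiv.toLp 2 (Fin d → ℝ)).symm.measurableEmbedding]
  rw [← cube_eq_preimage]
  exact setIntegral_congr_fun measurableSet_cube fun x hx => by
    change g (torusToCube (fun i => ((x i : ℝ) : UnitAddCircle))) = g x
    rw [torusToCube_coe hx]

lemma map_torusToCube :
    Measure.map torusToCube (volume : Measure (UnitAddTorus (Fin d))) = volume.restrict (cube d) := by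
  ext s hs
  rw [Measure.map_apply measurable_torusToCube hs, ← lintegral_indicator_one
    (measurable_torusToCube hs), ← lintegral_indicator_one hs, ← lintegral_torusToCube]
  rfl

lemma measurePreserving_torusToCube :
    MeasurePreserving torusToCube (volume : Measure (UnitAddTorus (Fin d)))
      (volume.restrict (cube d)) :=
  ⟨measurable_torusToCube, map_torusToCube⟩

/-- The characters of the torus are the exponentials on the cube. -/
lemma mFourier_neg_apply (k : Z d) (t : UnitAddTorus (Fin d)) :
    UnitAddTorus.mFourier (-k) t = expo (pt k) ((2 * Real.pi) • torusToCube t) := by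
  obtain ⟨x, rfl⟩ : ∃ x : Fin d → ℝ, (fun i => ((x i : ℝ) : UnitAddCircle)) = t :=
    ⟨fun i => (UnitAddTorus.measurableEquivPiIoc (fun _ : Fin d => (-1 / 2 : ℝ)) t).1 i,
      (UnitAddTorus.measurableEquivPiIoc (fun _ : Fin d => (-1 / 2 : ℝ))).symm_apply_apply t⟩
  obtain ⟨y, hy, hyx⟩ : ∃ y ∈ cube d, ∀ i, ((y i : ℝ) : UnitAddCircle) = x i := by
    refine ⟨WithLp.toLp 2 x - pt (rnd (WithLp.toLp 2 x)), (sub_pt_mem_cube_iff _ _).2 rfl,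
      fun i => ?_⟩
    simp only [PiLp.sub_apply, pt_apply]
    rw [AddCircle.coe_sub]
    have := AddCircle.coe_add_period (1 : ℝ) 0
    have h2 : (((rnd (WithLp.toLp 2 x) i : ℤ) : ℝ) : UnitAddCircle) = 0 := by
      rw [AddCircle.coe_eq_zero_iff]
      exact ⟨rnd (WithLp.toLp 2 x) i, by simp⟩
    rw [h2, sub_zero]
  have hx : (fun i => ((x i : ℝ) : UnitAddCircle)) = fun i => ((y i : ℝ) : UnitAddCircle) := by
    ext i; exact (hyx i).symm
  rw [hx, torusToCube_coe hy]
  simp only [UnitAddTorus.mFourier, ContinuousMap.coe_mk, fourier_coe_apply, Pi.neg_apply]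
  rw [← Complex.exp_sum, expo, real_inner_smul_right, inner_pt]
  congr 1
  push_cast
  rw [Finset.mul_sum, Finset.mul_sum, ← Finset.sum_neg_distrib]
  refine Finset.sum_congr rfl fun i _ => ?_
  ring

/-- Parseval's identity on the cube. -/
lemma hasSum_sq_coeff_cube {g : E d → ℂ} (hg : MemLp g 2 (volume.restrict (cube d))) :
    HasSum (fun k : Z d => ‖∫ x in cube d, g x * expo (pt k) ((2 * Real.pi) • x)‖ ^ 2)
      (∫ x in cube d, ‖g x‖ ^ 2) := by
  have hG : MemLp (fun t : UnitAddTorus (Fin d) => g (torusToCube t)) 2 volume :=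
    hg.comp_measurePreserving measurePreserving_torusToCube
  have h := UnitAddTorus.hasSum_sq_mFourierCoeff (hG.toLp _)
  have h1 : ∀ k : Z d, UnitAddTorus.mFourierCoeff (hG.toLp _) k =
      ∫ x in cube d, g x * expo (pt k) ((2 * Real.pi) • x) := by
    intro k
    rw [UnitAddTorus.mFourierCoeff, ← integral_torusToCube]
    refine integral_congr_ae ?_
    filter_upwards [hG.coeFn_toLp] with t ht
    rw [ht, mFourier_neg_apply, smul_eq_mul, mul_comm]
  have h2 : ∫ t, ‖hG.toLp _ t‖ ^ 2 = ∫ x in cube d, ‖g x‖ ^ 2 := by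
    rw [← integral_torusToCube]
    refine integral_congr_ae ?_
    filter_upwards [hG.coeFn_toLp] with t ht
    rw [ht]
  rw [h2] at h
  simpa only [h1] using h

lemma integral_expo_cube (k : Z d) :
    ∫ x in cube d, expo (pt k) ((2 * Real.pi) • x) = if k = 0 then 1 else 0 := by
  have h := (orthonormal_iff_ite.1 (UnitAddTorus.orthonormal_mFourier (d := Fin d))) k 0
  rw [ContinuousMap.inner_toLp] at h
  rw [← integral_torusToCube, ← h]
  refine integral_congr_ae (Eventually.of_forall fun t => ?_)
  simp only [← mFourier_neg_apply, UnitAddTorus.mFourier_zero, UnitAddTorus.mFourier_neg]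
  simp

/-- Parseval's identity for trigonometric polynomials. -/
lemma lintegral_trigPoly_cube (w : Z d →₀ ℂ) :
    ∫⁻ x in cube d, ‖fourierSeries w ((2 * Real.pi) • x)‖ₑ ^ 2 = ∑' k, ‖w k‖ₑ ^ 2 := by
  have hcont : Continuous fun x : E d => fourierSeries w ((2 * Real.pi) • x) := by
    unfold fourierSeries Finsupp.sum
    refine continuous_finsetSum _ fun k _ => ?_
    exact ((continuous_expo_right (pt k)).comp (continuous_const_smul _)).smul continuous_const
  have hbd : ∀ x : E d, ‖fourierSeries w ((2 * Real.pi) • x)‖ ≤ ∑ k ∈ w.support, ‖w k‖ := by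
    intro x
    refine (norm_sum_le _ _).trans (Finset.sum_le_sum fun k _ => ?_)
    rw [norm_smul]
    exact (congrArg (· * ‖w k‖) (norm_expo (pt k) _)).le.trans (one_mul _).le
  have hg : MemLp (fun x : E d => fourierSeries w ((2 * Real.pi) • x)) 2
      (volume.restrict (cube d)) :=
    MemLp.of_bound hcont.aestronglyMeasurable _ (Eventually.of_forall hbd)
  have h := hasSum_sq_coeff_cube hg
  -- the sign comes from the conjugation in the Fourier coefficients
  have hc : ∀ k : Z d, ∫ x in cube d, fourierSeries w ((2 * Real.pi) • x) *
      expo (pt k) ((2 * Real.pi) • x) = w (-k) := by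
    intro k
    have : ∀ x : E d, fourierSeries w ((2 * Real.pi) • x) * expo (pt k) ((2 * Real.pi) • x) =
        ∑ l ∈ w.support, w l * expo (pt (l + k)) ((2 * Real.pi) • x) := by
      intro x
      rw [fourierSeries, Finsupp.sum, Finset.sum_mul]
      refine Finset.sum_congr rfl fun l _ => ?_
      rw [pt_add, expo_add_left, smul_eq_mul]
      change expo (pt l) _ * _ * _ = _
      ring
    simp_rw [this]
    rw [integral_finsetSum]
    · simp_rw [integral_const_mul, integral_expo_cube]
      simp only [mul_ite, mul_one, mul_zero, add_eq_zero_iff_eq_neg]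
      rw [Finset.sum_ite_eq']
      split_ifs with hk
      · rfl
      · exact (Finsupp.notMem_support_iff.1 hk).symm
    · intro l _
      refine Integrable.const_mul ?_ _
      refine Integrable.of_bound (C := 1) ?_ (Eventually.of_forall fun x => (norm_expo _ _).le)
      exact ((continuous_expo_right _).comp (continuous_const_smul _)).aestronglyMeasurable
  simp_rw [hc] at h
  have h3 : ∫⁻ x in cube d, ‖fourierSeries w ((2 * Real.pi) • x)‖ₑ ^ 2 =
      ENNReal.ofReal (∫ x in cube d, ‖fourierSeries w ((2 * Real.pi) • x)‖ ^ 2) := by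
    rw [ofReal_integral_eq_lintegral_ofReal]
    · refine lintegral_congr fun x => ?_
      rw [ENNReal.ofReal_pow (norm_nonneg _), ofReal_norm]
    · exact (memLp_two_iff_integrable_sq_norm hcont.aestronglyMeasurable).1 hg
    · exact Eventually.of_forall fun x => by positivity
  rw [h3, ← h.tsum_eq, ENNReal.ofReal_tsum_of_nonneg (fun _ => by positivity) h.summable]
  rw [← (Equiv.neg (Z d)).tsum_eq]
  refine tsum_congr fun k => ?_
  simp only [Equiv.neg_apply, neg_neg]
  rw [ENNReal.ofReal_pow (norm_nonneg _), ofReal_norm]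

end Torus


/-! ### Dilations and translations -/

section Dilation

variable {d : ℕ}

lemma quasiMeasurePreserving_act_sub {U : Matrix (Fin d) (Fin d) ℝ} (hU : U.det ≠ 0) (t : E d) :
    Measure.QuasiMeasurePreserving (fun x : E d => act U x - t) volume volume :=
  (measurePreserving_sub_right (volume : Measure (E d)) t).quasiMeasurePreserving.comp
    (quasiMeasurePreserving_act hU)

lemma coeFn_dilate {U : Matrix (Fin d) (Fin d) ℝ} (hU : U.det ≠ 0) (t : E d) (f : L2 d) :
    dilate U t f =ᵐ[volume] fun x => ((Real.sqrt |U.det| : ℝ) : ℂ) * f (act U x - t) := by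
  rw [dilate, dif_pos hU]
  exact MemLp.coeFn_toLp _

lemma dilate_add {U : Matrix (Fin d) (Fin d) ℝ} (hU : U.det ≠ 0) (t : E d) (f g : L2 d) :
    dilate U t (f + g) = dilate U t f + dilate U t g := by
  apply Lp.ext
  filter_upwards [coeFn_dilate hU t (f + g), coeFn_dilate hU t f, coeFn_dilate hU t g,
    Lp.coeFn_add (dilate U t f) (dilate U t g),
    (quasiMeasurePreserving_act_sub hU t).ae (Lp.coeFn_add f g)] with x h1 h2 h3 h4 h5
  rw [h1, h4, Pi.add_apply, h2, h3, h5, Pi.add_apply, mul_add]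

lemma dilate_smul {U : Matrix (Fin d) (Fin d) ℝ} (hU : U.det ≠ 0) (t : E d) (c : ℂ) (f : L2 d) :
    dilate U t (c • f) = c • dilate U t f := by
  apply Lp.ext
  filter_upwards [coeFn_dilate hU t (c • f), coeFn_dilate hU t f,
    Lp.coeFn_smul c (dilate U t f),
    (quasiMeasurePreserving_act_sub hU t).ae (Lp.coeFn_smul c f)] with x h1 h2 h4 h5
  rw [h1, h4, Pi.smul_apply, h2, h5, Pi.smul_apply, smul_eq_mul, smul_eq_mul]
  ring

lemma dilate_dilate {U V : Matrix (Fin d) (Fin d) ℝ} (hU : U.det ≠ 0) (hV : V.det ≠ 0) (s t : E d)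
    (f : L2 d) : dilate U t (dilate V s f) = dilate (V * U) (act V t + s) f := by
  have hVU : (V * U).det ≠ 0 := by rw [Matrix.det_mul]; exact mul_ne_zero hV hU
  apply Lp.ext
  filter_upwards [coeFn_dilate hU t (dilate V s f), coeFn_dilate hVU (act V t + s) f,
    (quasiMeasurePreserving_act_sub hU t).ae (coeFn_dilate hV s f)] with x h1 h2 h3
  rw [h1, h2, h3, act_sub, act_act, Matrix.det_mul, abs_mul, Real.sqrt_mul (abs_nonneg _),
    sub_sub]
  push_cast
  ring

lemma dilate_one_zero (f : L2 d) : dilate 1 0 f = f := by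
  apply Lp.ext
  filter_upwards [coeFn_dilate (U := (1 : Matrix (Fin d) (Fin d) ℝ)) (by simp) 0 f] with x h
  rw [h]; simp [act_one]

lemma lintegral_comp_act_sub {U : Matrix (Fin d) (Fin d) ℝ} (hU : U.det ≠ 0) (t : E d)
    (f : E d → ℝ≥0∞) :
    ∫⁻ x, f (act U x - t) = ENNReal.ofReal |U.det|⁻¹ * ∫⁻ x, f x := by
  rw [lintegral_comp_act hU (fun x => f (x - t)), lintegral_sub_right_eq_self f t]

lemma enorm_sq_L2 (f : L2 d) : ‖f‖ₑ ^ 2 = ∫⁻ x, ‖f x‖ₑ ^ 2 := by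
  rw [Lp.enorm_def, eLpNorm_eq_lintegral_rpow_enorm_toReal (by norm_num) (by norm_num)]
  simp only [ENNReal.toReal_ofNat]
  rw [← ENNReal.rpow_natCast, ← ENNReal.rpow_mul]
  norm_num

lemma norm_dilate {U : Matrix (Fin d) (Fin d) ℝ} (hU : U.det ≠ 0) (t : E d) (f : L2 d) :
    ‖dilate U t f‖ = ‖f‖ := by
  have h : ‖dilate U t f‖ₑ ^ 2 = ‖f‖ₑ ^ 2 := by
    rw [enorm_sq_L2, enorm_sq_L2]
    have h1 : ∫⁻ x, ‖dilate U t f x‖ₑ ^ 2 =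
        ∫⁻ x, ENNReal.ofReal |U.det| * ‖f (act U x - t)‖ₑ ^ 2 := by
      refine lintegral_congr_ae ?_
      filter_upwards [coeFn_dilate hU t f] with x hx
      rw [hx, enorm_mul, mul_pow]
      congr 1
      rw [← ofReal_norm, Complex.norm_real, Real.norm_of_nonneg (Real.sqrt_nonneg _),
        ← ENNReal.ofReal_pow (Real.sqrt_nonneg _), Real.sq_sqrt (abs_nonneg _)]
    rw [h1, lintegral_const_mul' _ _ ENNReal.ofReal_ne_top,
      lintegral_comp_act_sub hU t (fun x => ‖f x‖ₑ ^ 2), ← mul_assoc, ← ENNReal.ofReal_mul (abs_nonneg _),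
      mul_inv_cancel₀ (abs_ne_zero.2 hU), ENNReal.ofReal_one, one_mul]
  have h2 : ‖dilate U t f‖ₑ = ‖f‖ₑ := (ENNReal.pow_right_strictMono two_ne_zero).injective h
  have h3 := congrArg ENNReal.toReal h2
  simpa using h3

/-- The unitary operator `f ↦ |det U|^{1/2} f(U · - t)`. -/
noncomputable def dilateEquiv (U : Matrix (Fin d) (Fin d) ℝ) (hU : U.det ≠ 0) (t : E d) :
    L2 d ≃ₗᵢ[ℂ] L2 d where
  toFun := dilate U t
  map_add' := dilate_add hU t
  map_smul' := dilate_smul hU t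
  invFun := dilate U⁻¹ (-(act U⁻¹ t))
  left_inv f := by
    have hU' : (U⁻¹).det ≠ 0 := by
      rw [Matrix.det_nonsing_inv, Ring.inverse_eq_inv']; exact inv_ne_zero hU
    rw [dilate_dilate hU' hU, Matrix.mul_nonsing_inv _ (isUnit_iff_ne_zero.2 hU)]
    have : act U (-(act U⁻¹ t)) + t = 0 := by
      rw [← neg_one_smul ℝ, act_smul, act_act, Matrix.mul_nonsing_inv _ (isUnit_iff_ne_zero.2 hU),
        act_one]
      simp
    rw [this, dilate_one_zero]
  right_inv f := by
    have hU' : (U⁻¹).det ≠ 0 := by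
      rw [Matrix.det_nonsing_inv, Ring.inverse_eq_inv']; exact inv_ne_zero hU
    rw [dilate_dilate hU hU', Matrix.nonsing_inv_mul _ (isUnit_iff_ne_zero.2 hU), add_neg_cancel,
      dilate_one_zero]
  norm_map' := norm_dilate hU t

@[simp]
lemma dilateEquiv_apply (U : Matrix (Fin d) (Fin d) ℝ) (hU : U.det ≠ 0) (t : E d) (f : L2 d) :
    dilateEquiv U hU t f = dilate U t f := rfl

/-- The levels of an affine system are the images of the coarsest level under the powers of one
unitary operator. -/
lemma dilate_pow_eq {U : Matrix (Fin d) (Fin d) ℝ} (hU : U.det ≠ 0) (j : ℕ) (t : E d) (f : L2 d) :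
    dilate (U ^ j) t f = ((dilateEquiv U hU 0) ^ j) (dilate 1 t f) := by
  induction j generalizing t f with
  | zero =>
    simp only [pow_zero]
    rfl
  | succ j ih =>
    have hUj : (U ^ j).det ≠ 0 := by rw [Matrix.det_pow]; exact pow_ne_zero _ hU
    rw [pow_succ', pow_succ, LinearIsometryEquiv.coe_mul, Function.comp_apply, dilateEquiv_apply]
    have h1 : dilate U 0 (dilate 1 t f) = dilate 1 0 (dilate U t f) := by
      rw [dilate_dilate hU (by simp), dilate_dilate (by simp) hU]
      simp [act_zero]
    rw [h1, ← ih, dilate_dilate hUj hU]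
    simp [act_zero]

lemma translate_dilate {U : Matrix (Fin d) (Fin d) ℝ} (hU : U.det ≠ 0) (t : E d) (f : L2 d) :
    dilate 1 t (dilate U 0 f) = dilate U 0 (dilate 1 (act U t) f) := by
  rw [dilate_dilate (by simp) hU, dilate_dilate hU (by simp)]
  simp [act_zero]

lemma translate_translate (s t : E d) (f : L2 d) :
    dilate 1 t (dilate 1 s f) = dilate 1 (s + t) f := by
  rw [dilate_dilate (by simp) (by simp)]
  simp [act_one, add_comm]

end Dilation


/-! ### The Fourier transform of compactly supported functions -/

section FourierTransform

variable {d : ℕ}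

lemma IsCompactlySupported.integrable {f : L2 d} (hf : IsCompactlySupported f) :
    Integrable f volume := by
  obtain ⟨K, hK, hfK⟩ := hf
  have h1 : IntegrableOn f K volume := by
    have : Fact ((volume : Measure (E d)) K < ⊤) := ⟨hK.measure_lt_top⟩
    exact ((Lp.memLp f).restrict K).integrable (by norm_num)
  exact h1.integrable_of_ae_notMem_eq_zero hfK

lemma fourierIntegralHat_eq_integral_expo (f : E d → ℂ) (ξ : E d) :
    fourierIntegralHat f ξ = ∫ x, f x * expo x ξ := rfl

lemma fourierIntegralHat_eq (f : E d → ℂ) (ξ : E d) :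
    fourierIntegralHat f ξ = 𝓕 f ((2 * Real.pi)⁻¹ • ξ) := by
  rw [Real.fourier_eq', fourierIntegralHat]
  refine integral_congr_ae (Eventually.of_forall fun x => ?_)
  simp only [real_inner_smul_right, smul_eq_mul]
  rw [mul_comm]
  congr 2
  have : (Real.pi : ℂ) ≠ 0 := by exact_mod_cast Real.pi_ne_zero
  push_cast
  field_simp

/-- For integrable functions in `L₂`, the Fourier transform on `L₂` is given by the Fourier
integral: both define the same tempered distribution. -/
lemma coeFn_fourier_ae_eq {f : L2 d} (hf : Integrable f volume) :
    (𝓕 f : L2 d) =ᵐ[volume] 𝓕 (f : E d → ℂ) := by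
  have hcont : Continuous (𝓕 (f : E d → ℂ)) :=
    VectorFourier.fourierIntegral_continuous Real.continuous_fourierChar
      (by exact continuous_inner) hf
  have h1 : LocallyIntegrable (fun x => (𝓕 f : L2 d) x - 𝓕 (f : E d → ℂ) x) volume :=
    ((Lp.memLp (𝓕 f : L2 d)).locallyIntegrable (by norm_num)).sub hcont.locallyIntegrable
  have h2 : ∀ g : E d → ℝ, ContDiff ℝ (⊤ : ℕ∞) g → HasCompactSupport g →
      ∫ x, g x • ((𝓕 f : L2 d) x - 𝓕 (f : E d → ℂ) x) = 0 := by
    intro g hg hgc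
    have hgc' : HasCompactSupport (fun x => (g x : ℂ)) := hgc.comp_left (g := fun r : ℝ => (r : ℂ)) rfl
    have hg' : ContDiff ℝ (⊤ : ℕ∞) (fun x => (g x : ℂ)) := Complex.ofRealCLM.contDiff.comp hg
    set G : SchwartzMap (E d) ℂ := hgc'.toSchwartzMap hg' with hG
    have hGx : ∀ x, G x = (g x : ℂ) := fun x => rfl
    have e1 := congrArg (fun T : TemperedDistribution (E d) ℂ => T G)
      (Lp.fourier_toTemperedDistribution_eq f)
    simp only [TemperedDistribution.fourier_apply, Lp.toTemperedDistribution_apply] at e1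
    have e2 : ∫ x, G x • 𝓕 (f : E d → ℂ) x = ∫ x, (𝓕 G) x • f x := by
      have := VectorFourier.integral_fourierIntegral_smul_eq_flip (e := Real.fourierChar)
        (L := innerₗ (E d)) (f := (G : E d → ℂ)) (g := (f : E d → ℂ)) (μ := volume) (ν := volume)
        Real.continuous_fourierChar (by exact continuous_inner) G.integrable hf
      rw [flip_innerₗ] at this
      rw [SchwartzMap.fourier_coe]
      exact this.symm
    have i1 : Integrable (fun x => G x • (𝓕 f : L2 d) x) := by
      have := (Lp.memLp (𝓕 f : L2 d)).locallyIntegrable (by norm_num)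
      exact this.integrable_smul_left_of_hasCompactSupport hg'.continuous hgc'
    have i2 : Integrable (fun x => G x • 𝓕 (f : E d → ℂ) x) :=
      hcont.locallyIntegrable.integrable_smul_left_of_hasCompactSupport hg'.continuous hgc'
    have e3 : ∀ x, g x • ((𝓕 f : L2 d) x - 𝓕 (f : E d → ℂ) x) =
        G x • (𝓕 f : L2 d) x - G x • 𝓕 (f : E d → ℂ) x := by
      intro x; rw [hGx, ← smul_sub]; simp
    simp_rw [e3]
    rw [integral_sub i1 i2, e2, e1, sub_self]
  filter_upwards [ae_eq_zero_of_integral_contDiff_smul_eq_zero h1 h2] with x hx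
  exact sub_eq_zero.1 hx

lemma two_pi_pos : 0 < 2 * Real.pi := by positivity

lemma quasiMeasurePreserving_const_smul {c : ℝ} (hc : c ≠ 0) :
    Measure.QuasiMeasurePreserving (fun η : E d => c • η) volume volume := by
  refine ⟨(continuous_const_smul _).measurable, ?_⟩
  rw [Measure.map_addHaar_smul _ hc]
  exact Measure.smul_absolutelyContinuous

/-- Plancherel's formula for compactly supported functions. -/
lemma lintegral_hat_sq {f : L2 d} (hf : IsCompactlySupported f) :
    ∫⁻ η, ‖fourierIntegralHat f ((2 * Real.pi) • η)‖ₑ ^ 2 = ‖f‖ₑ ^ 2 := by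
  have h1 : ‖(𝓕 f : L2 d)‖ₑ = ‖f‖ₑ := by
    rw [← ofReal_norm, ← ofReal_norm, Lp.norm_fourier_eq]
  rw [← h1, enorm_sq_L2]
  refine lintegral_congr_ae ?_
  filter_upwards [coeFn_fourier_ae_eq hf.integrable] with η hη
  rw [hη, fourierIntegralHat_eq, smul_smul, inv_mul_cancel₀ two_pi_pos.ne', one_smul]

/-- A function in `L₂` is determined by its Fourier transform; only the second function is assumed
to have compact support. -/
lemma eq_of_fourierL2Hat_ae_eq {f g : L2 d} (hg : IsCompactlySupported g)
    (h : ∀ᵐ ξ, fourierL2Hat f ξ = fourierIntegralHat g ξ) : f = g := by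
  apply (Lp.fourierTransformₗᵢ (E d) ℂ).injective
  change (𝓕 f : L2 d) = (𝓕 g : L2 d)
  apply Lp.ext
  have hq := quasiMeasurePreserving_const_smul (d := d) two_pi_pos.ne'
  filter_upwards [coeFn_fourier_ae_eq hg.integrable, hq.ae h] with η h1 h2
  rw [h1, fourierL2Hat, fourierIntegralHat_eq] at *
  rwa [smul_smul, inv_mul_cancel₀ two_pi_pos.ne', one_smul] at h2

lemma eq_of_hat_eq {f g : L2 d} (hf : IsCompactlySupported f) (hg : IsCompactlySupported g)
    (h : ∀ ξ, fourierIntegralHat f ξ = fourierIntegralHat g ξ) : f = g := by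
  refine eq_of_fourierL2Hat_ae_eq hg ?_
  have hq := quasiMeasurePreserving_const_smul (d := d) (inv_ne_zero two_pi_pos.ne')
  filter_upwards [hq.ae (coeFn_fourier_ae_eq hf.integrable)] with ξ h1
  rw [fourierL2Hat, h1, ← fourierIntegralHat_eq, h]

lemma continuous_hat {f : E d → ℂ} (hf : Integrable f volume) :
    Continuous (fourierIntegralHat f) := by
  have hcont : Continuous (𝓕 f) :=
    VectorFourier.fourierIntegral_continuous Real.continuous_fourierChar
      (by exact continuous_inner) hf
  have : fourierIntegralHat f = fun ξ => 𝓕 f ((2 * Real.pi)⁻¹ • ξ) :=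
    funext (fourierIntegralHat_eq f)
  rw [this]
  exact hcont.comp (continuous_const_smul _)

lemma fourierIntegralHat_congr_ae {f g : E d → ℂ} (h : f =ᵐ[volume] g) :
    fourierIntegralHat f = fourierIntegralHat g := by
  funext ξ
  refine integral_congr_ae ?_
  filter_upwards [h] with x hx
  rw [hx]

lemma integrable_mul_expo {f : E d → ℂ} (hf : Integrable f volume) (ξ : E d) :
    Integrable (fun x => f x * expo x ξ) volume := by
  refine hf.mul_bdd (c := 1) ?_ ?_
  · exact (continuous_expo_left ξ).aestronglyMeasurable
  · exact Eventually.of_forall fun x => (norm_expo x ξ).le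

lemma hat_add {f g : L2 d} (hf : Integrable f volume) (hg : Integrable g volume) (ξ : E d) :
    fourierIntegralHat (f + g : L2 d) ξ = fourierIntegralHat f ξ + fourierIntegralHat g ξ := by
  rw [fourierIntegralHat_congr_ae (Lp.coeFn_add f g)]
  simp only [fourierIntegralHat_eq_integral_expo]
  rw [← integral_add (integrable_mul_expo hf ξ) (integrable_mul_expo hg ξ)]
  simp only [Pi.add_apply, add_mul]

lemma hat_smul (c : ℂ) (f : L2 d) (ξ : E d) :
    fourierIntegralHat (c • f : L2 d) ξ = c * fourierIntegralHat f ξ := by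
  rw [fourierIntegralHat_congr_ae (Lp.coeFn_smul c f)]
  rw [fourierIntegralHat, fourierIntegralHat, ← integral_const_mul]
  simp only [Pi.smul_apply, smul_eq_mul, mul_assoc]

lemma hat_zero (ξ : E d) : fourierIntegralHat (0 : L2 d) ξ = 0 := by
  have := hat_smul (0 : ℂ) (0 : L2 d) ξ
  simpa using this

lemma isCompactlySupported_zero : IsCompactlySupported (0 : L2 d) := by
  refine ⟨∅, isCompact_empty, ?_⟩
  filter_upwards [Lp.coeFn_zero ℂ 2 (volume : Measure (E d))] with x hx _
  rw [hx]; rfl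

lemma IsCompactlySupported.add {f g : L2 d} (hf : IsCompactlySupported f)
    (hg : IsCompactlySupported g) : IsCompactlySupported (f + g) := by
  obtain ⟨K, hK, hfK⟩ := hf
  obtain ⟨L, hL, hgL⟩ := hg
  refine ⟨K ∪ L, hK.union hL, ?_⟩
  filter_upwards [hfK, hgL, Lp.coeFn_add f g] with x h1 h2 h3 hx
  rw [h3, Pi.add_apply, h1 fun h => hx (Or.inl h), h2 fun h => hx (Or.inr h), add_zero]

lemma IsCompactlySupported.smul {f : L2 d} (hf : IsCompactlySupported f) (c : ℂ) :
    IsCompactlySupported (c • f) := by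
  obtain ⟨K, hK, hfK⟩ := hf
  refine ⟨K, hK, ?_⟩
  filter_upwards [hfK, Lp.coeFn_smul c f] with x h1 h3 hx
  rw [h3, Pi.smul_apply, h1 hx, smul_zero]

lemma IsCompactlySupported.sum {ι : Type*} (s : Finset ι) {f : ι → L2 d}
    (hf : ∀ i ∈ s, IsCompactlySupported (f i)) : IsCompactlySupported (∑ i ∈ s, f i) := by
  classical
  induction s using Finset.induction_on with
  | empty => simpa using isCompactlySupported_zero
  | insert i s hi ih =>
    rw [Finset.sum_insert hi]
    exact (hf i (Finset.mem_insert_self i s)).add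
      (ih fun j hj => hf j (Finset.mem_insert_of_mem hj))

lemma hat_sum {ι : Type*} (s : Finset ι) {f : ι → L2 d}
    (hf : ∀ i ∈ s, IsCompactlySupported (f i)) (ξ : E d) :
    fourierIntegralHat (∑ i ∈ s, f i : L2 d) ξ = ∑ i ∈ s, fourierIntegralHat (f i) ξ := by
  classical
  induction s using Finset.induction_on with
  | empty => simpa using hat_zero ξ
  | insert i s hi ih =>
    have h2 : ∀ j ∈ s, IsCompactlySupported (f j) := fun j hj => hf j (Finset.mem_insert_of_mem hj)
    rw [Finset.sum_insert hi, Finset.sum_insert hi, hat_add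
      (hf i (Finset.mem_insert_self i s)).integrable (IsCompactlySupported.sum s h2).integrable,
      ih h2]

lemma IsCompactlySupported.dilate {f : L2 d} (hf : IsCompactlySupported f)
    {U : Matrix (Fin d) (Fin d) ℝ} (hU : U.det ≠ 0) (t : E d) :
    IsCompactlySupported (dilate U t f) := by
  obtain ⟨K, hK, hfK⟩ := hf
  refine ⟨(fun y => act U⁻¹ (y + t)) '' K, hK.image ((continuous_act _).comp (by fun_prop)), ?_⟩
  filter_upwards [(quasiMeasurePreserving_act_sub hU t).ae hfK, coeFn_dilate hU t f] with x h1 h2 hx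
  rw [h2, h1, mul_zero]
  intro hK'
  refine hx ⟨_, hK', ?_⟩
  simp only [sub_add_cancel]
  rw [act_act, Matrix.nonsing_inv_mul _ (isUnit_iff_ne_zero.2 hU), act_one]

lemma hat_translate (f : L2 d) (t ξ : E d) :
    fourierIntegralHat (dilate 1 t f) ξ = expo t ξ * fourierIntegralHat f ξ := by
  rw [fourierIntegralHat_congr_ae (coeFn_dilate (by simp) t f)]
  rw [fourierIntegralHat, fourierIntegralHat, ← integral_const_mul]
  rw [← integral_add_right_eq_self (μ := volume) _ t]
  refine integral_congr_ae (Eventually.of_forall fun x => ?_)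
  have : expo (x + t) ξ = expo x ξ * expo t ξ := expo_add_left _ _ _
  change _ * expo (x + t) ξ = expo t ξ * (f x * expo x ξ)
  simp [act_one, this]
  ring

lemma hat_dilate {U : Matrix (Fin d) (Fin d) ℝ} (hU : U.det ≠ 0) (f : L2 d) (ξ : E d) :
    fourierIntegralHat (dilate U 0 f) (act U.transpose ξ) =
      ((Real.sqrt |U.det| : ℝ) : ℂ)⁻¹ * fourierIntegralHat f ξ := by
  rw [fourierIntegralHat_congr_ae (coeFn_dilate hU 0 f)]
  have h1 : ∀ x, (((Real.sqrt |U.det| : ℝ) : ℂ) * f (act U x - 0)) * expo x (act U.transpose ξ) =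
      (fun y => ((Real.sqrt |U.det| : ℝ) : ℂ) * (f y * expo y ξ)) (act U x) := by
    intro x; simp only [sub_zero, expo_act]; ring
  change ∫ x, _ * expo x (act U.transpose ξ) = _
  simp_rw [h1]
  rw [integral_comp_act hU (fun y => ((Real.sqrt |U.det| : ℝ) : ℂ) * (f y * expo y ξ)),
    integral_const_mul]
  change _ • (_ * fourierIntegralHat f ξ) = _
  have hs : (Real.sqrt |U.det|) ≠ 0 := by
    rw [Real.sqrt_ne_zero']; exact abs_pos.2 hU
  have hs2 : |U.det| = Real.sqrt |U.det| * Real.sqrt |U.det| :=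
    (Real.mul_self_sqrt (abs_nonneg _)).symm
  rw [Complex.real_smul]
  have hs' : ((Real.sqrt |U.det| : ℝ) : ℂ) ≠ 0 := by exact_mod_cast hs
  conv_lhs => rw [hs2]
  push_cast
  field_simp
  simp

end FourierTransform


/-! ### Square summable sequences and their pairing -/

section Sequences

variable {d q t : ℕ}

/-- The pairing `∑ₖ ⟨u(k), v(k)⟩` of two sequences of matrices. -/
noncomputable def pair (u v : Z d → Matrix (Fin q) (Fin t) ℂ) : ℂ :=
  ∑' k, ∑ i, ∑ j, u k i j * star (v k i j)

lemma two_mul_enorm_mul_le {c : ℝ} (hc : 0 < c) (a b : ℂ) :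
    2 * ‖a * star b‖ₑ ≤ ENNReal.ofReal c * ‖a‖ₑ ^ 2 + ENNReal.ofReal c⁻¹ * ‖b‖ₑ ^ 2 := by
  have h : 2 * (‖a‖ * ‖b‖) ≤ c * ‖a‖ ^ 2 + c⁻¹ * ‖b‖ ^ 2 := by
    have h1 : 0 ≤ c * (‖a‖ - c⁻¹ * ‖b‖) ^ 2 := by positivity
    have h2 : c * (‖a‖ - c⁻¹ * ‖b‖) ^ 2 =
        c * ‖a‖ ^ 2 + c⁻¹ * ‖b‖ ^ 2 - 2 * (‖a‖ * ‖b‖) := by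
      field_simp; ring
    linarith
  have h3 := ENNReal.ofReal_le_ofReal h
  rw [ENNReal.ofReal_add (by positivity) (by positivity), ENNReal.ofReal_mul (by norm_num),
    ENNReal.ofReal_mul (norm_nonneg _), ENNReal.ofReal_mul hc.le,
    ENNReal.ofReal_mul (inv_nonneg.2 hc.le), ENNReal.ofReal_pow (norm_nonneg _),
    ENNReal.ofReal_pow (norm_nonneg _), ofReal_norm, ofReal_norm] at h3
  simpa [enorm_mul] using h3

/-- Young's inequality with a weight, which stands in for the Cauchy–Schwarz inequality where the
norms may be infinite. -/
lemma two_mul_enorm_pair_le {c : ℝ} (hc : 0 < c) (u v : Z d → Matrix (Fin q) (Fin t) ℂ) :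
    2 * ‖pair u v‖ₑ ≤ ENNReal.ofReal c * sqNorm u + ENNReal.ofReal c⁻¹ * sqNorm v := by
  have h1 : ‖pair u v‖ₑ ≤ ∑' k, ∑ i, ∑ j, ‖u k i j * star (v k i j)‖ₑ := by
    refine enorm_tsum_le_tsum_enorm.trans (ENNReal.tsum_le_tsum fun k => ?_)
    refine (enorm_sum_le _ _).trans (Finset.sum_le_sum fun i _ => ?_)
    exact enorm_sum_le _ _
  refine (mul_le_mul_right h1 2).trans ?_
  rw [sqNorm, sqNorm, ← ENNReal.tsum_mul_left, ← ENNReal.tsum_mul_left, ← ENNReal.tsum_mul_left,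
    ← ENNReal.tsum_add]
  refine ENNReal.tsum_le_tsum fun k => ?_
  simp only [Finset.mul_sum]
  rw [← Finset.sum_add_distrib]
  refine Finset.sum_le_sum fun i _ => ?_
  rw [← Finset.sum_add_distrib]
  exact Finset.sum_le_sum fun j _ => two_mul_enorm_mul_le hc _ _

lemma enorm_sq_le_sqNorm (v : Z d → Matrix (Fin q) (Fin t) ℂ) (i : Fin q) (j : Fin t) :
    ∑' k, ‖v k i j‖ₑ ^ 2 ≤ sqNorm v := by
  refine ENNReal.tsum_le_tsum fun k => ?_
  refine le_trans ?_ (Finset.single_le_sum (f := fun i => ∑ j, ‖v k i j‖ₑ ^ 2)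
    (fun _ _ => bot_le) (Finset.mem_univ i))
  exact Finset.single_le_sum (f := fun j => ‖v k i j‖ₑ ^ 2) (fun _ _ => bot_le) (Finset.mem_univ j)

lemma summable_sq_iff_enorm {ι : Type*} (a : ι → ℂ) :
    Summable (fun k => ‖a k‖ ^ 2) ↔ ∑' k, ‖a k‖ₑ ^ 2 ≠ ∞ := by
  have h1 : ∀ k, ‖a k‖ₑ ^ 2 = ENNReal.ofReal (‖a k‖ ^ 2) := fun k => by
    rw [ENNReal.ofReal_pow (norm_nonneg _), ofReal_norm]
  simp_rw [h1]
  exact ⟨fun h => h.tsum_ofReal_ne_top, fun h => by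
    simpa [ENNReal.toReal_ofReal, sq_nonneg] using ENNReal.summable_toReal h⟩

lemma tsum_enorm_sq_eq {ι : Type*} {a : ι → ℂ} (h : Summable fun k => ‖a k‖ ^ 2) :
    ∑' k, ‖a k‖ₑ ^ 2 = ENNReal.ofReal (∑' k, ‖a k‖ ^ 2) := by
  rw [ENNReal.ofReal_tsum_of_nonneg (fun _ => by positivity) h]
  exact tsum_congr fun k => by rw [ENNReal.ofReal_pow (norm_nonneg _), ofReal_norm]

lemma summable_sq_of_sqNorm {v : Z d → Matrix (Fin q) (Fin t) ℂ} (hv : sqNorm v < ∞)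
    (i : Fin q) (j : Fin t) : Summable fun k => ‖v k i j‖ ^ 2 :=
  (summable_sq_iff_enorm fun k => v k i j).2 ((enorm_sq_le_sqNorm v i j).trans_lt hv).ne

lemma summable_mul_of_summable_sq {ι : Type*} {a b : ι → ℂ} (ha : Summable fun k => ‖a k‖ ^ 2)
    (hb : Summable fun k => ‖b k‖ ^ 2) : Summable fun k => ‖a k * star (b k)‖ := by
  refine Summable.of_nonneg_of_le (fun _ => norm_nonneg _) (fun k => ?_) (ha.add hb)
  rw [norm_mul, norm_star]
  nlinarith [sq_nonneg (‖a k‖ - ‖b k‖), sq_nonneg (‖a k‖), sq_nonneg ‖b k‖]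

lemma summable_pair {u v : Z d → Matrix (Fin q) (Fin t) ℂ} (hu : sqNorm u < ∞)
    (hv : sqNorm v < ∞) : Summable fun k => ∑ i, ∑ j, u k i j * star (v k i j) :=
  summable_sum fun i _ => summable_sum fun j _ =>
    (summable_mul_of_summable_sq (summable_sq_of_sqNorm hu i j)
      (summable_sq_of_sqNorm hv i j)).of_norm

lemma enorm_pair_self {u : Z d → Matrix (Fin q) (Fin t) ℂ} (hu : sqNorm u < ∞) :
    ‖pair u u‖ₑ = sqNorm u := by
  have h0 : ∀ z : ℂ, z * star z = ((‖z‖ ^ 2 : ℝ) : ℂ) := fun z => by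
    rw [Complex.star_def, Complex.mul_conj, Complex.normSq_eq_norm_sq]
  have h1 : pair u u = ((∑' k, ∑ i, ∑ j, ‖u k i j‖ ^ 2 : ℝ) : ℂ) := by
    rw [pair, Complex.ofReal_tsum]
    refine tsum_congr fun k => ?_
    push_cast
    refine Finset.sum_congr rfl fun i _ => Finset.sum_congr rfl fun j _ => ?_
    rw [h0]; push_cast; rfl
  have h2 : Summable fun k => ∑ i, ∑ j, ‖u k i j‖ ^ 2 :=
    summable_sum fun i _ => summable_sum fun j _ => summable_sq_of_sqNorm hu i j
  rw [h1, ← ofReal_norm, Complex.norm_real, Real.norm_of_nonneg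
    (tsum_nonneg fun k => by positivity),
    ENNReal.ofReal_tsum_of_nonneg (fun k => by positivity) h2, sqNorm]
  refine tsum_congr fun k => ?_
  rw [ENNReal.ofReal_sum_of_nonneg fun i _ => by positivity]
  refine Finset.sum_congr rfl fun i _ => ?_
  rw [ENNReal.ofReal_sum_of_nonneg fun i _ => by positivity]
  refine Finset.sum_congr rfl fun j _ => ?_
  rw [ENNReal.ofReal_pow (norm_nonneg _), ofReal_norm]

end Sequences

/-! ### Refinable families in a Hilbert space -/

section Abstract

variable {d r s : ℕ} {H : Type*} [NormedAddCommGroup H] [InnerProductSpace ℂ H]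

/-- The coefficients `⟨f, φ_{i,k}⟩` of `f` with respect to a family of vectors. -/
noncomputable def coef {t : ℕ} (φ : Fin t → Z d → H) (f : H) : Z d → Matrix (Fin 1) (Fin t) ℂ :=
  fun k => Matrix.of fun _ i => inner ℂ (φ i k) f

/-- The family `ω` is obtained from `φ` by the filter `c`, the matrix `N` and the unitary
operator `D`: `ω_{i,n} = |det N|^{1/2} D ∑ₘ ∑_q c(m)_{i,q} φ_{q, m + N n}`. -/
def IsRefined {t : ℕ} (D : H ≃ₗᵢ[ℂ] H) (N : Matrix (Fin d) (Fin d) ℤ) (c : Filt d t r)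
    (φ : Fin r → Z d → H) (ω : Fin t → Z d → H) : Prop :=
  ∀ i n, ω i n = D (((Real.sqrt |(N.det : ℝ)| : ℝ) : ℂ) •
    c.sum fun m B => ∑ q, B i q • φ q (m + N.mulVec n))

/-- The transition operator maps the coefficients with respect to a refinable family to the
coefficients at the next coarser level: this transports the affine system to the filter bank. -/
lemma IsRefined.transition_coef {t : ℕ} {D : H ≃ₗᵢ[ℂ] H} {N : Matrix (Fin d) (Fin d) ℤ}
    {c : Filt d t r} {φ : Fin r → Z d → H} {ω : Fin t → Z d → H} (h : IsRefined D N c φ ω) (f : H) :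
    transition N c (coef φ f) = coef ω (D f) := by
  funext n
  ext a i
  simp only [transition, coef, Matrix.smul_apply, smul_eq_mul, Matrix.of_apply]
  rw [h i n, LinearIsometryEquiv.inner_map_map, inner_smul_left, Complex.conj_ofReal]
  congr 1
  rw [Finsupp.sum, Finsupp.sum, sum_inner, Matrix.sum_apply]
  refine Finset.sum_congr rfl fun m _ => ?_
  rw [sum_inner, Matrix.mul_apply]
  refine Finset.sum_congr rfl fun q _ => ?_
  rw [inner_smul_left, Matrix.conjTranspose_apply, Matrix.of_apply, mul_comm]
  rfl

lemma IsRefined.lowPass_coef {D : H ≃ₗᵢ[ℂ] H} {N : Matrix (Fin d) (Fin d) ℤ}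
    {c : Filt d r r} {φ : Fin r → Z d → H} (h : IsRefined D N c φ φ) (f : H) (j : ℕ) :
    lowPass N c (coef φ f) j = coef φ ((D ^ j) f) := by
  induction j with
  | zero => rfl
  | succ j ih =>
    rw [lowPass, ih, h.transition_coef, pow_succ']
    rfl

/-- The affine system generated by the unitary operator `D` from the families `φ` and `ω`. -/
def affine (D : H ≃ₗᵢ[ℂ] H) (φ : Fin r → Z d → H) (ω : Fin s → Fin 1 → Z d → H) :
    (Fin r × Z d) ⊕ (Fin s × ℕ × Z d) → H
  | Sum.inl (q, k) => φ q k
  | Sum.inr (l, j, k) => (D ^ j) (ω l 0 k)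

lemma inner_pow_left (D : H ≃ₗᵢ[ℂ] H) (j : ℕ) (x y : H) :
    inner ℂ ((D ^ j) x) y = inner ℂ x ((D ^ j)⁻¹ y) := by
  rw [← LinearIsometryEquiv.inner_map_map (D ^ j) x]
  congr 1
  exact ((D ^ j).apply_symm_apply y).symm

lemma pow_inv_pow_apply (D : H ≃ₗᵢ[ℂ] H) {i j : ℕ} (h : i ≤ j) (f : H) :
    (D ^ i) ((D ^ j)⁻¹ f) = (D ^ (j - i))⁻¹ f := by
  have : D ^ i * (D ^ j)⁻¹ = (D ^ (j - i))⁻¹ := by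
    rw [← pow_sub_mul_pow D h, mul_inv_rev, mul_inv_cancel_left]
  rw [← this]; rfl

lemma apply_inv_pow_succ (D : H ≃ₗᵢ[ℂ] H) (j : ℕ) (f : H) :
    D ((D ^ (j + 1))⁻¹ f) = (D ^ j)⁻¹ f := by
  have := pow_inv_pow_apply D (i := 1) (j := j + 1) (by omega) f
  simpa using this

lemma pow_apply_symm (D : H ≃ₗᵢ[ℂ] H) (j : ℕ) (f : H) : (D ^ j)⁻¹ ((D ^ j) f) = f :=
  (D ^ j).symm_apply_apply f

lemma apply_pow_symm (D : H ≃ₗᵢ[ℂ] H) (j : ℕ) (f : H) : (D ^ j) ((D ^ j)⁻¹ f) = f :=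
  (D ^ j).apply_symm_apply f

/-- A summable family over the index set of an affine system, summed level by level. -/
lemma tsum_affineIndex {F : (Fin r × Z d) ⊕ (Fin s × ℕ × Z d) → ℂ} (hF : Summable F) :
    Summable (fun j : ℕ => ∑ l, ∑' k, F (Sum.inr (l, j, k))) ∧
    ∑' i, F i = (∑' k, ∑ q, F (Sum.inl (q, k))) +
      ∑' j : ℕ, ∑ l, ∑' k, F (Sum.inr (l, j, k)) := by
  have h1 : Summable (F ∘ Sum.inl) := hF.comp_injective Sum.inl_injective
  have h2 : Summable (F ∘ Sum.inr) := hF.comp_injective Sum.inr_injective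
  let e : ℕ × Fin s × Z d ≃ Fin s × ℕ × Z d :=
    ⟨fun p => (p.2.1, p.1, p.2.2), fun p => (p.2.1, p.1, p.2.2), fun _ => rfl, fun _ => rfl⟩
  let e1 : Z d × Fin r ≃ Fin r × Z d := Equiv.prodComm _ _
  have h3 : Summable ((F ∘ Sum.inr) ∘ e) := e.summable_iff.2 h2
  have h4 : Summable ((F ∘ Sum.inl) ∘ e1) := e1.summable_iff.2 h1
  have h5 : ∀ j : ℕ, ∑' p : Fin s × Z d, ((F ∘ Sum.inr) ∘ e) (j, p) =
      ∑ l, ∑' k, F (Sum.inr (l, j, k)) := by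
    intro j
    rw [(h3.prod_factor j).tsum_prod, tsum_fintype]
    rfl
  refine ⟨?_, ?_⟩
  · have := h3.prod
    simpa only [h5] using this
  · rw [h1.tsum_sum h2]
    congr 1
    · rw [← e1.tsum_eq]
      change ∑' c, ((F ∘ Sum.inl) ∘ e1) c = _
      rw [h4.tsum_prod]
      simp only [tsum_fintype]
      rfl
    · rw [← e.tsum_eq]
      change ∑' c, ((F ∘ Sum.inr) ∘ e) c = _
      rw [h3.tsum_prod]
      simp only [h5]

lemma ennreal_tsum_affineIndex (F : (Fin r × Z d) ⊕ (Fin s × ℕ × Z d) → ℝ≥0∞) :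
    ∑' i, F i = (∑' k, ∑ q, F (Sum.inl (q, k))) +
      ∑' j : ℕ, ∑ l, ∑' k, F (Sum.inr (l, j, k)) := by
  rw [ENNReal.summable.tsum_sum ENNReal.summable]
  congr 1
  · rw [ENNReal.tsum_prod', tsum_fintype, ← Summable.tsum_finsetSum fun _ _ => ENNReal.summable]
  · rw [ENNReal.tsum_prod', tsum_fintype]
    simp_rw [ENNReal.tsum_prod']
    rw [← Summable.tsum_finsetSum fun _ _ => ENNReal.summable]

/-- The coefficients of `f` with respect to the affine system, collected by levels. -/
lemma tsum_enorm_affine (D : H ≃ₗᵢ[ℂ] H) (φ : Fin r → Z d → H) (ω : Fin s → Fin 1 → Z d → H)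
    (f : H) :
    ∑' i, ‖inner ℂ (affine D φ ω i) f‖ₑ ^ 2 =
      sqNorm (coef φ f) + ∑' j : ℕ, ∑ l, sqNorm (coef (ω l) ((D ^ j)⁻¹ f)) := by
  rw [ennreal_tsum_affineIndex]
  simp [affine, sqNorm, coef, inner_pow_left]

lemma tsum_affine_mul (D : H ≃ₗᵢ[ℂ] H) (φ φ' : Fin r → Z d → H)
    (ω ω' : Fin s → Fin 1 → Z d → H) (f g : H)
    (h : Summable fun i => inner ℂ (affine D φ ω i) f * inner ℂ g (affine D φ' ω' i)) :
    Summable (fun j : ℕ => ∑ l, pair (coef (ω l) ((D ^ j)⁻¹ f)) (coef (ω' l) ((D ^ j)⁻¹ g))) ∧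
    ∑' i, inner ℂ (affine D φ ω i) f * inner ℂ g (affine D φ' ω' i) =
      pair (coef φ f) (coef φ' g) +
        ∑' j : ℕ, ∑ l, pair (coef (ω l) ((D ^ j)⁻¹ f)) (coef (ω' l) ((D ^ j)⁻¹ g)) := by
  have h1 := tsum_affineIndex h
  have h2 : ∀ (j : ℕ) (l : Fin s), ∑' k, inner ℂ (affine D φ ω (Sum.inr (l, j, k))) f *
      inner ℂ g (affine D φ' ω' (Sum.inr (l, j, k))) =
      pair (coef (ω l) ((D ^ j)⁻¹ f)) (coef (ω' l) ((D ^ j)⁻¹ g)) := by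
    intro j l
    refine tsum_congr fun k => ?_
    have h4 : inner ℂ g ((D ^ j) (ω' l 0 k)) = star (inner ℂ (ω' l 0 k) ((D ^ j)⁻¹ g)) := by
      rw [← inner_pow_left D j (ω' l 0 k) g]; simp
    simp [affine, coef, inner_pow_left, h4]
  have h3 : ∑' k, ∑ q, inner ℂ (affine D φ ω (Sum.inl (q, k))) f *
      inner ℂ g (affine D φ' ω' (Sum.inl (q, k))) = pair (coef φ f) (coef φ' g) := by
    refine tsum_congr fun k => ?_
    simp [affine, coef]
  simpa only [h2, h3] using h1

/-- Frame bounds in terms of sums with values in `[0, ∞]`. -/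
lemma isFrame_iff_enorm {ι : Type*} (e : ι → H) :
    IsFrame e ↔ ∃ C₁ C₂ : ℝ, 0 < C₁ ∧ 0 < C₂ ∧ ∀ f : H,
      ENNReal.ofReal C₁ * ‖f‖ₑ ^ 2 ≤ ∑' i, ‖inner ℂ (e i) f‖ₑ ^ 2 ∧
      ∑' i, ‖inner ℂ (e i) f‖ₑ ^ 2 ≤ ENNReal.ofReal C₂ * ‖f‖ₑ ^ 2 := by
  have hn : ∀ (C : ℝ) (f : H), 0 < C →
      ENNReal.ofReal C * ‖f‖ₑ ^ 2 = ENNReal.ofReal (C * ‖f‖ ^ 2) := by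
    intro C f hC
    rw [ENNReal.ofReal_mul hC.le, ENNReal.ofReal_pow (norm_nonneg _), ofReal_norm]
  refine exists_congr fun C₁ => exists_congr fun C₂ => and_congr_right fun h1 =>
    and_congr_right fun h2 => forall_congr' fun f => ?_
  rw [hn C₁ f h1, hn C₂ f h2]
  constructor
  · rintro ⟨hs, hl, hu⟩
    rw [tsum_enorm_sq_eq hs]
    exact ⟨ENNReal.ofReal_le_ofReal hl, ENNReal.ofReal_le_ofReal hu⟩
  · rintro ⟨hl, hu⟩
    have hs : Summable fun i => ‖inner ℂ (e i) f‖ ^ 2 :=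
      (summable_sq_iff_enorm _).2 (hu.trans_lt ENNReal.ofReal_lt_top).ne
    rw [tsum_enorm_sq_eq hs] at hl hu
    exact ⟨hs, (ENNReal.ofReal_le_ofReal_iff (tsum_nonneg fun _ => by positivity)).1 hl,
      (ENNReal.ofReal_le_ofReal_iff (by positivity)).1 hu⟩

end Abstract


/-! ### Perfect reconstruction, stability and dual affine frames -/

section AbstractDuality

variable {d r s : ℕ} {H : Type*} [NormedAddCommGroup H] [InnerProductSpace ℂ H]

/-- One-level perfect reconstruction of a pair of filter banks: the pairing of two square summable
sequences is the sum of the pairings of their transforms. -/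
def PerfectReconstruction (M : Fin (s + 1) → Matrix (Fin d) (Fin d) ℤ)
    (b₀ : Filt d r r) (b : Fin s → Filt d 1 r) (b₀' : Filt d r r) (b' : Fin s → Filt d 1 r) : Prop :=
  ∀ u v : Z d → Matrix (Fin 1) (Fin r) ℂ, sqNorm u < ∞ → sqNorm v < ∞ →
    pair u v = pair (transition (M 0) b₀ u) (transition (M 0) b₀' v) +
      ∑ l, pair (transition (M l.succ) (b l) u) (transition (M l.succ) (b' l) v)

lemma pair_star (u v : Z d → Matrix (Fin 1) (Fin r) ℂ) : star (pair u v) = pair v u := by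
  rw [pair, pair, Complex.star_def, Complex.conj_tsum]
  simp [mul_comm]

lemma PerfectReconstruction.symm {M : Fin (s + 1) → Matrix (Fin d) (Fin d) ℤ}
    {b₀ b₀' : Filt d r r} {b b' : Fin s → Filt d 1 r}
    (h : PerfectReconstruction M b₀ b b₀' b') : PerfectReconstruction M b₀' b' b₀ b := by
  intro u v hu hv
  have := congrArg star (h v u hv hu)
  simpa only [star_add, star_sum, pair_star] using this

/-- Perfect reconstruction, iterated over `J` levels. -/
lemma PerfectReconstruction.pair_lowPass {M : Fin (s + 1) → Matrix (Fin d) (Fin d) ℤ}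
    {b₀ b₀' : Filt d r r} {b b' : Fin s → Filt d 1 r}
    (h : PerfectReconstruction M b₀ b b₀' b') {u v : Z d → Matrix (Fin 1) (Fin r) ℂ}
    (hu : ∀ j, sqNorm (lowPass (M 0) b₀ u j) < ∞) (hv : ∀ j, sqNorm (lowPass (M 0) b₀' v j) < ∞)
    (J : ℕ) :
    pair u v = (∑ j ∈ Finset.range J, ∑ l, pair (transition (M l.succ) (b l) (lowPass (M 0) b₀ u j))
      (transition (M l.succ) (b' l) (lowPass (M 0) b₀' v j))) +
      pair (lowPass (M 0) b₀ u J) (lowPass (M 0) b₀' v J) := by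
  induction J with
  | zero => simp [lowPass]
  | succ J ih =>
    rw [ih, Finset.sum_range_succ, h _ _ (hu J) (hv J), lowPass, lowPass]
    ring

/-- The squared norm of the output of the analysis operator, with the sum over the levels taken over
an initial segment of `ℕ`. -/
lemma analysisSqNorm_eq (M : Fin (s + 1) → Matrix (Fin d) (Fin d) ℤ)
    (b₀ : Filt d r r) (b : Fin s → Filt d 1 r) (J : ℕ) (v : Z d → Matrix (Fin 1) (Fin r) ℂ) :
    analysisSqNorm (analysis M b₀ b J v) =
      (∑ j ∈ Finset.range J, ∑ l, sqNorm (transition (M l.succ) (b l) (lowPass (M 0) b₀ v j))) +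
        sqNorm (lowPass (M 0) b₀ v J) := by
  simp only [analysisSqNorm, analysis]
  rw [Finset.sum_range]

/-- Half of stability: the upper bound. -/
def HasUpperStability (M : Fin (s + 1) → Matrix (Fin d) (Fin d) ℤ)
    (b₀ : Filt d r r) (b : Fin s → Filt d 1 r) : Prop :=
  ∃ C₂ : ℝ, 0 < C₂ ∧ ∀ J : ℕ, ∀ v : Z d → Matrix (Fin 1) (Fin r) ℂ, sqNorm v < ∞ →
    analysisSqNorm (analysis M b₀ b J v) ≤ ENNReal.ofReal C₂ * sqNorm v

lemma HasStability.upper {M : Fin (s + 1) → Matrix (Fin d) (Fin d) ℤ}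
    {b₀ : Filt d r r} {b : Fin s → Filt d 1 r} (h : HasStability M b₀ b) :
    HasUpperStability M b₀ b := by
  obtain ⟨C₁, C₂, -, h2, h3⟩ := h
  refine ⟨max C₂ 1, lt_max_of_lt_left h2, fun J v hv => ?_⟩
  rcases Nat.eq_zero_or_pos J with rfl | hJ
  · have : analysisSqNorm (analysis M b₀ b 0 v) = sqNorm v := by
      simp [analysisSqNorm_eq, lowPass]
    rw [this]
    calc sqNorm v = 1 * sqNorm v := (one_mul _).symm
      _ ≤ ENNReal.ofReal (max C₂ 1) * sqNorm v := by
        gcongr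
        rw [← ENNReal.ofReal_one]
        exact ENNReal.ofReal_le_ofReal (le_max_right _ _)
  · refine (h3 J hJ v hv).2.trans ?_
    gcongr
    exact le_max_left _ _

lemma HasUpperStability.lowPass_lt_top {M : Fin (s + 1) → Matrix (Fin d) (Fin d) ℤ}
    {b₀ : Filt d r r} {b : Fin s → Filt d 1 r} (h : HasUpperStability M b₀ b)
    {v : Z d → Matrix (Fin 1) (Fin r) ℂ} (hv : sqNorm v < ∞) (J : ℕ) :
    sqNorm (lowPass (M 0) b₀ v J) < ∞ := by
  obtain ⟨C₂, h2, h3⟩ := h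
  refine lt_of_le_of_lt ?_ ((h3 J v hv).trans_lt (ENNReal.mul_lt_top ENNReal.ofReal_lt_top hv))
  rw [analysisSqNorm_eq]
  exact le_add_self

lemma le_of_two_mul_le {x A : ℝ≥0∞} (hx : x ≠ ∞) (h : 2 * x ≤ A + x) : x ≤ A := by
  rw [two_mul] at h
  exact (ENNReal.add_le_add_iff_right hx).1 h

/-- The lower bound in the definition of stability follows from perfect reconstruction and the upper
bound for the dual filter bank. -/
lemma PerfectReconstruction.hasStability {M : Fin (s + 1) → Matrix (Fin d) (Fin d) ℤ}
    {b₀ b₀' : Filt d r r} {b b' : Fin s → Filt d 1 r}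
    (h : PerfectReconstruction M b₀ b b₀' b') (h1 : HasUpperStability M b₀ b)
    (h2 : HasUpperStability M b₀' b') : HasStability M b₀ b := by
  obtain ⟨C, hC, hC2⟩ := id h1
  obtain ⟨C', hC', hC2'⟩ := id h2
  refine ⟨C'⁻¹, C, inv_pos.2 hC', hC, fun J _ v hv => ⟨?_, hC2 J v hv⟩⟩
  set A := analysisSqNorm (analysis M b₀ b J v) with hA
  have e1 := h.pair_lowPass (h1.lowPass_lt_top hv) (h2.lowPass_lt_top hv) J
  have e2 : 2 * sqNorm v ≤ ENNReal.ofReal C' * A +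
      ENNReal.ofReal C'⁻¹ * analysisSqNorm (analysis M b₀' b' J v) := by
    rw [← enorm_pair_self hv, e1, hA, analysisSqNorm_eq, analysisSqNorm_eq]
    refine (mul_le_mul_right (enorm_add_le _ _) 2).trans ?_
    refine (mul_le_mul_right (add_le_add_left ((enorm_sum_le _ _).trans
      (Finset.sum_le_sum fun j _ => enorm_sum_le _ _)) _) 2).trans ?_
    simp only [mul_add, Finset.mul_sum]
    rw [add_add_add_comm, ← Finset.sum_add_distrib]
    refine add_le_add (Finset.sum_le_sum fun j _ => ?_) (two_mul_enorm_pair_le hC' _ _)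
    rw [← Finset.sum_add_distrib]
    exact Finset.sum_le_sum fun l _ => two_mul_enorm_pair_le hC' _ _
  have e3 : ENNReal.ofReal C'⁻¹ * analysisSqNorm (analysis M b₀' b' J v) ≤ sqNorm v := by
    refine (mul_le_mul_right (hC2' J v hv) _).trans ?_
    rw [← mul_assoc, ← ENNReal.ofReal_mul (inv_nonneg.2 hC'.le), inv_mul_cancel₀ hC'.ne',
      ENNReal.ofReal_one, one_mul]
  have e4 : sqNorm v ≤ ENNReal.ofReal C' * A :=
    le_of_two_mul_le hv.ne (e2.trans (add_le_add_right e3 _))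
  calc ENNReal.ofReal C'⁻¹ * sqNorm v ≤ ENNReal.ofReal C'⁻¹ * (ENNReal.ofReal C' * A) := by gcongr
    _ = A := by
      rw [← mul_assoc, ← ENNReal.ofReal_mul (inv_nonneg.2 hC'.le), inv_mul_cancel₀ hC'.ne',
      ENNReal.ofReal_one, one_mul]

variable {M : Fin (s + 1) → Matrix (Fin d) (Fin d) ℤ} {b₀ b₀' : Filt d r r}
  {b b' : Fin s → Filt d 1 r} {D : H ≃ₗᵢ[ℂ] H} {φ φ' : Fin r → Z d → H}
  {ω ω' : Fin s → Fin 1 → Z d → H}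

/-- The analysis operator, applied to the coefficients of a fine level, yields the coefficients with
respect to the affine system. -/
lemma analysisSqNorm_coef (hφ : IsRefined D (M 0) b₀ φ φ)
    (hω : ∀ l, IsRefined D (M l.succ) (b l) φ (ω l)) (J : ℕ) (f : H) :
    analysisSqNorm (analysis M b₀ b J (coef φ ((D ^ J)⁻¹ f))) =
      (∑ j ∈ Finset.range J, ∑ l, sqNorm (coef (ω l) ((D ^ j)⁻¹ f))) + sqNorm (coef φ f) := by
  rw [analysisSqNorm_eq]
  congr 1
  · rw [← Finset.sum_range_reflect]
    refine Finset.sum_congr rfl fun j hj => Finset.sum_congr rfl fun l _ => ?_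
    have hj' := Finset.mem_range.1 hj
    rw [hφ.lowPass_coef, (hω l).transition_coef]
    have e1 : (D ^ (J - 1 - j)) ((D ^ J)⁻¹ f) = (D ^ (j + 1))⁻¹ f := by
      rw [pow_inv_pow_apply D (by omega)]
      congr 3; omega
    rw [e1, apply_inv_pow_succ]
  · rw [hφ.lowPass_coef, apply_pow_symm]

/-- The family `φ` satisfies the upper frame bound. -/
def IsBessel (φ : Fin r → Z d → H) : Prop :=
  ∃ B : ℝ, 0 < B ∧ ∀ f : H, sqNorm (coef φ f) ≤ ENNReal.ofReal B * ‖f‖ₑ ^ 2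

lemma IsBessel.lt_top {φ : Fin r → Z d → H} (h : IsBessel φ) (f : H) : sqNorm (coef φ f) < ∞ := by
  obtain ⟨B, _, hB⟩ := h
  exact (hB f).trans_lt (ENNReal.mul_lt_top ENNReal.ofReal_lt_top (by simp))

lemma enorm_symm_apply (U : H ≃ₗᵢ[ℂ] H) (f : H) : ‖U⁻¹ f‖ₑ = ‖f‖ₑ := by
  rw [← ofReal_norm, ← ofReal_norm]
  congr 1
  exact U.symm.norm_map f

/-- Upper stability of the filter bank and the Bessel property of the refinable family give the upper
frame bound of the affine system. -/
lemma affine_upper_bound (hφ : IsRefined D (M 0) b₀ φ φ)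
    (hω : ∀ l, IsRefined D (M l.succ) (b l) φ (ω l)) (hB : IsBessel φ)
    (hs : HasUpperStability M b₀ b) :
    ∃ C : ℝ, 0 < C ∧ ∀ f : H,
      ∑' i, ‖inner ℂ (affine D φ ω i) f‖ₑ ^ 2 ≤ ENNReal.ofReal C * ‖f‖ₑ ^ 2 := by
  obtain ⟨B, hB0, hB1⟩ := id hB
  obtain ⟨C, hC0, hC1⟩ := hs
  refine ⟨C * B, mul_pos hC0 hB0, fun f => ?_⟩
  rw [tsum_enorm_affine, add_comm, ENNReal.tsum_eq_iSup_nat, ENNReal.iSup_add]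
  refine iSup_le fun J => ?_
  rw [← analysisSqNorm_coef hφ hω]
  refine (hC1 J _ (hB.lt_top _)).trans ?_
  rw [ENNReal.ofReal_mul hC0.le, mul_assoc]
  gcongr
  refine (hB1 _).trans ?_
  rw [enorm_symm_apply]

/-- The expansion of the fine-level pairing into the pairings of the coefficients with respect to
the affine systems. -/
lemma PerfectReconstruction.pair_coef (h : PerfectReconstruction M b₀ b b₀' b')
    (hφ : IsRefined D (M 0) b₀ φ φ) (hω : ∀ l, IsRefined D (M l.succ) (b l) φ (ω l))
    (hφ' : IsRefined D (M 0) b₀' φ' φ') (hω' : ∀ l, IsRefined D (M l.succ) (b' l) φ' (ω' l))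
    (hB : IsBessel φ) (hB' : IsBessel φ') (f g : H) (J : ℕ) :
    pair (coef φ ((D ^ J)⁻¹ f)) (coef φ' ((D ^ J)⁻¹ g)) = pair (coef φ f) (coef φ' g) +
      ∑ j ∈ Finset.range J, ∑ l,
        pair (coef (ω l) ((D ^ j)⁻¹ f)) (coef (ω' l) ((D ^ j)⁻¹ g)) := by
  induction J with
  | zero => simp
  | succ J ih =>
    rw [h _ _ (hB.lt_top _) (hB'.lt_top _), hφ.transition_coef, hφ'.transition_coef,
      apply_inv_pow_succ, apply_inv_pow_succ, ih, Finset.sum_range_succ, add_assoc]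
    congr 2
    refine Finset.sum_congr rfl fun l _ => ?_
    rw [(hω l).transition_coef, (hω' l).transition_coef, apply_inv_pow_succ, apply_inv_pow_succ]

lemma summable_inner_mul {ι : Type*} {e e' : ι → H} {f g : H}
    (h : ∑' i, ‖inner ℂ (e i) f‖ₑ ^ 2 < ∞) (h' : ∑' i, ‖inner ℂ (e' i) g‖ₑ ^ 2 < ∞) :
    Summable fun i => ‖inner ℂ (e i) f * inner ℂ g (e' i)‖ := by
  have := summable_mul_of_summable_sq ((summable_sq_iff_enorm _).2 h.ne)
    ((summable_sq_iff_enorm _).2 h'.ne)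
  refine this.congr fun i => ?_
  rw [Complex.star_def, inner_conj_symm]

/-- A family that reproduces the inner product together with a Bessel family satisfies the lower
frame bound. -/
lemma lower_bound_of_dual {ι : Type*} {e e' : ι → H} {C' : ℝ} (hC' : 0 < C')
    (h' : ∀ f : H, ∑' i, ‖inner ℂ (e' i) f‖ₑ ^ 2 ≤ ENNReal.ofReal C' * ‖f‖ₑ ^ 2)
    (hd : ∀ f : H, inner ℂ f f = ∑' i, inner ℂ (e i) f * inner ℂ f (e' i)) (f : H) :
    ENNReal.ofReal C'⁻¹ * ‖f‖ₑ ^ 2 ≤ ∑' i, ‖inner ℂ (e i) f‖ₑ ^ 2 := by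
  have e1 : ‖f‖ₑ ^ 2 = ‖(inner ℂ f f : ℂ)‖ₑ := by
    rw [inner_self_eq_norm_sq_to_K, enorm_pow, ← ofReal_norm f, ← ofReal_norm]
    simp
  have e2 : 2 * ‖f‖ₑ ^ 2 ≤ ENNReal.ofReal C' * (∑' i, ‖inner ℂ (e i) f‖ₑ ^ 2) +
      ENNReal.ofReal C'⁻¹ * ∑' i, ‖inner ℂ (e' i) f‖ₑ ^ 2 := by
    rw [e1, hd f]
    refine (mul_le_mul_right enorm_tsum_le_tsum_enorm 2).trans ?_
    rw [← ENNReal.tsum_mul_left, ← ENNReal.tsum_mul_left, ← ENNReal.tsum_mul_left,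
      ← ENNReal.tsum_add]
    refine ENNReal.tsum_le_tsum fun i => ?_
    have := two_mul_enorm_mul_le hC' (inner ℂ (e i) f) (inner ℂ (e' i) f)
    rwa [Complex.star_def, inner_conj_symm] at this
  have e3 : ENNReal.ofReal C'⁻¹ * ∑' i, ‖inner ℂ (e' i) f‖ₑ ^ 2 ≤ ‖f‖ₑ ^ 2 := by
    refine (mul_le_mul_right (h' f) _).trans ?_
    rw [← mul_assoc, ← ENNReal.ofReal_mul (inv_nonneg.2 hC'.le), inv_mul_cancel₀ hC'.ne',
      ENNReal.ofReal_one, one_mul]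
  have e4 := le_of_two_mul_le (by simp) (e2.trans (add_le_add_right e3 _))
  calc ENNReal.ofReal C'⁻¹ * ‖f‖ₑ ^ 2
      ≤ ENNReal.ofReal C'⁻¹ * (ENNReal.ofReal C' * ∑' i, ‖inner ℂ (e i) f‖ₑ ^ 2) := by gcongr
    _ = _ := by
      rw [← mul_assoc, ← ENNReal.ofReal_mul (inv_nonneg.2 hC'.le), inv_mul_cancel₀ hC'.ne',
      ENNReal.ofReal_one, one_mul]

/-- From filter banks to dual frames: the fine-level pairing is the sum of the pairings over all
coarser levels, and tends to the inner product. The lower frame bounds follow by duality. -/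
theorem dualFrame_of_filterBank (h : PerfectReconstruction M b₀ b b₀' b')
    (hφ : IsRefined D (M 0) b₀ φ φ) (hω : ∀ l, IsRefined D (M l.succ) (b l) φ (ω l))
    (hφ' : IsRefined D (M 0) b₀' φ' φ') (hω' : ∀ l, IsRefined D (M l.succ) (b' l) φ' (ω' l))
    (hB : IsBessel φ) (hB' : IsBessel φ')
    (hs : HasUpperStability M b₀ b) (hs' : HasUpperStability M b₀' b')
    (hlim : ∀ f g : H, Tendsto (fun J : ℕ => pair (coef φ ((D ^ J)⁻¹ f)) (coef φ' ((D ^ J)⁻¹ g)))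
      atTop (𝓝 (inner ℂ g f))) :
    IsFrame (affine D φ ω) ∧ IsFrame (affine D φ' ω') ∧ ∀ f g : H,
      Summable (fun i => ‖inner ℂ (affine D φ ω i) f * inner ℂ g (affine D φ' ω' i)‖) ∧
      inner ℂ g f = ∑' i, inner ℂ (affine D φ ω i) f * inner ℂ g (affine D φ' ω' i) := by
  obtain ⟨C, hC, hC1⟩ := affine_upper_bound hφ hω hB hs
  obtain ⟨C', hC', hC1'⟩ := affine_upper_bound hφ' hω' hB' hs'
  have hfin : ∀ (K : ℝ) (f : H), ENNReal.ofReal K * ‖f‖ₑ ^ 2 < ∞ := fun K f =>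
    ENNReal.mul_lt_top ENNReal.ofReal_lt_top (by simp)
  have hsum : ∀ f g : H,
      Summable (fun i => ‖inner ℂ (affine D φ ω i) f * inner ℂ g (affine D φ' ω' i)‖) := fun f g =>
    summable_inner_mul ((hC1 f).trans_lt (hfin _ _)) ((hC1' g).trans_lt (hfin _ _))
  have hd : ∀ f g : H,
      inner ℂ g f = ∑' i, inner ℂ (affine D φ ω i) f * inner ℂ g (affine D φ' ω' i) := by
    intro f g
    obtain ⟨h1, h2⟩ := tsum_affine_mul D φ φ' ω ω' f g (hsum f g).of_norm
    rw [h2]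
    refine tendsto_nhds_unique (hlim f g) ?_
    simp_rw [h.pair_coef hφ hω hφ' hω' hB hB' f g]
    exact tendsto_const_nhds.add h1.hasSum.tendsto_sum_nat
  have hd' : ∀ f : H,
      inner ℂ f f = ∑' i, inner ℂ (affine D φ' ω' i) f * inner ℂ f (affine D φ ω i) := by
    intro f
    have := congrArg star (hd f f)
    rw [Complex.star_def, Complex.conj_tsum] at this
    simp only [map_mul, inner_conj_symm] at this
    rw [this]
    exact tsum_congr fun i => mul_comm _ _
  refine ⟨(isFrame_iff_enorm _).2 ⟨C'⁻¹, C, inv_pos.2 hC', hC, fun f => ⟨?_, hC1 f⟩⟩,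
    (isFrame_iff_enorm _).2 ⟨C⁻¹, C', inv_pos.2 hC, hC', fun f => ⟨?_, hC1' f⟩⟩,
    fun f g => ⟨hsum f g, hd f g⟩⟩
  · exact lower_bound_of_dual hC' hC1' (fun f => hd f f) f
  · exact lower_bound_of_dual hC hC1 hd' f

/-- Every square summable sequence is the sequence of coefficients of some vector, with control of
the norm. -/
def HasBoundedInterpolation (φ : Fin r → Z d → H) : Prop :=
  ∃ K : ℝ, 0 < K ∧ ∀ v : Z d → Matrix (Fin 1) (Fin r) ℂ, sqNorm v < ∞ →
    ∃ f : H, coef φ f = v ∧ ‖f‖ₑ ^ 2 ≤ ENNReal.ofReal K * sqNorm v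

/-- The upper frame bound of the affine system bounds the analysis operators: every square summable
sequence is a sequence of fine-level coefficients, and its analysis is part of the affine expansion. -/
lemma upperStability_of_isFrame (hφ : IsRefined D (M 0) b₀ φ φ)
    (hω : ∀ l, IsRefined D (M l.succ) (b l) φ (ω l)) (hI : HasBoundedInterpolation φ)
    (hF : IsFrame (affine D φ ω)) : HasUpperStability M b₀ b := by
  obtain ⟨C₁, C₂, -, hC, hC2⟩ := (isFrame_iff_enorm _).1 hF
  obtain ⟨K, hK, hK2⟩ := hI
  refine ⟨C₂ * K, mul_pos hC hK, fun J v hv => ?_⟩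
  obtain ⟨f, rfl, hf⟩ := hK2 v hv
  have h1 := analysisSqNorm_coef hφ hω J ((D ^ J) f)
  rw [pow_apply_symm] at h1
  have h2 := (hC2 ((D ^ J) f)).2
  rw [tsum_enorm_affine] at h2
  have h3 : ‖(D ^ J) f‖ₑ = ‖f‖ₑ := by
    rw [← ofReal_norm, ← ofReal_norm, LinearIsometryEquiv.norm_map]
  rw [h1]
  calc _ ≤ (∑' j : ℕ, ∑ l, sqNorm (coef (ω l) ((D ^ j)⁻¹ ((D ^ J) f)))) +
        sqNorm (coef φ ((D ^ J) f)) := by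
        gcongr
        exact ENNReal.sum_le_tsum _
    _ ≤ ENNReal.ofReal C₂ * ‖f‖ₑ ^ 2 := by rw [add_comm, ← h3]; exact h2
    _ ≤ _ := by
        rw [ENNReal.ofReal_mul hC.le, mul_assoc]
        gcongr

/-- From dual frames to filter banks: comparing the expansions of the pairs `(f, g)` and
`(D f, D g)` isolates a single level. -/
theorem perfectReconstruction_of_dualFrame
    (hφ : IsRefined D (M 0) b₀ φ φ) (hω : ∀ l, IsRefined D (M l.succ) (b l) φ (ω l))
    (hφ' : IsRefined D (M 0) b₀' φ' φ') (hω' : ∀ l, IsRefined D (M l.succ) (b' l) φ' (ω' l))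
    (hI : HasBoundedInterpolation φ) (hI' : HasBoundedInterpolation φ')
    (hd : ∀ f g : H,
      Summable (fun i => ‖inner ℂ (affine D φ ω i) f * inner ℂ g (affine D φ' ω' i)‖) ∧
      inner ℂ g f = ∑' i, inner ℂ (affine D φ ω i) f * inner ℂ g (affine D φ' ω' i)) :
    PerfectReconstruction M b₀ b b₀' b' := by
  intro u v hu hv
  obtain ⟨K, -, hK⟩ := hI
  obtain ⟨K', -, hK'⟩ := hI'
  obtain ⟨f, rfl, -⟩ := hK u hu
  obtain ⟨g, rfl, -⟩ := hK' v hv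
  rw [hφ.transition_coef, hφ'.transition_coef]
  have e : ∀ l, pair (transition (M l.succ) (b l) (coef φ f)) (transition (M l.succ) (b' l) (coef φ' g))
      = pair (coef (ω l) (D f)) (coef (ω' l) (D g)) := fun l => by
    rw [(hω l).transition_coef, (hω' l).transition_coef]
  simp_rw [e]
  obtain ⟨h1, h2⟩ := tsum_affine_mul D φ φ' ω ω' f g (hd f g).1.of_norm
  obtain ⟨h3, h4⟩ := tsum_affine_mul D φ φ' ω ω' (D f) (D g) (hd (D f) (D g)).1.of_norm
  rw [← (hd f g).2] at h2
  rw [← (hd (D f) (D g)).2, LinearIsometryEquiv.inner_map_map, h2, h3.tsum_eq_zero_add] at h4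
  have e2 : ∀ (j : ℕ) (x : H), (D ^ (j + 1))⁻¹ (D x) = (D ^ j)⁻¹ x := by
    intro j x
    rw [pow_succ', mul_inv_rev]
    change (D ^ j)⁻¹ (D⁻¹ (D x)) = _
    congr 1
    exact D.symm_apply_apply x
  simp_rw [e2] at h4
  rw [← add_assoc] at h4
  -- the two expansions agree from the first level on; only the level `j = 0` of `(D f, D g)` remains
  have h5 := add_right_cancel h4
  simpa using h5

end AbstractDuality


/-! ### Characters of the lattices -/

section Lattice

variable {d : ℕ}

/-- The lattice `Mᵀ ℤᵈ`. -/
def transposeLattice (M : Matrix (Fin d) (Fin d) ℤ) : Submodule ℤ (Z d) :=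
  LinearMap.range M.transpose.mulVecLin

lemma mulVec_injective_of_det {M : Matrix (Fin d) (Fin d) ℤ} (hM : M.det ≠ 0) :
    Function.Injective M.mulVec := by
  intro x y hxy
  refine sub_eq_zero.1 (Matrix.eq_zero_of_mulVec_eq_zero hM ?_)
  rw [Matrix.mulVec_sub, sub_eq_zero]
  exact hxy

lemma card_quotient_transposeLattice {M : Matrix (Fin d) (Fin d) ℤ} (hM : M.det ≠ 0) :
    Nat.card (Z d ⧸ transposeLattice M) = M.det.natAbs := by
  have hinj : Function.Injective M.transpose.mulVecLin :=
    mulVec_injective_of_det (by rwa [Matrix.det_transpose])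
  have h := Submodule.natAbs_det_equiv (transposeLattice M)
    (LinearEquiv.ofInjective M.transpose.mulVecLin hinj)
  rw [← h, ← Matrix.det_transpose M, ← LinearMap.det_toLin']
  rfl

lemma det_re_transpose_ne_zero {M : Matrix (Fin d) (Fin d) ℤ} (hM : M.det ≠ 0) :
    IsUnit (re M).transpose.det := by
  rw [Matrix.det_transpose, det_re]
  exact isUnit_iff_ne_zero.2 (by exact_mod_cast hM)

lemma expo_two_pi_add_pt (x k : Z d) (y : E d) :
    expo (pt x) ((2 * Real.pi) • (y + pt k)) = expo (pt x) ((2 * Real.pi) • y) := by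
  rw [smul_add, expo_add_right, expo_pt_two_pi, mul_one]

/-- The representative of the point `M⁻ᵀ k` in the half-open cube `[0,1)ᵈ`. -/
noncomputable def fracRep (M : Matrix (Fin d) (Fin d) ℤ) (k : Z d) : E d :=
  act ((re M).transpose)⁻¹ (pt k) - pt fun i => ⌊act ((re M).transpose)⁻¹ (pt k) i⌋

lemma act_re_transpose_pt (M : Matrix (Fin d) (Fin d) ℤ) (k : Z d) :
    act (re M).transpose (pt k) = pt (M.transpose.mulVec k) :=
  act_re_pt M.transpose k

lemma act_inv_transpose_pt_mulVec {M : Matrix (Fin d) (Fin d) ℤ} (hM : M.det ≠ 0) (k : Z d) :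
    act ((re M).transpose)⁻¹ (pt (M.transpose.mulVec k)) = pt k := by
  rw [← act_re_transpose_pt, act_act, Matrix.nonsing_inv_mul _ (det_re_transpose_ne_zero hM), act_one]

lemma fracRep_mem {M : Matrix (Fin d) (Fin d) ℤ} (hM : M.det ≠ 0) (k : Z d) :
    fracRep M k ∈ Omega M := by
  refine ⟨⟨k - M.transpose.mulVec fun i => ⌊act ((re M).transpose)⁻¹ (pt k) i⌋, ?_⟩, fun i => ?_⟩
  · rw [pt_sub, act_sub, act_inv_transpose_pt_mulVec hM, fracRep]
  · simp only [fracRep, PiLp.sub_apply, pt_apply]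
    exact ⟨by linarith [Int.floor_le (act ((re M).transpose)⁻¹ (pt k) i)],
      by linarith [Int.lt_floor_add_one (act ((re M).transpose)⁻¹ (pt k) i)]⟩

lemma eq_of_sub_eq_pt {x y : E d} (hx : ∀ i, 0 ≤ x i ∧ x i < 1) (hy : ∀ i, 0 ≤ y i ∧ y i < 1)
    {m : Z d} (h : x - y = pt m) : x = y := by
  have hm : m = 0 := by
    ext i
    have h1 : x i - y i = (m i : ℝ) := by
      have := congrArg (fun z : E d => z i) h
      simpa [pt_apply] using this
    have h2 : (m i : ℝ) < 1 := by linarith [(hx i).2, (hy i).1]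
    have h3 : (-1 : ℝ) < (m i : ℝ) := by linarith [(hx i).1, (hy i).2]
    have h4 : m i < 1 := by exact_mod_cast h2
    have h5 : -1 < m i := by exact_mod_cast h3
    simp only [Pi.zero_apply]; omega
  rw [hm, pt_zero, sub_eq_zero] at h
  exact h

lemma fracRep_eq_iff {M : Matrix (Fin d) (Fin d) ℤ} (hM : M.det ≠ 0) (k l : Z d) :
    fracRep M k = fracRep M l ↔ k - l ∈ transposeLattice M := by
  constructor
  · intro h
    refine ⟨(fun i => ⌊act ((re M).transpose)⁻¹ (pt k) i⌋) -
      (fun i => ⌊act ((re M).transpose)⁻¹ (pt l) i⌋), ?_⟩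
    apply pt_injective
    have h1 : act ((re M).transpose)⁻¹ (pt k) - act ((re M).transpose)⁻¹ (pt l) =
        pt ((fun i => ⌊act ((re M).transpose)⁻¹ (pt k) i⌋) -
      (fun i => ⌊act ((re M).transpose)⁻¹ (pt l) i⌋)) := by
      rw [pt_sub]
      rw [fracRep, fracRep, sub_eq_sub_iff_add_eq_add] at h
      rw [sub_eq_sub_iff_add_eq_add, h, add_comm]
    rw [Matrix.mulVecLin_apply, ← act_re_transpose_pt, ← h1, ← act_sub, act_act,
      Matrix.mul_nonsing_inv _ (det_re_transpose_ne_zero hM), act_one, pt_sub]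
  · rintro ⟨n, hn⟩
    have h1 : act ((re M).transpose)⁻¹ (pt k) - act ((re M).transpose)⁻¹ (pt l) = pt n := by
      rw [← act_sub, ← pt_sub, ← hn, Matrix.mulVecLin_apply, act_inv_transpose_pt_mulVec hM]
    refine eq_of_sub_eq_pt (fracRep_mem hM k).2 (fracRep_mem hM l).2
      (m := n - (fun i => ⌊act ((re M).transpose)⁻¹ (pt k) i⌋) +
        (fun i => ⌊act ((re M).transpose)⁻¹ (pt l) i⌋)) ?_
    rw [pt_add, pt_sub, ← h1, fracRep, fracRep]
    abel

/-- The set `Omega M` is in bijection with the finite group `ℤᵈ / Mᵀ ℤᵈ`, by `k ↦ M⁻ᵀ k` modulo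
integers. -/
noncomputable def omegaEquiv {M : Matrix (Fin d) (Fin d) ℤ} (hM : M.det ≠ 0) :
    (Z d ⧸ transposeLattice M) ≃ Omega M :=
  Equiv.ofBijective
    (Quotient.lift (s := (transposeLattice M).quotientRel)
      (fun k => (⟨fracRep M k, fracRep_mem hM k⟩ : Omega M))
      (fun k l h => Subtype.ext ((fracRep_eq_iff hM k l).2
        ((Submodule.quotientRel_def _).1 h))))
    ⟨by
      intro p q
      refine Quotient.inductionOn₂ p q fun k l h => ?_
      exact (Submodule.Quotient.eq _).2 ((fracRep_eq_iff hM k l).1 (congrArg Subtype.val h)),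
    by
      rintro ⟨ω, ⟨k, hk⟩, hω⟩
      refine ⟨Submodule.Quotient.mk k, Subtype.ext ?_⟩
      refine eq_of_sub_eq_pt (fracRep_mem hM k).2 hω
        (m := -(fun i => ⌊act ((re M).transpose)⁻¹ (pt k) i⌋)) ?_
      change fracRep M k - ω = _
      rw [pt_neg, hk, fracRep]
      abel⟩

lemma omegaEquiv_mk {M : Matrix (Fin d) (Fin d) ℤ} (hM : M.det ≠ 0) (k : Z d) :
    (omegaEquiv hM (Submodule.Quotient.mk k) : E d) = fracRep M k := rfl

lemma finite_Omega {M : Matrix (Fin d) (Fin d) ℤ} (hM : M.det ≠ 0) : (Omega M).Finite := by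
  have : Finite (Z d ⧸ transposeLattice M) := by
    apply Nat.finite_of_card_ne_zero
    rw [card_quotient_transposeLattice hM]
    exact Int.natAbs_ne_zero.2 hM
  have := Finite.of_equiv _ (omegaEquiv hM)
  exact Set.toFinite _

/-- Orthogonality of the characters indexed by `Omega M`: their sum is `|det M|` on the sublattice
`M ℤᵈ` and zero off it. -/
lemma sum_Omega_expo {M : Matrix (Fin d) (Fin d) ℤ} (hM : M.det ≠ 0) (x : Z d)
    [Decidable (∃ n, x = M.mulVec n)] :
    ∑ ω ∈ (finite_Omega hM).toFinset, expo (pt x) ((2 * Real.pi) • ω) =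
      if ∃ n, x = M.mulVec n then ((|(M.det : ℝ)| : ℝ) : ℂ) else 0 := by
  classical
  have : Finite (Z d ⧸ transposeLattice M) := by
    apply Nat.finite_of_card_ne_zero
    rw [card_quotient_transposeLattice hM]
    exact Int.natAbs_ne_zero.2 hM
  let _ : Fintype (Z d ⧸ transposeLattice M) := Fintype.ofFinite _
  have hrep : ∀ k, expo (pt x) ((2 * Real.pi) • fracRep M k) =
      expo (pt x) ((2 * Real.pi) • act ((re M).transpose)⁻¹ (pt k)) := by
    intro k
    rw [fracRep, sub_eq_add_neg, ← pt_neg, expo_two_pi_add_pt]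
  have hsum : ∑ ω ∈ (finite_Omega hM).toFinset, expo (pt x) ((2 * Real.pi) • ω) =
      ∑ q : Z d ⧸ transposeLattice M, expo (pt x) ((2 * Real.pi) • (omegaEquiv hM q : E d)) := by
    symm
    refine Finset.sum_bij (fun q _ => (omegaEquiv hM q : E d)) ?_ ?_ ?_ ?_
    · intro q _; simp
    · intro p _ q _ h
      exact (omegaEquiv hM).injective (Subtype.ext h)
    · intro ω hω
      refine ⟨(omegaEquiv hM).symm ⟨ω, by simpa using hω⟩, Finset.mem_univ _, by simp⟩
    · intro q _; rfl
  rw [hsum]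
  have hinv : (re M)⁻¹.transpose = ((re M).transpose)⁻¹ := Matrix.transpose_nonsing_inv _
  have hmove : ∀ k : Z d, expo (pt x) ((2 * Real.pi) • act ((re M).transpose)⁻¹ (pt k)) =
      expo (act (re M)⁻¹ (pt x)) ((2 * Real.pi) • pt k) := by
    intro k
    rw [← hinv, ← act_smul, expo_act]
  split_ifs with h
  · obtain ⟨n, rfl⟩ := h
    have h1 : ∀ q : Z d ⧸ transposeLattice M,
        expo (pt (M.mulVec n)) ((2 * Real.pi) • (omegaEquiv hM q : E d)) = 1 := by
      intro q
      obtain ⟨k, rfl⟩ := Submodule.Quotient.mk_surjective _ q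
      have hdet : IsUnit (re M).det := by
        rw [det_re]; exact isUnit_iff_ne_zero.2 (by exact_mod_cast hM)
      rw [omegaEquiv_mk, hrep, hmove, ← act_re_pt, act_act, Matrix.nonsing_inv_mul _ hdet, act_one,
        expo_pt_two_pi]
    rw [Finset.sum_congr rfl fun q _ => h1 q, Finset.sum_const, nsmul_eq_mul, mul_one,
      Finset.card_univ, ← Nat.card_eq_fintype_card, card_quotient_transposeLattice hM]
    have : ((M.det.natAbs : ℤ) : ℝ) = |(M.det : ℝ)| := by
      rw [Int.natCast_natAbs, Int.cast_abs]
    rw [← this, Int.cast_natCast, Complex.ofReal_natCast]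
  · have hi : ∃ i, ∀ m : ℤ, act (re M)⁻¹ (pt x) i ≠ m := by
      by_contra hcon
      push Not at hcon
      choose n hn using hcon
      refine h ⟨n, pt_injective ?_⟩
      have hdet : IsUnit (re M).det := by
        rw [det_re]; exact isUnit_iff_ne_zero.2 (by exact_mod_cast hM)
      have h2 : pt n = act (re M)⁻¹ (pt x) := by
        ext i; rw [hn i]; rfl
      rw [← act_re_pt, h2, act_act, Matrix.mul_nonsing_inv _ hdet, act_one]
    obtain ⟨i, hi⟩ := hi
    set S := ∑ q : Z d ⧸ transposeLattice M, expo (pt x) ((2 * Real.pi) • (omegaEquiv hM q : E d))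
      with hS
    set c := expo (act (re M)⁻¹ (pt x)) ((2 * Real.pi) • pt (Pi.single i 1 : Z d)) with hc
    -- translating the summation variable by a unit vector multiplies the sum by `c ≠ 1`
    have hshift : S = c * S := by
      conv_lhs => rw [hS, ← Equiv.sum_comp (Equiv.addRight
        (Submodule.Quotient.mk (Pi.single i 1) : Z d ⧸ transposeLattice M))]
      rw [hS, Finset.mul_sum]
      refine Finset.sum_congr rfl fun q _ => ?_
      obtain ⟨k, rfl⟩ := Submodule.Quotient.mk_surjective _ q
      simp only [Equiv.coe_addRight]
      rw [← Submodule.Quotient.mk_add, omegaEquiv_mk, omegaEquiv_mk, hrep, hrep,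
        hmove, hmove, pt_add, smul_add, expo_add_right, mul_comm]
    have hc1 : c ≠ 1 := by
      intro h1
      rw [hc, expo, Complex.exp_eq_one_iff] at h1
      obtain ⟨m, hm⟩ := h1
      refine hi (-m) ?_
      have h3 : (inner ℝ (act (re M)⁻¹ (pt x)) ((2 * Real.pi) • pt (Pi.single i 1 : Z d)) : ℝ) =
          2 * Real.pi * act (re M)⁻¹ (pt x) i := by
        rw [real_inner_smul_right, real_inner_comm, inner_pt]
        congr 1
        rw [Finset.sum_eq_single i]
        · simp
        · intro j _ hj; simp [hj]
        · simp
      rw [h3] at hm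
      have hpi : (Real.pi : ℂ) ≠ 0 := by exact_mod_cast Real.pi_ne_zero
      have h4 : ((act (re M)⁻¹ (pt x) i : ℝ) : ℂ) = ((-m : ℤ) : ℂ) := by
        push_cast at hm ⊢
        have h5 : Complex.I * (2 * Real.pi) * ((act (re M)⁻¹ (pt x) i : ℝ) : ℂ) =
          Complex.I * (2 * Real.pi) * (-m) := by linear_combination -hm
        exact mul_left_cancel₀ (mul_ne_zero Complex.I_ne_zero
          (mul_ne_zero two_ne_zero hpi)) h5
      exact_mod_cast h4
    have h6 : (1 - c) * S = 0 := by rw [sub_mul, one_mul, ← hshift, sub_self]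
    exact (mul_eq_zero.1 h6).resolve_left (sub_ne_zero.2 hc1.symm)

/-- The characters of `ℤᵈ` indexed by distinct points of `[0,1)ᵈ` are linearly independent. -/
lemma eq_zero_of_sum_expo_eq_zero {W : Finset (E d)} (hW : ∀ ω ∈ W, ∀ i, 0 ≤ ω i ∧ ω i < 1)
    {a : E d → ℂ} (h : ∀ k : Z d, ∑ ω ∈ W, a ω * expo (-pt k) ((2 * Real.pi) • ω) = 0) :
    ∀ ω ∈ W, a ω = 0 := by
  let χ : E d → (Multiplicative (Z d) →* ℂ) := fun ω =>
    { toFun := fun k => expo (-pt k.toAdd) ((2 * Real.pi) • ω)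
      map_one' := by simp [pt_zero, expo_zero_left]
      map_mul' := by
        intro k l
        rw [toAdd_mul, pt_add, neg_add, expo_add_left] }
  have hinj : Set.InjOn χ W := by
    intro ω hω ω' hω' hχ
    have h1 : ∀ i, ∃ m : ℤ, ω i - ω' i = m := by
      intro i
      have h2 := congrArg (fun f : Multiplicative (Z d) →* ℂ =>
        f (Multiplicative.ofAdd (Pi.single i 1 : Z d))) hχ
      have h3 : expo (-pt (Pi.single i 1 : Z d)) ((2 * Real.pi) • (ω - ω')) = 1 := by
        rw [smul_sub, sub_eq_add_neg, expo_add_right]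
        have h4 : expo (-pt (Pi.single i 1 : Z d)) ((2 * Real.pi) • ω) =
          expo (-pt (Pi.single i 1 : Z d)) ((2 * Real.pi) • ω') := h2
        rw [h4, ← expo_add_right, add_neg_cancel, expo_zero_right]
      rw [expo, Complex.exp_eq_one_iff] at h3
      obtain ⟨m, hm⟩ := h3
      refine ⟨m, ?_⟩
      have h3 : (inner ℝ (-pt (Pi.single i 1 : Z d)) ((2 * Real.pi) • (ω - ω')) : ℝ) =
          -(2 * Real.pi * (ω i - ω' i)) := by
        rw [real_inner_smul_right, inner_neg_left, inner_pt, mul_neg]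
        congr 2
        rw [Finset.sum_eq_single i]
        · simp
        · intro j _ hj; simp [hj]
        · simp
      rw [h3] at hm
      have hpi : (Real.pi : ℂ) ≠ 0 := by exact_mod_cast Real.pi_ne_zero
      have h4 : ((ω i - ω' i : ℝ) : ℂ) = (m : ℂ) := by
        push_cast at hm ⊢
        have h5 : Complex.I * (2 * Real.pi) * ((ω i - ω' i : ℂ)) =
          Complex.I * (2 * Real.pi) * m := by linear_combination hm
        exact mul_left_cancel₀ (mul_ne_zero Complex.I_ne_zero
          (mul_ne_zero two_ne_zero hpi)) h5
      exact_mod_cast h4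
    choose m hm using h1
    exact eq_of_sub_eq_pt (hW ω hω) (hW ω' hω') (m := m) (by ext i; simpa [pt_apply] using hm i)
  -- Dedekind's lemma on the independence of characters
  have hli := (linearIndependent_monoidHom (Multiplicative (Z d)) ℂ)
  have hli2 : LinearIndependent ℂ (fun ω : W => (χ ω : Multiplicative (Z d) → ℂ)) :=
    hli.comp (fun ω : W => χ ω) fun x y hxy => Subtype.ext (hinj x.2 y.2 hxy)
  rw [Fintype.linearIndependent_iff] at hli2
  intro ω hω
  refine hli2 (fun ω => a ω) ?_ ⟨ω, hω⟩
  funext k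
  have := h k.toAdd
  rw [← Finset.sum_coe_sort] at this
  simpa [χ] using this

end Lattice


/-! ### Dual framelet filter banks and perfect reconstruction -/

section FilterBank

variable {d t r s : ℕ}

open Classical in
/-- The kernel of the composition of the transition operator of `c` with the adjoint of the
transition operator of `c'`, at the positions `k` and `k + δ`. -/
noncomputable def corr (N : Matrix (Fin d) (Fin d) ℤ) (c c' : Filt d t r) (k δ : Z d) :
    Matrix (Fin r) (Fin r) ℂ :=
  ∑ m ∈ c.support, (if ∃ n, m - k = N.mulVec n then ((|(N.det : ℝ)| : ℝ) : ℂ) else 0) •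
    ((c m).conjTranspose * c' (m + δ))

/-- The coefficients of the trigonometric polynomial `ĉ(ξ)ᴴ ĉ'(ξ + 2πω)`. -/
noncomputable def freq (c c' : Filt d t r) (ω : E d) (δ : Z d) : Matrix (Fin r) (Fin r) ℂ :=
  ∑ m ∈ c.support, expo (pt m) ((2 * Real.pi) • ω) • ((c m).conjTranspose * c' (m + δ))

/-- Fourier inversion on `ℤᵈ / N ℤᵈ`: the condition `m - k ∈ N ℤᵈ` is expanded in characters. -/
lemma corr_eq_sum_freq {N : Matrix (Fin d) (Fin d) ℤ} (hN : N.det ≠ 0) (c c' : Filt d t r)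
    (k δ : Z d) : corr N c c' k δ =
      ∑ ω ∈ (finite_Omega hN).toFinset, expo (-pt k) ((2 * Real.pi) • ω) • freq c c' ω δ := by
  classical
  simp only [corr, freq, Finset.smul_sum]
  rw [Finset.sum_comm]
  refine Finset.sum_congr rfl fun m _ => ?_
  rw [← sum_Omega_expo hN, Finset.sum_smul]
  refine Finset.sum_congr rfl fun ω _ => ?_
  rw [smul_smul, pt_sub, sub_eq_add_neg, expo_add_left, mul_comm]

/-- The set of differences of the supports of two filters. -/
noncomputable def diffs (c c' : Filt d t r) : Finset (Z d) :=
  (c.support ×ˢ c'.support).image fun p => p.2 - p.1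

lemma sum_support_shift {V : Type*} [AddCommMonoid V] {c c' : Filt d t r} {Δ : Finset (Z d)}
    (hΔ : diffs c c' ⊆ Δ) {m : Z d} (hm : m ∈ c.support) (F : Z d → V)
    (hF : ∀ m', c' m' = 0 → F m' = 0) : ∑ m' ∈ c'.support, F m' = ∑ δ ∈ Δ, F (m + δ) := by
  have h : ∑ δ ∈ Δ, F (m + δ) = ∑ x ∈ Δ.map (addLeftEmbedding m), F x :=
    (Finset.sum_map Δ (addLeftEmbedding m) F).symm
  rw [h]
  refine Finset.sum_subset ?_ ?_
  · intro m' hm'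
    rw [Finset.mem_map]
    refine ⟨m' - m, hΔ ?_, by simp⟩
    exact Finset.mem_image.2 ⟨(m, m'), Finset.mem_product.2 ⟨hm, hm'⟩, rfl⟩
  · intro m' _ hm'
    exact hF m' (Finsupp.notMem_support_iff.1 hm')

lemma freq_eq_zero {c c' : Filt d t r} {δ : Z d}
    (hδ : δ ∉ diffs c c') (ω : E d) : freq c c' ω δ = 0 := by
  refine Finset.sum_eq_zero fun m hm => ?_
  have : c' (m + δ) = 0 := by
    by_contra h
    exact hδ (Finset.mem_image.2 ⟨(m, m + δ), Finset.mem_product.2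
      ⟨hm, Finsupp.mem_support_iff.2 h⟩, by simp⟩)
  rw [this, Matrix.mul_zero, smul_zero]

lemma fourierSeries_eq {V : Type*} [AddCommMonoid V] [Module ℂ V] (u : Z d →₀ V) (ξ : E d) :
    fourierSeries u ξ = ∑ k ∈ u.support, expo (pt k) ξ • u k := rfl

lemma conjTranspose_fourierSeries_mul {c c' : Filt d t r} {Δ : Finset (Z d)}
    (hΔ : diffs c c' ⊆ Δ) (ω ξ : E d) :
    (fourierSeries c ξ).conjTranspose * fourierSeries c' (ξ + (2 * Real.pi) • ω) =
      ∑ δ ∈ Δ, expo (pt δ) (ξ + (2 * Real.pi) • ω) • freq c c' ω δ := by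
  rw [fourierSeries_eq, fourierSeries_eq, Matrix.conjTranspose_sum, Matrix.sum_mul]
  simp only [freq, Finset.smul_sum]
  rw [Finset.sum_comm]
  refine Finset.sum_congr rfl fun m hm => ?_
  rw [Matrix.mul_sum, sum_support_shift hΔ hm]
  · refine Finset.sum_congr rfl fun δ _ => ?_
    rw [Matrix.conjTranspose_smul, Matrix.smul_mul, Matrix.mul_smul, smul_smul, smul_smul]
    congr 1
    rw [star_expo, pt_add, expo_add_left, expo_add_right (pt m), mul_comm (expo (pt m) ξ),
      mul_assoc (expo (pt m) _), mul_left_comm (expo (-pt m) ξ), ← mul_assoc (expo (-pt m) ξ),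
      ← expo_add_left, neg_add_cancel, expo_zero_left, one_mul, mul_comm]
  · intro m' hm'
    rw [hm', smul_zero, Matrix.mul_zero]

lemma pair_eq_tsum_mul {q : ℕ} (u v : Z d → Matrix (Fin 1) (Fin q) ℂ) :
    pair u v = ∑' k, (u k * (v k).conjTranspose) 0 0 := by
  simp [pair, Matrix.mul_apply]

lemma summable_mul_mul_shift {u v : Z d → Matrix (Fin 1) (Fin r) ℂ} (hu : sqNorm u < ∞)
    (hv : sqNorm v < ∞) (A : Matrix (Fin r) (Fin r) ℂ) (δ : Z d) :
    Summable fun k => (u k * A * (v (k + δ)).conjTranspose) 0 0 := by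
  have h2 : ∀ j, Summable fun k => ‖v (k + δ) 0 j‖ ^ 2 := fun j =>
    (summable_sq_of_sqNorm hv 0 j).comp_injective (add_left_injective δ)
  have h1 : ∀ i j, Summable fun k => A i j * (u k 0 i * star (v (k + δ) 0 j)) := fun i j =>
    (summable_mul_of_summable_sq (a := fun k => u k 0 i) (b := fun k => v (k + δ) 0 j)
      (summable_sq_of_sqNorm hu 0 i) (h2 j)).of_norm.mul_left (A i j)
  have h3 : Summable fun k => ∑ j, ∑ i, A i j * (u k 0 i * star (v (k + δ) 0 j)) :=
    summable_sum fun j _ => summable_sum fun i _ => h1 i j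
  refine h3.congr fun k => ?_
  rw [Matrix.mul_apply]
  refine Finset.sum_congr rfl fun j _ => ?_
  rw [Matrix.mul_apply, Finset.sum_mul]
  refine Finset.sum_congr rfl fun i _ => ?_
  rw [Matrix.conjTranspose_apply]
  ring

lemma summable_mul_corr {u v : Z d → Matrix (Fin 1) (Fin r) ℂ} (hu : sqNorm u < ∞)
    (hv : sqNorm v < ∞) (N : Matrix (Fin d) (Fin d) ℤ) (c c' : Filt d t r) (δ : Z d) :
    Summable fun k => (u k * corr N c c' k δ * (v (k + δ)).conjTranspose) 0 0 := by
  classical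
  have h1 : ∀ m, Summable fun k => (if ∃ n, m - k = N.mulVec n then ((|(N.det : ℝ)| : ℝ) : ℂ) else 0) *
      (u k * ((c m).conjTranspose * c' (m + δ)) * (v (k + δ)).conjTranspose) 0 0 := by
    intro m
    refine Summable.of_norm_bounded (g := fun k => |(N.det : ℝ)| *
        ‖(u k * ((c m).conjTranspose * c' (m + δ)) * (v (k + δ)).conjTranspose) 0 0‖)
        ((summable_mul_mul_shift hu hv _ δ).norm.mul_left _) fun k => ?_
    rw [norm_mul]
    gcongr
    split_ifs <;> simp
  refine (summable_sum (s := c.support) fun m _ => h1 m).congr fun k => ?_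
  rw [corr, Matrix.mul_sum, Matrix.sum_mul, Matrix.sum_apply]
  refine Finset.sum_congr rfl fun m _ => ?_
  rw [Matrix.mul_smul, Matrix.smul_mul, Matrix.smul_apply, smul_eq_mul]

open Classical in
/-- The pairing of two transforms as a sesquilinear form in the original sequences, with kernel
`corr`. -/
lemma pair_transition {N : Matrix (Fin d) (Fin d) ℤ} (hN : N.det ≠ 0) {c c' : Filt d t r}
    {Δ : Finset (Z d)} (hΔ : diffs c c' ⊆ Δ) {u v : Z d → Matrix (Fin 1) (Fin r) ℂ}
    (hu : sqNorm u < ∞) (hv : sqNorm v < ∞) :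
    pair (transition N c u) (transition N c' v) =
      ∑' k, ∑ δ ∈ Δ, (u k * corr N c c' k δ * (v (k + δ)).conjTranspose) 0 0 := by
  set a : ℂ := ((|(N.det : ℝ)| : ℝ) : ℂ) with ha
  let G : Z d → Z d → Z d → ℂ := fun m δ k =>
    (u k * ((c m).conjTranspose * c' (m + δ)) * (v (k + δ)).conjTranspose) 0 0
  have hsum : ∀ m δ, Summable (G m δ) := fun m δ => summable_mul_mul_shift hu hv _ δ
  have hinj : ∀ m : Z d, Function.Injective fun n => m + N.mulVec n := fun m x y h =>
    mulVec_injective_of_det hN (add_left_cancel h)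
  -- the summand for fixed `n`, expanded over the supports of the two filters
  have h1 : ∀ n, (transition N c u n * (transition N c' v n).conjTranspose) 0 0 =
      ∑ m ∈ c.support, ∑ δ ∈ Δ, a * G m δ (m + N.mulVec n) := by
    intro n
    have hs : ((Real.sqrt |(N.det : ℝ)| : ℝ) : ℂ) * star ((Real.sqrt |(N.det : ℝ)| : ℝ) : ℂ) = a := by
      rw [Complex.star_def, Complex.conj_ofReal, ← Complex.ofReal_mul,
        Real.mul_self_sqrt (abs_nonneg _)]
    rw [transition, transition, Matrix.conjTranspose_smul, Matrix.smul_mul, Matrix.mul_smul,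
      smul_smul, hs, Finsupp.sum, Finsupp.sum, Matrix.conjTranspose_sum, Matrix.sum_mul]
    rw [Matrix.smul_apply, Matrix.sum_apply, smul_eq_mul, Finset.mul_sum]
    refine Finset.sum_congr rfl fun m hm => ?_
    rw [Matrix.mul_sum, Matrix.sum_apply, Finset.mul_sum, sum_support_shift hΔ hm]
    · refine Finset.sum_congr rfl fun δ _ => ?_
      congr 1
      simp only [G]
      rw [Matrix.conjTranspose_mul, Matrix.conjTranspose_conjTranspose]
      have : m + δ + N.mulVec n = m + N.mulVec n + δ := by abel
      rw [this]
      simp only [Matrix.mul_assoc]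
    · intro m' hm'
      rw [hm']; simp
  -- summation over the coset `m + N ℤᵈ`
  have h2 : ∀ m δ, ∑' n, G m δ (m + N.mulVec n) =
      ∑' k, if ∃ n, m - k = N.mulVec n then G m δ k else 0 := by
    intro m δ
    have h3 := (hinj m).tsum_eq (f := fun k => if ∃ n, m - k = N.mulVec n then G m δ k else 0) ?_
    · rw [← h3]
      refine tsum_congr fun n => ?_
      rw [if_pos ⟨-n, by rw [Matrix.mulVec_neg]; abel⟩]
    · intro k hk
      by_cases h : ∃ n, m - k = N.mulVec n
      · obtain ⟨n, hn⟩ := h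
        refine ⟨-n, ?_⟩
        simp only [Matrix.mulVec_neg, ← hn]
        abel
      · simp [h] at hk
  have h3 : ∀ m δ, Summable fun k => if ∃ n, m - k = N.mulVec n then G m δ k else 0 := by
    intro m δ
    refine Summable.of_norm_bounded (hsum m δ).norm fun k => ?_
    split_ifs <;> simp
  have h5 : ∀ m δ, Summable fun n => a * G m δ (m + N.mulVec n) := fun m δ =>
    ((hsum m δ).comp_injective (hinj m)).mul_left a
  have h6 : ∀ m, Summable fun n => ∑ δ ∈ Δ, a * G m δ (m + N.mulVec n) := fun m =>
    summable_sum fun δ _ => h5 m δ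
  have h7 : ∀ m δ, Summable fun k => a * (if ∃ n, m - k = N.mulVec n then G m δ k else 0) :=
    fun m δ => (h3 m δ).mul_left a
  have h8 : ∀ m, Summable fun k => ∑ δ ∈ Δ, a * (if ∃ n, m - k = N.mulVec n then G m δ k else 0) :=
    fun m => summable_sum fun δ _ => h7 m δ
  rw [pair_eq_tsum_mul, tsum_congr h1, Summable.tsum_finsetSum fun m _ => h6 m]
  have h4 : ∀ m ∈ c.support, ∑' n, ∑ δ ∈ Δ, a * G m δ (m + N.mulVec n) =
      ∑' k, ∑ δ ∈ Δ, a * (if ∃ n, m - k = N.mulVec n then G m δ k else 0) := by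
    intro m _
    rw [Summable.tsum_finsetSum fun δ _ => h5 m δ, Summable.tsum_finsetSum fun δ _ => h7 m δ]
    refine Finset.sum_congr rfl fun δ _ => ?_
    rw [tsum_mul_left, tsum_mul_left, h2]
  rw [Finset.sum_congr rfl h4, ← Summable.tsum_finsetSum fun m _ => h8 m]
  refine tsum_congr fun k => ?_
  rw [Finset.sum_comm]
  refine Finset.sum_congr rfl fun δ _ => ?_
  rw [corr, Matrix.mul_sum, Matrix.sum_mul, Matrix.sum_apply]
  refine Finset.sum_congr rfl fun m _ => ?_
  rw [Matrix.mul_smul, Matrix.smul_mul, Matrix.smul_apply, smul_eq_mul]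
  split_ifs <;> simp [G, ha]

/-- The sequence with value the unit row vector `e_p` at `k`, and zero elsewhere. -/
noncomputable def delta (k : Z d) (p : Fin r) : Z d → Matrix (Fin 1) (Fin r) ℂ :=
  Pi.single k (Matrix.of fun _ j => if j = p then 1 else 0)

lemma sqNorm_delta_lt_top (k : Z d) (p : Fin r) : sqNorm (delta k p) < ∞ := by
  rw [sqNorm, tsum_eq_single k]
  · refine ENNReal.sum_lt_top.2 fun i _ => ENNReal.sum_lt_top.2 fun j _ => ?_
    simp
  · intro l hl
    simp [delta, hl]

variable {M : Fin (s + 1) → Matrix (Fin d) (Fin d) ℤ} {b₀ b₀' : Filt d r r}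
  {b b' : Fin s → Filt d 1 r}

/-- Perfect reconstruction in terms of the kernels of the transition operators. -/
lemma perfectReconstruction_iff_corr (hM : ∀ l, (M l).det ≠ 0) :
    PerfectReconstruction M b₀ b b₀' b' ↔ ∀ k δ, corr (M 0) b₀ b₀' k δ +
      ∑ l : Fin s, corr (M l.succ) (b l) (b' l) k δ =
        if δ = 0 then (1 : Matrix (Fin r) (Fin r) ℂ) else 0 := by
  -- the right-hand side of the perfect reconstruction identity as a form with an explicit kernel
  have key : ∀ (Δ : Finset (Z d)), diffs b₀ b₀' ⊆ Δ → (∀ l, diffs (b l) (b' l) ⊆ Δ) →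
      ∀ u v : Z d → Matrix (Fin 1) (Fin r) ℂ, sqNorm u < ∞ → sqNorm v < ∞ →
      pair (transition (M 0) b₀ u) (transition (M 0) b₀' v) +
        ∑ l : Fin s, pair (transition (M l.succ) (b l) u) (transition (M l.succ) (b' l) v) =
      ∑' k, ∑ δ ∈ Δ, (u k * (corr (M 0) b₀ b₀' k δ +
        ∑ l : Fin s, corr (M l.succ) (b l) (b' l) k δ) * (v (k + δ)).conjTranspose) 0 0 := by
    intro Δ h0 h1 u v hu hv
    have hs : ∀ {t : ℕ} (N : Matrix (Fin d) (Fin d) ℤ) (c c' : Filt d t r), N.det ≠ 0 →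
        Summable fun k => ∑ δ ∈ Δ, (u k * corr N c c' k δ * (v (k + δ)).conjTranspose) 0 0 := by
      intro t N c c' hN
      refine summable_sum fun δ _ => ?_
      exact summable_mul_corr hu hv N c c' δ
    rw [pair_transition (hM 0) h0 hu hv, Finset.sum_congr rfl fun l _ =>
      pair_transition (hM l.succ) (h1 l) hu hv, ← Summable.tsum_finsetSum fun l _ =>
      hs _ _ _ (hM _), ← (hs _ _ _ (hM 0)).tsum_add (summable_sum fun l _ => hs _ _ _ (hM _))]
    refine tsum_congr fun k => ?_
    rw [Finset.sum_comm, ← Finset.sum_add_distrib]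
    refine Finset.sum_congr rfl fun δ _ => ?_
    rw [Matrix.mul_add, Matrix.add_mul, Matrix.add_apply, Matrix.mul_sum, Matrix.sum_mul,
      Matrix.sum_apply]
  set Δ₀ : Finset (Z d) := diffs b₀ b₀' ∪ Finset.univ.biUnion fun l => diffs (b l) (b' l) with hΔ₀
  have hsub : diffs b₀ b₀' ⊆ Δ₀ := Finset.subset_union_left
  have hsub' : ∀ l, diffs (b l) (b' l) ⊆ Δ₀ := fun l =>
    (Finset.subset_biUnion_of_mem (fun l => diffs (b l) (b' l)) (Finset.mem_univ l)).trans
      Finset.subset_union_right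
  constructor
  · intro h k δ
    ext p q
    -- testing on unit sequences isolates an entry of the kernel
    have h1 := h (delta k p) (delta (k + δ) q) (sqNorm_delta_lt_top _ _) (sqNorm_delta_lt_top _ _)
    rw [key (insert δ Δ₀) (hsub.trans (Finset.subset_insert _ _))
      (fun l => (hsub' l).trans (Finset.subset_insert _ _)) _ _ (sqNorm_delta_lt_top _ _)
      (sqNorm_delta_lt_top _ _), pair_eq_tsum_mul, tsum_eq_single k, tsum_eq_single k,
      Finset.sum_eq_single δ] at h1
    · have e : ∀ A : Matrix (Fin r) (Fin r) ℂ,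
          (delta k p k * A * (delta (k + δ) q (k + δ)).conjTranspose) 0 0 = A p q := by
        intro A
        simp [delta, Matrix.mul_apply]
      rw [e] at h1
      rw [← h1]
      by_cases hδ : δ = 0
      · subst hδ
        simp [delta, Matrix.mul_apply, Matrix.one_apply, eq_comm]
      · simp [delta, hδ]
    · intro δ' _ hδ'
      simp [delta, hδ']
    · intro hδ
      exact absurd (Finset.mem_insert_self _ _) hδ
    · intro l hl
      simp [delta, hl]
    · intro l hl
      simp [delta, hl]
  · intro h u v hu hv
    rw [key (insert 0 Δ₀) (hsub.trans (Finset.subset_insert _ _))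
      (fun l => (hsub' l).trans (Finset.subset_insert _ _)) u v hu hv, pair_eq_tsum_mul]
    refine tsum_congr fun k => ?_
    simp_rw [h]
    rw [Finset.sum_eq_single 0]
    · simp
    · intro δ _ hδ
      simp [hδ]
    · intro h0
      exact absurd (Finset.mem_insert_self _ _) h0

end FilterBank


section FilterBankFourier

variable {d r s : ℕ}

/-- A trigonometric polynomial that vanishes almost everywhere is zero. -/
lemma eq_zero_of_fourierSeries_ae_eq_zero {w : Z d →₀ ℂ} (h : ∀ᵐ ξ : E d, fourierSeries w ξ = 0) :
    w = 0 := by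
  have h1 := lintegral_trigPoly_cube w
  have h2 : ∫⁻ x in cube d, ‖fourierSeries w ((2 * Real.pi) • x)‖ₑ ^ 2 = 0 := by
    rw [← lintegral_zero (μ := volume.restrict (cube d))]
    refine lintegral_congr_ae ?_
    filter_upwards [ae_restrict_of_ae ((quasiMeasurePreserving_const_smul two_pi_pos.ne').ae h)] with x hx
    simp [hx]
  rw [h2, eq_comm, ENNReal.tsum_eq_zero] at h1
  ext k
  simpa using h1 k

variable {M : Fin (s + 1) → Matrix (Fin d) (Fin d) ℤ} {b₀ b₀' : Filt d r r}
  {b b' : Fin s → Filt d 1 r}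

open Classical in
/-- The coefficients of the trigonometric polynomial in the definition of a dual framelet filter bank
at the frequency `ω`. -/
noncomputable def bankFreq (M : Fin (s + 1) → Matrix (Fin d) (Fin d) ℤ) (b₀ : Filt d r r)
    (b : Fin s → Filt d 1 r) (b₀' : Filt d r r) (b' : Fin s → Filt d 1 r) (ω : E d) (δ : Z d) :
    Matrix (Fin r) (Fin r) ℂ :=
  (if ω ∈ Omega (M 0) then freq b₀ b₀' ω δ else 0) +
    ∑ l : Fin s, if ω ∈ Omega (M l.succ) then freq (b l) (b' l) ω δ else 0

open Classical in
/-- Perfect reconstruction, after a Fourier transform in the position `k`: the kernel depends on `k`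
only through the characters indexed by the sets `Omega (M l)`. -/
lemma perfectReconstruction_iff_bankFreq (hM : ∀ l, (M l).det ≠ 0) :
    PerfectReconstruction M b₀ b b₀' b' ↔ ∀ ω ∈ ⋃ l, Omega (M l), ∀ δ,
      bankFreq M b₀ b b₀' b' ω δ =
        if ω = 0 ∧ δ = 0 then (1 : Matrix (Fin r) (Fin r) ℂ) else 0 := by
  have hfin : (⋃ l, Omega (M l)).Finite := Set.finite_iUnion fun l => finite_Omega (hM l)
  have hsum : ∀ (l : Fin (s + 1)) (F : E d → Matrix (Fin r) (Fin r) ℂ),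
      ∑ ω ∈ (finite_Omega (hM l)).toFinset, F ω =
        ∑ ω ∈ hfin.toFinset, if ω ∈ Omega (M l) then F ω else 0 := by
    intro l F
    rw [← Finset.sum_filter]
    refine Finset.sum_congr ?_ fun _ _ => rfl
    ext ω
    simp only [Set.Finite.mem_toFinset, Finset.mem_filter, Set.mem_iUnion]
    exact ⟨fun h => ⟨⟨l, h⟩, h⟩, fun h => h.2⟩
  have h0 : (0 : E d) ∈ ⋃ l, Omega (M l) := by
    refine Set.mem_iUnion.2 ⟨0, ⟨0, ?_⟩, fun i => by simp⟩
    rw [pt_zero, act_zero]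
  have hcorr : ∀ k δ, corr (M 0) b₀ b₀' k δ + ∑ l : Fin s, corr (M l.succ) (b l) (b' l) k δ =
      ∑ ω ∈ hfin.toFinset, expo (-pt k) ((2 * Real.pi) • ω) • bankFreq M b₀ b b₀' b' ω δ := by
    intro k δ
    rw [corr_eq_sum_freq (hM 0), Finset.sum_congr rfl fun l _ => corr_eq_sum_freq (hM (Fin.succ l))
      (b l) (b' l) k δ, hsum]
    rw [Finset.sum_congr rfl fun l _ => hsum (Fin.succ l) _, Finset.sum_comm,
      ← Finset.sum_add_distrib]
    refine Finset.sum_congr rfl fun ω _ => ?_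
    simp only [bankFreq, smul_add, Finset.smul_sum, smul_ite, smul_zero]
  have hone : ∀ k δ : Z d, (if δ = 0 then (1 : Matrix (Fin r) (Fin r) ℂ) else 0) =
      ∑ ω ∈ hfin.toFinset, expo (-pt k) ((2 * Real.pi) • ω) •
        (if ω = 0 ∧ δ = 0 then (1 : Matrix (Fin r) (Fin r) ℂ) else 0) := by
    intro k δ
    rw [Finset.sum_eq_single 0]
    · simp [expo_zero_right]
    · intro ω _ hω; simp [hω]
    · intro h; exact absurd (hfin.mem_toFinset.2 h0) h
  rw [perfectReconstruction_iff_corr hM]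
  simp_rw [hcorr]
  constructor
  · intro h ω hω δ
    ext p q
    have hW : ∀ ω ∈ hfin.toFinset, ∀ i, 0 ≤ ω i ∧ ω i < 1 := by
      intro ω hω
      obtain ⟨l, hl⟩ := Set.mem_iUnion.1 (hfin.mem_toFinset.1 hω)
      exact hl.2
    have h1 := eq_zero_of_sum_expo_eq_zero hW (a := fun ω => (bankFreq M b₀ b b₀' b' ω δ -
      (if ω = 0 ∧ δ = 0 then (1 : Matrix (Fin r) (Fin r) ℂ) else 0)) p q) ?_ ω
      (hfin.mem_toFinset.2 hω)
    · rw [Matrix.sub_apply, sub_eq_zero] at h1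
      exact h1
    · intro k
      have h2 := h k δ
      rw [hone k δ, ← sub_eq_zero, ← Finset.sum_sub_distrib] at h2
      have h3 := congrFun (congrFun h2 p) q
      rw [Matrix.sum_apply, Matrix.zero_apply] at h3
      rw [← h3]
      refine Finset.sum_congr rfl fun ω _ => ?_
      rw [← smul_sub, Matrix.smul_apply, smul_eq_mul, mul_comm]
  · intro h k δ
    rw [hone k δ]
    refine Finset.sum_congr rfl fun ω hω => ?_
    rw [h ω (hfin.mem_toFinset.1 hω) δ]

open Classical in
/-- A pair of filter banks is a dual framelet filter bank if and only if it has the perfect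
reconstruction property. -/
theorem isDualFrameletFilterBank_iff (hM : ∀ l, (M l).det ≠ 0) :
    IsDualFrameletFilterBank M b₀ b b₀' b' ↔ PerfectReconstruction M b₀ b b₀' b' := by
  rw [perfectReconstruction_iff_bankFreq hM, IsDualFrameletFilterBank]
  refine forall_congr' fun ω => forall_congr' fun hω => ?_
  set Δ : Finset (Z d) := insert 0 (diffs b₀ b₀' ∪ Finset.univ.biUnion fun l => diffs (b l) (b' l))
    with hΔ
  have hsub : diffs b₀ b₀' ⊆ Δ := Finset.subset_union_left.trans (Finset.subset_insert _ _)
  have hsub' : ∀ l, diffs (b l) (b' l) ⊆ Δ := fun l =>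
    ((Finset.subset_biUnion_of_mem (fun l => diffs (b l) (b' l)) (Finset.mem_univ l)).trans
      Finset.subset_union_right).trans (Finset.subset_insert _ _)
  have hL : ∀ ξ : E d, (if ω ∈ Omega (M 0) then
        (fourierSeries b₀ ξ).conjTranspose * fourierSeries b₀' (ξ + (2 * Real.pi) • ω)
      else 0) +
    ∑ l : Fin s, (if ω ∈ Omega (M l.succ) then
        (fourierSeries (b l) ξ).conjTranspose * fourierSeries (b' l) (ξ + (2 * Real.pi) • ω)
      else 0) =
      ∑ δ ∈ Δ, expo (pt δ) (ξ + (2 * Real.pi) • ω) • bankFreq M b₀ b b₀' b' ω δ := by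
    intro ξ
    simp only [conjTranspose_fourierSeries_mul hsub, conjTranspose_fourierSeries_mul (hsub' _)]
    simp only [bankFreq, smul_add, Finset.sum_add_distrib]
    congr 1
    · split_ifs <;> simp
    · simp only [Finset.smul_sum]
      rw [Finset.sum_comm]
      refine Finset.sum_congr rfl fun l _ => ?_
      split_ifs <;> simp
  have hR : ∀ ξ : E d, (if ω = 0 then (1 : Matrix (Fin r) (Fin r) ℂ) else 0) =
      ∑ δ ∈ Δ, expo (pt δ) (ξ + (2 * Real.pi) • ω) •
        (if ω = 0 ∧ δ = 0 then (1 : Matrix (Fin r) (Fin r) ℂ) else 0) := by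
    intro ξ
    rw [Finset.sum_eq_single 0]
    · simp [pt_zero, expo_zero_left]
    · intro δ _ hδ; simp [hδ]
    · intro h; exact absurd (Finset.mem_insert_self _ _) h
  simp_rw [hL]
  constructor
  · intro h δ
    have hsupp : ∀ δ, bankFreq M b₀ b b₀' b' ω δ -
        (if ω = 0 ∧ δ = 0 then (1 : Matrix (Fin r) (Fin r) ℂ) else 0) ≠ 0 → δ ∈ Δ := by
      intro δ hδ
      by_contra hcon
      refine hδ ?_
      have e1 : δ ≠ 0 := fun h0 => hcon (by rw [h0]; exact Finset.mem_insert_self _ _)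
      have e2 : bankFreq M b₀ b b₀' b' ω δ = 0 := by
        simp only [bankFreq, freq_eq_zero fun h0 => hcon (hsub h0),
          fun l => freq_eq_zero (c := b l) (c' := b' l) fun h0 => hcon (hsub' l h0)]
        simp
      simp [e1, e2]
    ext p q
    let w : Z d →₀ ℂ := Finsupp.onFinset Δ (fun δ => expo (pt δ) ((2 * Real.pi) • ω) *
      (bankFreq M b₀ b b₀' b' ω δ -
        (if ω = 0 ∧ δ = 0 then (1 : Matrix (Fin r) (Fin r) ℂ) else 0)) p q) (by
          intro δ hδ
          refine hsupp δ fun h0 => hδ ?_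
          rw [h0]; simp)
    -- the two sides agree almost everywhere, so their coefficients agree
    have hw : w = 0 := by
      apply eq_zero_of_fourierSeries_ae_eq_zero
      filter_upwards [h] with ξ hξ
      rw [hR ξ, ← sub_eq_zero, ← Finset.sum_sub_distrib] at hξ
      have h3 := congrFun (congrFun hξ p) q
      rw [Matrix.sum_apply, Matrix.zero_apply] at h3
      rw [← h3, fourierSeries, Finsupp.onFinset_sum]
      · refine Finset.sum_congr rfl fun δ _ => ?_
        change expo (pt δ) ξ • _ = _
        rw [← smul_sub, Matrix.smul_apply, smul_eq_mul, smul_eq_mul, expo_add_right, mul_assoc]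
      · intro δ; exact smul_zero _
    have h4 := DFunLike.congr_fun hw δ
    have h5 : expo (pt δ) ((2 * Real.pi) • ω) * (bankFreq M b₀ b b₀' b' ω δ -
        (if ω = 0 ∧ δ = 0 then (1 : Matrix (Fin r) (Fin r) ℂ) else 0)) p q = 0 := h4
    have h6 := (mul_eq_zero.1 h5).resolve_left (expo_ne_zero _ _)
    rw [Matrix.sub_apply, sub_eq_zero] at h6
    exact h6
  · intro h
    refine Eventually.of_forall fun ξ => ?_
    rw [hR ξ]
    refine Finset.sum_congr rfl fun δ _ => ?_
    rw [h δ]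

end FilterBankFourier


/-! ### Refinement relations between the generators -/

section Generators

variable {d r s t : ℕ}

/-- The integer translates of a vector function. -/
noncomputable def shifts (ψ₀ : Fin r → L2 d) (q : Fin r) (k : Z d) : L2 d :=
  dilate 1 (pt k) (ψ₀ q)

/-- The combination `∑ₘ ∑_q c(m)_{i,q} ψ₀_q(· - m)` of integer translates. -/
noncomputable def synth (c : Filt d t r) (ψ₀ : Fin r → L2 d) (i : Fin t) : L2 d :=
  c.sum fun m B => ∑ q, B i q • shifts ψ₀ q m

lemma synth_eq (c : Filt d t r) (ψ₀ : Fin r → L2 d) (i : Fin t) :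
    synth c ψ₀ i = ∑ m ∈ c.support, ∑ q, c m i q • shifts ψ₀ q m := rfl

lemma isCompactlySupported_shifts {ψ₀ : Fin r → L2 d} (h : ∀ q, IsCompactlySupported (ψ₀ q))
    (q : Fin r) (k : Z d) : IsCompactlySupported (shifts ψ₀ q k) :=
  (h q).dilate (by simp) _

lemma isCompactlySupported_synth {ψ₀ : Fin r → L2 d} (h : ∀ q, IsCompactlySupported (ψ₀ q))
    (c : Filt d t r) (i : Fin t) : IsCompactlySupported (synth c ψ₀ i) := by
  rw [synth_eq]
  exact IsCompactlySupported.sum _ fun m _ => IsCompactlySupported.sum _ fun q _ =>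
    (isCompactlySupported_shifts h q m).smul _

lemma hat_synth {ψ₀ : Fin r → L2 d} (h : ∀ q, IsCompactlySupported (ψ₀ q))
    (c : Filt d t r) (i : Fin t) (ξ : E d) :
    fourierIntegralHat (synth c ψ₀ i) ξ = (fourierSeries c ξ).mulVec (vecHat ψ₀ ξ) i := by
  rw [synth_eq, hat_sum _ (fun m _ => IsCompactlySupported.sum _ fun q _ =>
    (isCompactlySupported_shifts h q m).smul _), fourierSeries_eq, Matrix.sum_mulVec,
    Finset.sum_apply]
  refine Finset.sum_congr rfl fun m _ => ?_
  rw [hat_sum _ fun q _ => (isCompactlySupported_shifts h q m).smul _, Matrix.smul_mulVec,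
    Pi.smul_apply, Matrix.mulVec, dotProduct, Finset.smul_sum]
  refine Finset.sum_congr rfl fun q _ => ?_
  rw [hat_smul, shifts, hat_translate, smul_eq_mul, vecHat]
  ring

lemma det_one_ne_zero : (1 : Matrix (Fin d) (Fin d) ℝ).det ≠ 0 := by simp

lemma translate_synth (c : Filt d t r) (ψ₀ : Fin r → L2 d) (i : Fin t) (l : Z d) :
    dilate 1 (pt l) (synth c ψ₀ i) = c.sum fun m B => ∑ q, B i q • shifts ψ₀ q (m + l) := by
  have : ∀ f : L2 d, dilate 1 (pt l) f = dilateEquiv 1 det_one_ne_zero (pt l) f := fun f => rfl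
  rw [this, synth, Finsupp.sum, map_sum, Finsupp.sum]
  refine Finset.sum_congr rfl fun m _ => ?_
  rw [map_sum]
  refine Finset.sum_congr rfl fun q _ => ?_
  rw [map_smul, dilateEquiv_apply, shifts, translate_translate, ← pt_add]
  rfl

lemma sqrt_abs_ne_zero {x : ℝ} (hx : x ≠ 0) : ((Real.sqrt |x| : ℝ) : ℂ) ≠ 0 := by
  rw [Complex.ofReal_ne_zero, Real.sqrt_ne_zero']
  exact abs_pos.2 hx

/-- The time-domain form of the refinement equation. -/
lemma eq_dilate_synth {N : Matrix (Fin d) (Fin d) ℤ} (hN : (re N).det ≠ 0) {ψ₀ : Fin r → L2 d}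
    (h : ∀ q, IsCompactlySupported (ψ₀ q)) (c : Filt d r r)
    (href : ∀ ξ : E d, vecHat ψ₀ (act (re N).transpose ξ) =
      (fourierSeries c ξ).mulVec (vecHat ψ₀ ξ)) (i : Fin r) :
    ψ₀ i = dilate (re N) 0 (((Real.sqrt |(re N).det| : ℝ) : ℂ) • synth c ψ₀ i) := by
  refine eq_of_hat_eq (h i) (((isCompactlySupported_synth h c i).smul _).dilate hN _) fun ξ => ?_
  have hdet : IsUnit (re N).transpose.det := by
    rw [Matrix.det_transpose]; exact isUnit_iff_ne_zero.2 hN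
  obtain ⟨η, rfl⟩ : ∃ η, act (re N).transpose η = ξ :=
    ⟨act (re N).transpose⁻¹ ξ, by rw [act_act, Matrix.mul_nonsing_inv _ hdet, act_one]⟩
  rw [hat_dilate hN, hat_smul, hat_synth h, ← href, inv_mul_cancel_left₀ (sqrt_abs_ne_zero hN)]
  rfl

/-- The time-domain form of the definition of a wavelet generator. -/
lemma eq_dilate_synth_of_L2Hat {N : Matrix (Fin d) (Fin d) ℤ} (hN : (re N).det ≠ 0)
    {ψ₀ : Fin r → L2 d} (h : ∀ q, IsCompactlySupported (ψ₀ q)) (c : Filt d 1 r) {f : L2 d}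
    (hf : ∀ᵐ ξ : E d, fourierL2Hat f ξ =
      (fourierSeries c (act ((re N).transpose)⁻¹ ξ)).mulVec
        (vecHat ψ₀ (act ((re N).transpose)⁻¹ ξ)) 0) :
    f = dilate (re N) 0 (((Real.sqrt |(re N).det| : ℝ) : ℂ) • synth c ψ₀ 0) := by
  refine eq_of_fourierL2Hat_ae_eq (((isCompactlySupported_synth h c 0).smul _).dilate hN _) ?_
  filter_upwards [hf] with ξ hξ
  have hdet : IsUnit (re N).transpose.det := by
    rw [Matrix.det_transpose]; exact isUnit_iff_ne_zero.2 hN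
  obtain ⟨η, rfl⟩ : ∃ η, act (re N).transpose η = ξ :=
    ⟨act (re N).transpose⁻¹ ξ, by rw [act_act, Matrix.mul_nonsing_inv _ hdet, act_one]⟩
  rw [act_act, Matrix.nonsing_inv_mul _ hdet, act_one] at hξ
  rw [hξ, hat_dilate hN, hat_smul, hat_synth h, inv_mul_cancel_left₀ (sqrt_abs_ne_zero hN)]

lemma isRefined_shifts {N : Matrix (Fin d) (Fin d) ℤ} (hN : (re N).det ≠ 0) {ψ₀ : Fin r → L2 d}
    (h : ∀ q, IsCompactlySupported (ψ₀ q)) (c : Filt d r r)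
    (href : ∀ ξ : E d, vecHat ψ₀ (act (re N).transpose ξ) =
      (fourierSeries c ξ).mulVec (vecHat ψ₀ ξ)) :
    IsRefined (dilateEquiv (re N) hN 0) N c (shifts ψ₀) (shifts ψ₀) := by
  intro i n
  rw [shifts, eq_dilate_synth hN h c href i, translate_dilate hN, dilate_smul det_one_ne_zero,
    act_re_pt, translate_synth, det_re]
  rfl

/-- The wavelet generators at the coarsest level, normalised as in the affine system. The index in
`Fin 1` is a dummy: wavelets are treated as vector functions with one component. -/
noncomputable def waveletShifts (M : Fin (s + 1) → Matrix (Fin d) (Fin d) ℤ) (ψ : Fin s → L2 d)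
    (l : Fin s) (_ : Fin 1) (k : Z d) : L2 d :=
  ((Real.sqrt |((re (M 0))⁻¹ * re (M l.succ)).det| : ℝ) : ℂ) •
    dilate 1 (act ((re (M 0))⁻¹ * re (M l.succ)) (pt k)) (ψ l)

lemma isRefined_waveletShifts {M : Fin (s + 1) → Matrix (Fin d) (Fin d) ℤ}
    (hM : (re (M 0)).det ≠ 0) {ψ₀ : Fin r → L2 d}
    (h : ∀ q, IsCompactlySupported (ψ₀ q)) {ψ : Fin s → L2 d} (l : Fin s) (c : Filt d 1 r)
    (hψ : ∀ᵐ ξ : E d, fourierL2Hat (ψ l) ξ =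
      (fourierSeries c (act ((re (M 0)).transpose)⁻¹ ξ)).mulVec
        (vecHat ψ₀ (act ((re (M 0)).transpose)⁻¹ ξ)) 0) :
    IsRefined (dilateEquiv (re (M 0)) hM 0) (M l.succ) c (shifts ψ₀) (waveletShifts M ψ l) := by
  intro i n
  obtain rfl : i = 0 := Subsingleton.elim _ _
  have hu : IsUnit (re (M 0)).det := isUnit_iff_ne_zero.2 hM
  rw [waveletShifts, eq_dilate_synth_of_L2Hat hM h c hψ, translate_dilate hM,
    dilate_smul det_one_ne_zero, act_act, Matrix.mul_nonsing_inv_cancel_left _ _ hu, act_re_pt,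
    translate_synth, dilate_smul hM, smul_smul, map_smul]
  congr 1
  rw [← Complex.ofReal_mul, ← Real.sqrt_mul (abs_nonneg _), ← abs_mul, Matrix.det_mul,
    Matrix.det_nonsing_inv, Ring.inverse_eq_inv', mul_right_comm, inv_mul_cancel₀ hM, one_mul,
    det_re]

lemma affineSystem_eq_affine {M : Fin (s + 1) → Matrix (Fin d) (Fin d) ℤ}
    (hM : (re (M 0)).det ≠ 0) (ψ₀ : Fin r → L2 d) (ψ : Fin s → L2 d) :
    affineSystem M ψ₀ ψ =
      affine (dilateEquiv (re (M 0)) hM 0) (shifts ψ₀) (waveletShifts M ψ) := by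
  funext i
  rcases i with ⟨q, k⟩ | ⟨l, j, k⟩
  · rfl
  · simp only [affineSystem, affine, waveletShifts]
    rw [dilate_pow_eq hM, map_smul]

end Generators


/-! ### The bracket product and the Bessel property -/

section Bessel

variable {d r s t : ℕ}

/-- Pairing with a fixed sequence, on finitely supported sequences. -/
noncomputable def pairHom (u : Z d → Matrix (Fin 1) (Fin r) ℂ) : Filt d 1 r →+ ℂ :=
  Finsupp.liftAddHom fun k =>
    { toFun := fun W => (u k * W.conjTranspose) 0 0
      map_zero' := by simp
      map_add' := fun A B => by simp [Matrix.mul_add] }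

lemma pairHom_eq (u : Z d → Matrix (Fin 1) (Fin r) ℂ) (w : Filt d 1 r) :
    pairHom u w = ∑ k ∈ w.support, (u k * (w k).conjTranspose) 0 0 := by
  simp [pairHom, Finsupp.sum]

lemma pair_eq_pairHom (u : Z d → Matrix (Fin 1) (Fin r) ℂ) (w : Filt d 1 r) :
    pair u w = pairHom u w := by
  rw [pair_eq_tsum_mul, pairHom_eq, tsum_eq_sum]
  intro k hk
  rw [Finsupp.notMem_support_iff.1 hk]; simp

lemma sqNorm_finsupp_lt_top (w : Filt d t r) : sqNorm w < ∞ := by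
  rw [sqNorm, tsum_eq_sum (s := w.support)]
  · refine ENNReal.sum_lt_top.2 fun k _ => ENNReal.sum_lt_top.2 fun i _ =>
      ENNReal.sum_lt_top.2 fun j _ => by simp
  · intro k hk
    rw [Finsupp.notMem_support_iff.1 hk]; simp

lemma fourierSeries_apply_entry (w : Filt d t r) (i : Fin t) (q : Fin r) (ξ : E d) :
    fourierSeries w ξ i q =
      fourierSeries (w.mapRange (fun A : Matrix (Fin t) (Fin r) ℂ => A i q) rfl) ξ := by
  rw [fourierSeries_eq, Matrix.sum_apply]
  exact (Finsupp.sum_mapRange_index (g := w)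
    (f := fun A : Matrix (Fin t) (Fin r) ℂ => A i q) (hf := rfl)
    (h := fun k (c : ℂ) => Complex.exp (-(Complex.I * ((inner ℝ (pt k) ξ : ℝ) : ℂ))) • c)
    fun _ => smul_zero (A := ℂ) _).symm

/-- Parseval's identity for finitely supported sequences of row vectors. -/
lemma lintegral_fourierSeries_cube (w : Filt d 1 r) :
    ∫⁻ x in cube d, ∑ q, ‖fourierSeries w ((2 * Real.pi) • x) 0 q‖ₑ ^ 2 = sqNorm w := by
  rw [lintegral_finsetSum']
  · simp_rw [fourierSeries_apply_entry, lintegral_trigPoly_cube]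
    rw [← Summable.tsum_finsetSum fun _ _ => ENNReal.summable]
    simp only [sqNorm, Finset.univ_unique, Finset.sum_singleton]
    rfl
  · intro q _
    simp_rw [fourierSeries_apply_entry]
    have : Continuous fun x : E d => fourierSeries
        (w.mapRange (fun A : Matrix (Fin 1) (Fin r) ℂ => A 0 q) rfl) ((2 * Real.pi) • x) := by
      simp_rw [fourierSeries_eq]
      refine continuous_finsetSum _ fun k _ => ?_
      exact ((continuous_expo_right (pt k)).comp (continuous_const_smul _)).smul continuous_const
    exact (this.enorm.measurable.pow_const 2).aemeasurable

lemma finite_rnd_image {K : Set (E d)} (hK : IsCompact K) : (rnd '' K).Finite := by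
  obtain ⟨R, hR⟩ := hK.isBounded.exists_norm_le
  refine (Set.finite_Icc (fun _ : Fin d => -⌈R⌉ - 1) (fun _ => ⌈R⌉ + 1)).subset ?_
  rintro _ ⟨x, hx, rfl⟩
  have h1 : ∀ i, |x i| ≤ R := fun i => (PiLp.norm_apply_le x i).trans (hR x hx)
  have h2 : R ≤ ⌈R⌉ := Int.le_ceil R
  refine ⟨fun i => ?_, fun i => ?_⟩
  · have := (abs_le.1 (h1 i)).1
    simp only [rnd]
    rw [Int.le_ceil_iff]
    push_cast
    linarith
  · have := (abs_le.1 (h1 i)).2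
    simp only [rnd]
    rw [Int.ceil_le]
    push_cast
    linarith

/-- An integral over the space, folded into an integral over the cube. -/
lemma integral_eq_sum_cube {K : Set (E d)} (hK : IsCompact K) {h : E d → ℂ}
    (hi : Integrable h volume) (h0 : ∀ᵐ x, x ∉ K → h x = 0) :
    ∫ x, h x = ∑ m ∈ (finite_rnd_image hK).toFinset, ∫ x in cube d, h (x + pt m) := by
  have h1 : ∀ m : Z d, ∫ x in cube d, h (x + pt m) = ∫ x, (rnd ⁻¹' {m}).indicator h x := by
    intro m
    rw [← integral_indicator measurableSet_cube, ← integral_sub_right_eq_self (μ := volume) _ (pt m)]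
    refine integral_congr_ae (Eventually.of_forall fun x => ?_)
    by_cases hx : rnd x = m
    · have : x - pt m ∈ cube d := (sub_pt_mem_cube_iff x m).2 hx
      simp [Set.indicator_of_mem, this, hx]
    · have : x - pt m ∉ cube d := fun hh => hx ((sub_pt_mem_cube_iff x m).1 hh)
      simp [Set.indicator_of_notMem, this, hx]
  simp_rw [h1]
  rw [← integral_finsetSum _ fun m _ => hi.indicator (measurable_rnd (measurableSet_singleton m))]
  refine integral_congr_ae ?_
  filter_upwards [h0] with x hx
  by_cases hxK : x ∈ K
  · rw [Finset.sum_eq_single (rnd x)]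
    · simp
    · intro m _ hm
      exact Set.indicator_of_notMem (s := rnd ⁻¹' {m}) (fun hh : rnd x = m => hm hh.symm) _
    · intro hh
      exact absurd ((finite_rnd_image hK).mem_toFinset.2 ⟨x, hxK, rfl⟩) hh
  · rw [hx hxK]
    refine (Finset.sum_eq_zero fun m _ => ?_).symm
    by_cases hm : rnd x = m
    · simp [hm, hx hxK]
    · exact Set.indicator_of_notMem (s := rnd ⁻¹' {m}) hm _

/-- For compactly supported `f`, the numbers `f̂(ξ + 2πk)` are the Fourier coefficients of a
periodization of `f(x) exp(-i x·ξ)`, a locally finite sum; so their sum of squares is bounded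
uniformly in `ξ`. -/
lemma exists_tsum_hat_sq_le {f : L2 d} (hf : IsCompactlySupported f) :
    ∃ B : ℝ, 0 < B ∧ ∀ ξ : E d,
      ∑' k : Z d, ‖fourierIntegralHat f (ξ + (2 * Real.pi) • pt k)‖ₑ ^ 2 ≤ ENNReal.ofReal B := by
  have hint := hf.integrable
  obtain ⟨K, hK, hfK⟩ := hf
  set F := (finite_rnd_image hK).toFinset with hF
  have hm : ∀ m : Z d, MemLp (fun x => f (x + pt m)) 2 (volume.restrict (cube d)) := fun m =>
    ((Lp.memLp f).comp_measurePreserving (measurePreserving_add_right volume (pt m))).restrict _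
  -- a bound for the periodizations by Cauchy–Schwarz over the finite set of translates
  set B₀ : ℝ := ∫ x in cube d, F.card * ∑ m ∈ F, ‖f (x + pt m)‖ ^ 2 with hB₀
  have hB₀0 : 0 ≤ B₀ := integral_nonneg fun x => by positivity
  refine ⟨B₀ + 1, by positivity, fun ξ => ?_⟩
  have hgm : ∀ m : Z d, MemLp (fun x => f (x + pt m) * expo (x + pt m) ξ) 2
      (volume.restrict (cube d)) := by
    intro m
    refine (hm m).of_le ((hm m).aestronglyMeasurable.mul
      ((continuous_expo_left ξ).comp (by fun_prop)).aestronglyMeasurable) ?_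
    exact Eventually.of_forall fun x => by simp [norm_expo]
  set g : E d → ℂ := fun x => ∑ m ∈ F, f (x + pt m) * expo (x + pt m) ξ with hg
  have hgL : MemLp g 2 (volume.restrict (cube d)) := memLp_finsetSum _ fun m _ => hgm m
  have hcoef : ∀ k : Z d, fourierIntegralHat f (ξ + (2 * Real.pi) • pt k) =
      ∫ x in cube d, g x * expo (pt k) ((2 * Real.pi) • x) := by
    intro k
    rw [fourierIntegralHat_eq_integral_expo,
      integral_eq_sum_cube hK (integrable_mul_expo hint _)
        (by filter_upwards [hfK] with x hx hxK; rw [hx hxK, zero_mul])]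
    simp_rw [hg, Finset.sum_mul]
    rw [integral_finsetSum]
    · refine Finset.sum_congr rfl fun m _ => integral_congr_ae (Eventually.of_forall fun x => ?_)
      have e1 : expo (x + pt m) (ξ + (2 * Real.pi) • pt k) =
          expo (x + pt m) ξ * expo (pt k) ((2 * Real.pi) • x) := by
        rw [expo_add_right, expo_add_left x (pt m) ((2 * Real.pi) • pt k), expo_pt_two_pi, mul_one,
          expo_comm x ((2 * Real.pi) • pt k), expo_smul]
      simp only [e1, mul_assoc]
    · intro m _
      refine ((hgm m).integrable (by norm_num)).mul_bdd (c := 1) ?_ ?_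
      · exact ((continuous_expo_right (pt k)).comp (continuous_const_smul _)).aestronglyMeasurable
      · exact Eventually.of_forall fun x => (norm_expo _ _).le
  have hsum := hasSum_sq_coeff_cube hgL
  simp_rw [← hcoef] at hsum
  rw [tsum_enorm_sq_eq hsum.summable, hsum.tsum_eq]
  refine ENNReal.ofReal_le_ofReal (le_trans ?_ (le_add_of_nonneg_right zero_le_one))
  refine integral_mono hgL.integrable_norm_pow' ?_ fun x => ?_
  · exact (integrable_finsetSum _ fun m _ => (hm m).integrable_norm_pow').const_mul _
  · refine (pow_le_pow_left₀ (norm_nonneg _) (norm_sum_le _ _) 2).trans ?_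
    refine (sq_sum_le_card_mul_sum_sq).trans_eq ?_
    simp [norm_expo]

lemma enorm_sum_mul_sq_le (x y : Fin r → ℂ) :
    ‖∑ q, x q * y q‖ₑ ^ 2 ≤ ∑ q, r * (‖x q‖ₑ ^ 2 * ‖y q‖ₑ ^ 2) := by
  have h1 : ‖∑ q, x q * y q‖ ^ 2 ≤ ∑ q, r * (‖x q‖ ^ 2 * ‖y q‖ ^ 2) := by
    refine (pow_le_pow_left₀ (norm_nonneg _) (norm_sum_le _ _) 2).trans ?_
    refine (sq_sum_le_card_mul_sum_sq).trans_eq ?_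
    simp [Finset.mul_sum, mul_pow]
  have h5 := ENNReal.ofReal_le_ofReal h1
  rw [ENNReal.ofReal_pow (norm_nonneg _), ofReal_norm,
    ENNReal.ofReal_sum_of_nonneg fun _ _ => by positivity] at h5
  refine h5.trans_eq (Finset.sum_congr rfl fun q _ => ?_)
  rw [ENNReal.ofReal_mul (by positivity), ENNReal.ofReal_mul (by positivity),
    ENNReal.ofReal_pow (norm_nonneg _), ENNReal.ofReal_pow (norm_nonneg _), ofReal_norm,
    ofReal_norm, ENNReal.ofReal_natCast]

/-- The quadratic form of the bracket product is bounded, uniformly in `ξ`. -/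
lemma exists_tsum_dot_vecHat_sq_le {ψ₀ : Fin r → L2 d} (hsupp : ∀ q, IsCompactlySupported (ψ₀ q)) :
    ∃ C : ℝ, 0 < C ∧ ∀ (ξ : E d) (c : Fin r → ℂ),
      ∑' k : Z d, ‖∑ q, c q * vecHat ψ₀ (ξ + (2 * Real.pi) • pt k) q‖ₑ ^ 2 ≤
        ENNReal.ofReal C * ∑ q, ‖c q‖ₑ ^ 2 := by
  choose B hB hB2 using fun q => exists_tsum_hat_sq_le (hsupp q)
  refine ⟨r * (∑ q, B q) + 1, ?_, fun ξ c => ?_⟩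
  · have : 0 ≤ ∑ q, B q := Finset.sum_nonneg fun q _ => (hB q).le
    positivity
  refine (ENNReal.tsum_le_tsum fun k => enorm_sum_mul_sq_le _ _).trans ?_
  rw [Summable.tsum_finsetSum fun _ _ => ENNReal.summable, Finset.mul_sum]
  refine Finset.sum_le_sum fun q _ => ?_
  simp_rw [← mul_assoc]
  rw [ENNReal.tsum_mul_left, mul_right_comm]
  gcongr
  calc (r : ℝ≥0∞) * ∑' k : Z d, ‖vecHat ψ₀ (ξ + (2 * Real.pi) • pt k) q‖ₑ ^ 2
      ≤ ENNReal.ofReal r * ENNReal.ofReal (B q) := by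
        rw [ENNReal.ofReal_natCast]
        gcongr
        exact hB2 q ξ
    _ ≤ _ := by
        rw [← ENNReal.ofReal_mul (by positivity)]
        refine ENNReal.ofReal_le_ofReal ?_
        have := Finset.single_le_sum (f := B) (fun q _ => (hB q).le) (Finset.mem_univ q)
        have : (r : ℝ) * B q ≤ r * ∑ q, B q := by gcongr
        linarith

lemma fourierSeries_add_two_pi {V : Type*} [AddCommMonoid V] [Module ℂ V] (u : Z d →₀ V)
    (ξ : E d) (k : Z d) : fourierSeries u (ξ + (2 * Real.pi) • pt k) = fourierSeries u ξ := by
  rw [fourierSeries_eq, fourierSeries_eq]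
  refine Finset.sum_congr rfl fun m _ => ?_
  rw [expo_add_right, expo_pt_two_pi, mul_one]

/-- Plancherel's formula for a combination of shifts: `∫ ŵ [φ̂, φ̂] ŵᴴ` over a period, the quadratic form
of the bracket product being written as a sum of squares. -/
lemma enorm_synth_sq {ψ₀ : Fin r → L2 d} (hsupp : ∀ q, IsCompactlySupported (ψ₀ q))
    (w : Filt d 1 r) : ‖synth w ψ₀ 0‖ₑ ^ 2 = ∫⁻ x in cube d, ∑' k : Z d,
      ‖∑ q, fourierSeries w ((2 * Real.pi) • x) 0 q *
        vecHat ψ₀ ((2 * Real.pi) • x + (2 * Real.pi) • pt k) q‖ₑ ^ 2 := by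
  have hc := isCompactlySupported_synth hsupp w 0
  rw [← lintegral_hat_sq hc, lintegral_eq_tsum_cube, lintegral_tsum]
  · refine tsum_congr fun k => lintegral_congr fun x => ?_
    rw [hat_synth hsupp, smul_add, fourierSeries_add_two_pi]
    rfl
  · intro k
    have h1 : Continuous fun x : E d => fourierIntegralHat (synth w ψ₀ 0)
        ((2 * Real.pi) • x + (2 * Real.pi) • pt k) :=
      (continuous_hat hc.integrable).comp (by fun_prop)
    have h2 : (fun x : E d => ‖∑ q, fourierSeries w ((2 * Real.pi) • x) 0 q *
        vecHat ψ₀ ((2 * Real.pi) • x + (2 * Real.pi) • pt k) q‖ₑ ^ 2) = fun x =>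
        ‖fourierIntegralHat (synth w ψ₀ 0) ((2 * Real.pi) • x + (2 * Real.pi) • pt k)‖ₑ ^ 2 := by
      funext x
      rw [hat_synth hsupp, fourierSeries_add_two_pi]
      rfl
    rw [h2]
    exact (h1.enorm.measurable.pow_const 2).aemeasurable

lemma exists_enorm_synth_sq_le {ψ₀ : Fin r → L2 d} (hsupp : ∀ q, IsCompactlySupported (ψ₀ q)) :
    ∃ C : ℝ, 0 < C ∧ ∀ w : Filt d 1 r, ‖synth w ψ₀ 0‖ₑ ^ 2 ≤ ENNReal.ofReal C * sqNorm w := by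
  obtain ⟨C, hC, hC2⟩ := exists_tsum_dot_vecHat_sq_le hsupp
  refine ⟨C, hC, fun w => ?_⟩
  rw [enorm_synth_sq hsupp, ← lintegral_fourierSeries_cube,
    ← lintegral_const_mul' _ _ ENNReal.ofReal_ne_top]
  exact lintegral_mono fun x => hC2 _ _

/-- The shifts of compactly supported functions are a Bessel family, by duality from the
boundedness of the synthesis operator. -/
lemma isBessel_shifts {ψ₀ : Fin r → L2 d} (hsupp : ∀ q, IsCompactlySupported (ψ₀ q)) :
    IsBessel (shifts ψ₀) := by
  obtain ⟨C, hC, h⟩ := exists_enorm_synth_sq_le hsupp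
  refine ⟨C, hC, fun f => ?_⟩
  rw [sqNorm, ENNReal.tsum_eq_iSup_sum]
  refine iSup_le fun S => ?_
  classical
  -- test with the coefficients themselves, truncated to a finite set
  let w : Filt d 1 r := Finsupp.onFinset S (fun k => if k ∈ S then coef (shifts ψ₀) f k else 0)
    (fun k hk => by by_contra hcon; simp [hcon] at hk)
  have hw : sqNorm w = ∑ k ∈ S, ∑ i, ∑ j, ‖coef (shifts ψ₀) f k i j‖ₑ ^ 2 := by
    rw [sqNorm, tsum_eq_sum (s := S)]
    · refine Finset.sum_congr rfl fun k hk => ?_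
      simp [w, hk]
    · intro k hk
      simp [w, hk]
  rw [← hw]
  have hinner : inner ℂ (synth w ψ₀ 0) f = pair w w := by
    rw [← pair_star, pair_eq_pairHom, pairHom_eq, synth_eq, sum_inner, star_sum]
    refine Finset.sum_congr rfl fun k hk => ?_
    have hkS : k ∈ S := by
      by_contra hcon
      exact (Finsupp.mem_support_iff.1 hk) (by simp [w, hcon])
    rw [sum_inner, Matrix.mul_apply, star_sum]
    refine Finset.sum_congr rfl fun q _ => ?_
    rw [inner_smul_left, Matrix.conjTranspose_apply, star_mul', star_star]
    have : w k 0 q = inner ℂ (shifts ψ₀ q k) f := by simp [w, hkS, coef]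
    rw [← this]
    rfl
  have hfin := sqNorm_finsupp_lt_top w
  have e1 : sqNorm w = ‖(inner ℂ (synth w ψ₀ 0) f : ℂ)‖ₑ := by
    rw [hinner, enorm_pair_self hfin]
  have e2 : 2 * sqNorm w ≤ ENNReal.ofReal C⁻¹ * ‖synth w ψ₀ 0‖ₑ ^ 2 + ENNReal.ofReal C * ‖f‖ₑ ^ 2 := by
    have h1 : ‖(inner ℂ (synth w ψ₀ 0) f : ℂ)‖ ≤ ‖synth w ψ₀ 0‖ * ‖f‖ := norm_inner_le_norm _ _
    have h2 := two_mul_enorm_mul_le (inv_pos.2 hC) (‖synth w ψ₀ 0‖ : ℂ) (‖f‖ : ℂ)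
    have h3 : ∀ x : ℝ, 0 ≤ x → ‖(x : ℂ)‖ₑ = ENNReal.ofReal x := fun x hx => by
      rw [← ofReal_norm, Complex.norm_real, Real.norm_of_nonneg hx]
    rw [inv_inv, h3 _ (norm_nonneg _), h3 _ (norm_nonneg _), ofReal_norm, ofReal_norm] at h2
    refine le_trans ?_ h2
    rw [e1]
    gcongr
    rw [← ofReal_norm, ← ofReal_norm]
    refine ENNReal.ofReal_le_ofReal (h1.trans_eq ?_)
    simp
  have e3 : ENNReal.ofReal C⁻¹ * ‖synth w ψ₀ 0‖ₑ ^ 2 ≤ sqNorm w := by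
    refine (mul_le_mul_right (h w) _).trans ?_
    rw [← mul_assoc, ← ENNReal.ofReal_mul (inv_nonneg.2 hC.le), inv_mul_cancel₀ hC.ne',
      ENNReal.ofReal_one, one_mul]
  refine le_of_two_mul_le hfin.ne (e2.trans ?_)
  rw [add_comm]
  gcongr

end Bessel


/-! ### Bounds for the bracket product -/

section Bracket

variable {d r : ℕ}

open scoped ComplexOrder

lemma hasSum_bracket {ψ₀ : Fin r → L2 d} (hsupp : ∀ q, IsCompactlySupported (ψ₀ q)) (ξ : E d)
    (p q : Fin r) : HasSum (fun k : Z d => vecHat ψ₀ (ξ + (2 * Real.pi) • pt k) p *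
      star (vecHat ψ₀ (ξ + (2 * Real.pi) • pt k) q)) (bracket (vecHat ψ₀) (vecHat ψ₀) ξ p q) := by
  have h : ∀ q, Summable fun k : Z d => ‖vecHat ψ₀ (ξ + (2 * Real.pi) • pt k) q‖ ^ 2 := by
    intro q
    obtain ⟨B, -, hB⟩ := exists_tsum_hat_sq_le (hsupp q)
    exact (summable_sq_iff_enorm _).2 ((hB ξ).trans_lt ENNReal.ofReal_lt_top).ne
  exact (summable_mul_of_summable_sq (h p) (h q)).of_norm.hasSum

lemma isHermitian_bracket (φ : E d → Fin r → ℂ) (ξ : E d) : (bracket φ φ ξ).IsHermitian := by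
  ext p q
  simp only [bracket, Matrix.conjTranspose_apply, Matrix.of_apply, Complex.star_def,
    Complex.conj_tsum, map_mul, Complex.conj_conj]
  exact tsum_congr fun k => mul_comm _ _

lemma hasSum_bracket_quadratic {ψ₀ : Fin r → L2 d} (hsupp : ∀ q, IsCompactlySupported (ψ₀ q))
    (ξ : E d) (x : Fin r → ℂ) :
    HasSum (fun k : Z d =>
      ((‖∑ q, star (x q) * vecHat ψ₀ (ξ + (2 * Real.pi) • pt k) q‖ ^ 2 : ℝ) : ℂ))
      (star x ⬝ᵥ (bracket (vecHat ψ₀) (vecHat ψ₀) ξ).mulVec x) := by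
  have h := hasSum_sum fun p (_ : p ∈ Finset.univ) => (hasSum_sum fun q (_ : q ∈ Finset.univ) =>
    (hasSum_bracket hsupp ξ p q).mul_right (x q)).mul_left (star (x p))
  simp only [dotProduct, Matrix.mulVec, Pi.star_apply]
  refine h.congr_fun ?_
  intro k
  have h0 : ∀ z : ℂ, ((‖z‖ ^ 2 : ℝ) : ℂ) = z * star z := fun z => by
    rw [Complex.star_def, Complex.mul_conj, Complex.normSq_eq_norm_sq]
  rw [h0, star_sum, Finset.sum_mul]
  refine Finset.sum_congr rfl fun p _ => ?_
  rw [Finset.mul_sum, Finset.mul_sum]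
  refine Finset.sum_congr rfl fun q _ => ?_
  rw [star_mul', star_star]
  ring

/-- The quadratic form of the bracket product is a sum of squares. -/
lemma bracket_quadratic {ψ₀ : Fin r → L2 d} (hsupp : ∀ q, IsCompactlySupported (ψ₀ q))
    (ξ : E d) (x : Fin r → ℂ) :
    ∃ a : ℝ, 0 ≤ a ∧ star x ⬝ᵥ (bracket (vecHat ψ₀) (vecHat ψ₀) ξ).mulVec x = (a : ℂ) ∧
      ∑' k : Z d, ‖∑ q, star (x q) * vecHat ψ₀ (ξ + (2 * Real.pi) • pt k) q‖ₑ ^ 2 =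
        ENNReal.ofReal a := by
  have h := hasSum_bracket_quadratic hsupp ξ x
  have hs : Summable fun k : Z d =>
      ‖∑ q, star (x q) * vecHat ψ₀ (ξ + (2 * Real.pi) • pt k) q‖ ^ 2 :=
    Complex.summable_ofReal.1 h.summable
  refine ⟨_, tsum_nonneg fun k => by positivity, ?_, tsum_enorm_sq_eq hs⟩
  rw [← h.tsum_eq, Complex.ofReal_tsum]

lemma dotProduct_star_self (x : Fin r → ℂ) : star x ⬝ᵥ x = ((∑ q, ‖x q‖ ^ 2 : ℝ) : ℂ) := by
  simp only [dotProduct, Pi.star_apply]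
  push_cast
  refine Finset.sum_congr rfl fun q _ => ?_
  rw [Complex.star_def, Complex.conj_mul']

lemma sum_enorm_sq (x : Fin r → ℂ) : ∑ q, ‖x q‖ₑ ^ 2 = ENNReal.ofReal (∑ q, ‖x q‖ ^ 2) := by
  rw [ENNReal.ofReal_sum_of_nonneg fun _ _ => by positivity]
  refine Finset.sum_congr rfl fun q _ => ?_
  rw [ENNReal.ofReal_pow (norm_nonneg _), ofReal_norm]

/-- The bracket products of compactly supported functions are bounded. -/
lemma bracketsBoundedAbove {ψ₀ ψ₀' : Fin r → L2 d} (hsupp : ∀ q, IsCompactlySupported (ψ₀ q))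
    (hsupp' : ∀ q, IsCompactlySupported (ψ₀' q)) :
    BracketsBoundedAbove (vecHat ψ₀) (vecHat ψ₀') := by
  obtain ⟨C, hC, h⟩ := exists_tsum_dot_vecHat_sq_le hsupp
  obtain ⟨C', hC', h'⟩ := exists_tsum_dot_vecHat_sq_le hsupp'
  refine ⟨C + C', add_pos hC hC', Eventually.of_forall fun ξ => ?_⟩
  refine Matrix.PosSemidef.of_dotProduct_mulVec_nonneg ?_ fun x => ?_
  · refine Matrix.IsHermitian.sub ?_ ((isHermitian_bracket _ ξ).add (isHermitian_bracket _ ξ))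
    rw [Matrix.IsHermitian, Matrix.conjTranspose_smul, Matrix.conjTranspose_one,
      Complex.star_def, Complex.conj_ofReal]
  · obtain ⟨a, ha, e1, e2⟩ := bracket_quadratic hsupp ξ x
    obtain ⟨a', ha', e1', e2'⟩ := bracket_quadratic hsupp' ξ x
    have hx : ∑ q, ‖star (x q)‖ₑ ^ 2 = ENNReal.ofReal (∑ q, ‖x q‖ ^ 2) := by
      rw [sum_enorm_sq fun q => star (x q)]
      simp
    have h1 := h ξ fun q => star (x q)
    have h1' := h' ξ fun q => star (x q)
    have hn : 0 ≤ ∑ q, ‖x q‖ ^ 2 := by positivity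
    rw [e2, hx, ← ENNReal.ofReal_mul hC.le, ENNReal.ofReal_le_ofReal_iff (by positivity)] at h1
    rw [e2', hx, ← ENNReal.ofReal_mul hC'.le, ENNReal.ofReal_le_ofReal_iff (by positivity)] at h1'
    rw [Matrix.sub_mulVec, Matrix.add_mulVec, dotProduct_sub, dotProduct_add, e1, e1',
      Matrix.smul_mulVec, Matrix.one_mulVec, dotProduct_smul, dotProduct_star_self, smul_eq_mul,
      ← Complex.ofReal_mul, ← Complex.ofReal_add, ← Complex.ofReal_sub, Complex.zero_le_real]
    linarith

/-- A lower bound for the bracket product is a lower bound for the synthesis operator. -/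
lemma le_enorm_synth_sq {ψ₀ : Fin r → L2 d} (hsupp : ∀ q, IsCompactlySupported (ψ₀ q)) {C : ℝ}
    (hC : 0 < C) (h : ∀ᵐ ξ : E d, (bracket (vecHat ψ₀) (vecHat ψ₀) ξ -
      (C : ℂ) • (1 : Matrix (Fin r) (Fin r) ℂ)).PosSemidef) (w : Filt d 1 r) :
    ENNReal.ofReal C * sqNorm w ≤ ‖synth w ψ₀ 0‖ₑ ^ 2 := by
  rw [enorm_synth_sq hsupp, ← lintegral_fourierSeries_cube,
    ← lintegral_const_mul' _ _ ENNReal.ofReal_ne_top]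
  refine lintegral_mono_ae (ae_restrict_of_ae ?_)
  filter_upwards [(quasiMeasurePreserving_const_smul two_pi_pos.ne').ae h] with x hx
  -- the quadratic form conjugates its argument, hence the conjugate of the row vector `ŵ`
  set c : Fin r → ℂ := fun q => star (fourierSeries w ((2 * Real.pi) • x) 0 q) with hc
  obtain ⟨a, ha, e1, e2⟩ := bracket_quadratic hsupp ((2 * Real.pi) • x) c
  have h1 := hx.dotProduct_mulVec_nonneg c
  rw [Matrix.sub_mulVec, dotProduct_sub, e1, Matrix.smul_mulVec, Matrix.one_mulVec,
    dotProduct_smul, dotProduct_star_self, smul_eq_mul, ← Complex.ofReal_mul,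
    ← Complex.ofReal_sub, Complex.zero_le_real] at h1
  simp only [hc, star_star, norm_star] at e2 h1
  rw [e2, sum_enorm_sq, ← ENNReal.ofReal_mul hC.le]
  exact ENNReal.ofReal_le_ofReal (by linarith)

end Bracket

/-! ### Interpolation -/

section Interpolation

variable {d r : ℕ}

lemma sq_le_mul_of_forall_two_mul_le {a x y : ℝ} (ha : 0 ≤ a) (hx : 0 ≤ x) (hy : 0 ≤ y)
    (h : ∀ t : ℝ, 0 < t → 2 * a ≤ t * x + t⁻¹ * y) : a ^ 2 ≤ x * y := by
  rcases ha.eq_or_lt with rfl | ha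
  · simpa using mul_nonneg hx hy
  rcases hx.eq_or_lt with rfl | hx
  · have h1 := h ((y + 1) / a) (by positivity)
    have h2 : ((y + 1) / a)⁻¹ * y ≤ a := by
      rw [inv_div, div_mul_eq_mul_div, div_le_iff₀ (by positivity)]
      nlinarith
    linarith
  · have h1 := h (a / x) (by positivity)
    rw [div_mul_cancel₀ _ hx.ne', inv_div, div_mul_eq_mul_div] at h1
    have h2 : a ≤ x * y / a := by linarith
    rw [le_div_iff₀ ha] at h2
    nlinarith

lemma norm_pair_sq_le {u v : Z d → Matrix (Fin 1) (Fin r) ℂ} (hu : sqNorm u < ∞)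
    (hv : sqNorm v < ∞) : ‖pair u v‖ ^ 2 ≤ (sqNorm u).toReal * (sqNorm v).toReal := by
  refine sq_le_mul_of_forall_two_mul_le (norm_nonneg _) ENNReal.toReal_nonneg
    ENNReal.toReal_nonneg fun t ht => ?_
  have h1 := two_mul_enorm_pair_le ht u v
  have h2 := ENNReal.toReal_mono (ENNReal.add_lt_top.2
    ⟨ENNReal.mul_lt_top ENNReal.ofReal_lt_top hu, ENNReal.mul_lt_top ENNReal.ofReal_lt_top hv⟩).ne h1
  rwa [ENNReal.toReal_add (ENNReal.mul_lt_top ENNReal.ofReal_lt_top hu).ne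
    (ENNReal.mul_lt_top ENNReal.ofReal_lt_top hv).ne, ENNReal.toReal_mul, ENNReal.toReal_mul,
    ENNReal.toReal_mul, ENNReal.toReal_ofReal ht.le, ENNReal.toReal_ofReal (inv_nonneg.2 ht.le),
    toReal_enorm, ENNReal.toReal_ofNat] at h2

variable {H : Type*} [NormedAddCommGroup H] [InnerProductSpace ℂ H] [CompleteSpace H]

/-- Interpolation by duality: if synthesis is bounded below on finitely supported sequences, then
`∑ wₖ φₖ ↦ ∑ wₖ v̄ₖ` is a bounded functional on the span of the family; the vector that represents a
norm-preserving extension has the prescribed coefficients. -/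
lemma hasBoundedInterpolation_of_le {φ : Fin r → Z d → H} {C : ℝ} (hC : 0 < C)
    (h : ∀ w : Filt d 1 r, ENNReal.ofReal C * sqNorm w ≤
      ‖w.sum fun m B => ∑ q, B 0 q • φ q m‖ₑ ^ 2) : HasBoundedInterpolation φ := by
  classical
  refine ⟨C⁻¹, inv_pos.2 hC, fun v hv => ?_⟩
  let S : Filt d 1 r →ₗ[ℂ] H := Finsupp.lsum ℂ fun m =>
    { toFun := fun B => ∑ q, B 0 q • φ q m
      map_add' := fun A B => by simp [add_smul, Finset.sum_add_distrib]
      map_smul' := fun c B => by simp [mul_smul, Finset.smul_sum] }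
  let L : Filt d 1 r →ₗ[ℂ] ℂ := Finsupp.lsum ℂ fun m =>
    { toFun := fun B => ∑ q, B 0 q * star (v m 0 q)
      map_add' := fun A B => by simp [add_mul, Finset.sum_add_distrib]
      map_smul' := fun c B => by simp [mul_assoc, Finset.mul_sum] }
  have hS : ∀ w : Filt d 1 r, C * (sqNorm w).toReal ≤ ‖S w‖ ^ 2 := by
    intro w
    have h1 := ENNReal.toReal_mono (by simp) (h w)
    rwa [ENNReal.toReal_mul, ENNReal.toReal_ofReal hC.le, ENNReal.toReal_pow, toReal_enorm] at h1
  have hL : ∀ w, L w = pair w v := by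
    intro w
    rw [pair, tsum_eq_sum (s := w.support)]
    · change (w.sum fun m B => ∑ q, B 0 q * star (v m 0 q)) = _
      simp [Finsupp.sum]
    · intro k hk
      rw [Finsupp.notMem_support_iff.1 hk]; simp
  have hLS : ∀ w, ‖L w‖ ≤ Real.sqrt (C⁻¹ * (sqNorm v).toReal) * ‖S w‖ := by
    intro w
    refine abs_le_of_sq_le_sq' ?_ (by positivity) |>.2
    rw [mul_pow, Real.sq_sqrt (by positivity), hL]
    refine (norm_pair_sq_le (sqNorm_finsupp_lt_top w) hv).trans ?_
    have h1 : (sqNorm w).toReal ≤ C⁻¹ * ‖S w‖ ^ 2 := by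
      rw [inv_mul_eq_div, le_div_iff₀ hC, mul_comm]
      exact hS w
    calc (sqNorm w).toReal * (sqNorm v).toReal ≤ (C⁻¹ * ‖S w‖ ^ 2) * (sqNorm v).toReal := by gcongr
      _ = _ := by ring
  -- the functional `L` factors through the range of the synthesis map `S`
  have hker : LinearMap.ker S ≤ LinearMap.ker L := by
    intro w hw
    rw [LinearMap.mem_ker] at hw ⊢
    have := hLS w
    rw [hw, norm_zero, mul_zero] at this
    exact norm_le_zero_iff.1 this
  obtain ⟨ℓ, hℓ⟩ : ∃ ℓ : LinearMap.range S →ₗ[ℂ] ℂ, ∀ w, ℓ ⟨S w, ⟨w, rfl⟩⟩ = L w := by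
    refine ⟨(LinearMap.ker S).liftQ L hker ∘ₗ S.quotKerEquivRange.symm.toLinearMap, fun w => ?_⟩
    have : S.quotKerEquivRange.symm ⟨S w, ⟨w, rfl⟩⟩ = (LinearMap.ker S).mkQ w :=
      S.quotKerEquivRange.symm_apply_eq.2 rfl
    simp [this]
  let ℓc : LinearMap.range S →L[ℂ] ℂ := ℓ.mkContinuous (Real.sqrt (C⁻¹ * (sqNorm v).toReal)) (by
    rintro ⟨_, w, rfl⟩
    rw [hℓ]
    exact hLS w)
  obtain ⟨g, hg, hgn⟩ := exists_extension_norm_eq _ ℓc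
  refine ⟨(InnerProductSpace.toDual ℂ H).symm g, ?_, ?_⟩
  · funext k
    ext i q
    obtain rfl : i = 0 := Subsingleton.elim _ _
    have e1 : S (Finsupp.single k (Matrix.of fun _ j => if j = q then 1 else 0)) = φ q k := by
      simp [S]
    have e2 : L (Finsupp.single k (Matrix.of fun _ j => if j = q then 1 else 0)) =
        star (v k 0 q) := by
      simp [L]
    have e3 := hg ⟨_, _, e1⟩
    have e4 : ℓc ⟨φ q k, ⟨_, e1⟩⟩ = star (v k 0 q) := by
      rw [← e2, ← hℓ]
      change ℓ _ = ℓ _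
      congr 1
      exact Subtype.ext e1.symm
    simp only [coef, Matrix.of_apply]
    rw [← inner_conj_symm, InnerProductSpace.toDual_symm_apply, e3, e4, Complex.star_def,
      Complex.conj_conj]
  · have h1 : ‖(InnerProductSpace.toDual ℂ H).symm g‖ ≤ Real.sqrt (C⁻¹ * (sqNorm v).toReal) := by
      rw [LinearIsometryEquiv.norm_map, hgn]
      exact LinearMap.mkContinuous_norm_le _ (Real.sqrt_nonneg _) _
    have h2 : ‖(InnerProductSpace.toDual ℂ H).symm g‖ ^ 2 ≤ C⁻¹ * (sqNorm v).toReal := by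
      rw [← Real.sq_sqrt (show 0 ≤ C⁻¹ * (sqNorm v).toReal by positivity)]
      gcongr
    have h3 := ENNReal.ofReal_le_ofReal h2
    rwa [ENNReal.ofReal_pow (norm_nonneg _), ofReal_norm, ENNReal.ofReal_mul (inv_nonneg.2 hC.le),
      ENNReal.ofReal_toReal hv.ne] at h3

end Interpolation


/-! ### The pairing of the coefficients at fine scales -/

section FineScales

variable {d r : ℕ}

lemma exists_norm_act_le {N : Matrix (Fin d) (Fin d) ℤ} (hN : IsDilationMatrix N) :
    ∃ n : ℕ → ℝ, Tendsto n atTop (𝓝 0) ∧ (∀ J, 0 ≤ n J) ∧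
      ∀ J v, ‖act ((re N)⁻¹ ^ J) v‖ ≤ n J * ‖v‖ := by
  let T : Matrix (Fin d) (Fin d) ℝ →ₗ[ℝ] (E d →L[ℝ] E d) :=
    (Matrix.toEuclideanCLM (n := Fin d) (𝕜 := ℝ)).toAlgEquiv.toLinearMap
  have hT : Continuous T := LinearMap.continuous_of_finiteDimensional T
  refine ⟨fun J => ‖T ((re N)⁻¹ ^ J)‖, ?_, fun J => norm_nonneg _, fun J v => ?_⟩
  · have h := (hT.norm.tendsto 0).comp hN.tendsto_inv_pow
    simpa [Function.comp_def] using h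
  · exact (T ((re N)⁻¹ ^ J)).le_opNorm v

lemma inv_pow_mul_pow {A : Matrix (Fin d) (Fin d) ℝ} (hA : A.det ≠ 0) (J : ℕ) :
    A⁻¹ ^ J * A ^ J = 1 := by
  rw [Matrix.inv_pow', Matrix.nonsing_inv_mul]
  rw [Matrix.det_pow]
  exact (isUnit_iff_ne_zero.2 hA).pow J

/-- The averages of `F(W(y + k))` against `conj ψ`: up to normalisation, the coefficients of `F` with
respect to the dilates of `ψ`. -/
noncomputable def sample (W : Matrix (Fin d) (Fin d) ℝ) (ψ F : E d → ℂ) (k : Z d) : ℂ :=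
  ∫ y, star (ψ y) * F (act W (y + pt k))

lemma inner_dilate {U W : Matrix (Fin d) (Fin d) ℝ} (hU : U.det ≠ 0) (hW : W * U = 1)
    (ψ : L2 d) {f : L2 d} {F : E d → ℂ} (hf : f =ᵐ[volume] F) (k : Z d) :
    inner ℂ (dilate U (pt k) ψ) f =
      (((Real.sqrt |U.det|)⁻¹ : ℝ) : ℂ) * sample W ψ F k := by
  rw [L2.inner_def]
  have h1 : ∫ x, inner ℂ ((dilate U (pt k) ψ : L2 d) x) (f x) = ∫ x,
      (fun y => ((Real.sqrt |U.det| : ℝ) : ℂ) * (star (ψ (y - pt k)) * F (act W y))) (act U x) := by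
    refine integral_congr_ae ?_
    filter_upwards [coeFn_dilate hU (pt k) ψ, hf] with x h1 h2
    rw [h1, h2, act_act, hW, act_one]
    simp
    ring
  rw [h1, integral_comp_act hU
    (fun y => ((Real.sqrt |U.det| : ℝ) : ℂ) * (star (ψ (y - pt k)) * F (act W y))),
    integral_const_mul, sample, ← integral_sub_right_eq_self (μ := volume)
    (fun y => star (ψ y) * F (act W (y + pt k))) (pt k)]
  simp only [sub_add_cancel]
  rw [Complex.real_smul, ← mul_assoc, ← Complex.ofReal_mul]
  congr 2
  have hs : Real.sqrt |U.det| ≠ 0 := by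
    rw [Real.sqrt_ne_zero']; exact abs_pos.2 hU
  field_simp
  rw [Real.sq_sqrt (abs_nonneg _)]

lemma norm_sample_le (W : Matrix (Fin d) (Fin d) ℝ) {ψ F : E d → ℂ} (hψ : Integrable ψ volume)
    {C : ℝ} (hF : ∀ x, ‖F x‖ ≤ C) (k : Z d) : ‖sample W ψ F k‖ ≤ C * ∫ y, ‖ψ y‖ := by
  rw [← integral_const_mul]
  refine norm_integral_le_of_norm_le (hψ.norm.const_mul C) (Eventually.of_forall fun y => ?_)
  rw [norm_mul, norm_star, mul_comm]
  gcongr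
  exact hF _

/-- The lattice point `k = rnd (U x)` satisfies `W k ≈ x` when `W = U⁻¹` is small. -/
lemma act_add_pt_rnd {U W : Matrix (Fin d) (Fin d) ℝ} (hW : W * U = 1) (x y : E d) :
    act W (y + pt (rnd (act U x))) = x + act W (y - (act U x - pt (rnd (act U x)))) := by
  rw [← sub_add, act_add, act_add, act_sub, act_act, hW, act_one]
  abel

lemma norm_sub_pt_rnd_le (x : E d) : ‖x - pt (rnd x)‖ ≤ Real.sqrt d :=
  norm_le_of_mem_cube ((sub_pt_mem_cube_iff x _).2 rfl)

/-- For a fixed bound on `W`, the samples of compactly supported functions are supported in a fixed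
bounded set of positions. -/
lemma sample_rnd_eq_zero {U W : Matrix (Fin d) (Fin d) ℝ} (hW : W * U = 1) {ψ F : E d → ℂ}
    {n Rψ RF : ℝ} (hn : 0 ≤ n) (hWn : ∀ v, ‖act W v‖ ≤ n * ‖v‖)
    (hψ : ∀ᵐ y, Rψ < ‖y‖ → ψ y = 0) (hF : ∀ y, RF < ‖y‖ → F y = 0) {x : E d}
    (hx : RF + n * (Rψ + Real.sqrt d) < ‖x‖) : sample W ψ F (rnd (act U x)) = 0 := by
  refine integral_eq_zero_of_ae ?_
  filter_upwards [hψ] with y hy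
  by_cases h : Rψ < ‖y‖
  · simp [hy h]
  · rw [hF, mul_zero]; · rfl
    rw [act_add_pt_rnd hW]
    have h1 : ‖y - (act U x - pt (rnd (act U x)))‖ ≤ Rψ + Real.sqrt d :=
      (norm_sub_le _ _).trans (add_le_add (not_lt.1 h) (norm_sub_pt_rnd_le _))
    have h2 := (hWn (y - (act U x - pt (rnd (act U x))))).trans (mul_le_mul_of_nonneg_left h1 hn)
    have h3 := norm_sub_le_norm_add x (act W (y - (act U x - pt (rnd (act U x)))))
    linarith

lemma tendsto_sample {N : Matrix (Fin d) (Fin d) ℤ} (hN : IsDilationMatrix N) {ψ F : E d → ℂ}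
    (hψ : Integrable ψ volume) (hF : Continuous F) {C : ℝ} (hFC : ∀ x, ‖F x‖ ≤ C) (x : E d) :
    Tendsto (fun J => sample ((re N)⁻¹ ^ J) ψ F (rnd (act (re N ^ J) x))) atTop
      (𝓝 (star (∫ y, ψ y) * F x)) := by
  have hW : ∀ J, (re N)⁻¹ ^ J * re N ^ J = 1 := inv_pow_mul_pow hN.det_re_ne_zero
  obtain ⟨n, hn, hn0, hWn⟩ := exists_norm_act_le hN
  have e : star (∫ y, ψ y) * F x = ∫ y, star (ψ y) * F x := by
    rw [integral_mul_const]
    congr 1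
    exact integral_conj.symm
  rw [e]
  refine tendsto_integral_of_dominated_convergence (fun y => ‖ψ y‖ * C) (fun J => ?_)
    (hψ.norm.mul_const C) (fun J => Eventually.of_forall fun y => ?_)
    (Eventually.of_forall fun y => ?_)
  · exact (continuous_star.comp_aestronglyMeasurable hψ.aestronglyMeasurable).mul
      (hF.comp ((continuous_act _).comp (by fun_prop))).aestronglyMeasurable
  · rw [norm_mul, norm_star]
    gcongr
    exact hFC _
  · refine Tendsto.const_mul _ ((hF.tendsto x).comp ?_)
    simp_rw [act_add_pt_rnd (hW _)]
    rw [show 𝓝 x = 𝓝 (x + 0) by rw [add_zero]]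
    refine tendsto_const_nhds.add ?_
    refine squeeze_zero_norm (a := fun J => n J * (‖y‖ + Real.sqrt d)) (fun J => ?_) ?_
    · refine (hWn J _).trans (mul_le_mul_of_nonneg_left ?_ (hn0 J))
      exact (norm_sub_le _ _).trans (add_le_add le_rfl (norm_sub_pt_rnd_le _))
    · simpa using hn.mul_const (‖y‖ + Real.sqrt d)

/-- A sum over the lattice as an integral of a step function. -/
lemma integral_comp_rnd {U : Matrix (Fin d) (Fin d) ℝ} (hU : U.det ≠ 0) {G : Z d → ℂ}
    (hG : Integrable (fun x => G (rnd (act U x))) volume) :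
    ∫ x, G (rnd (act U x)) = ∑' k, ((|U.det|⁻¹ : ℝ) : ℂ) * G k := by
  have hm : Measurable fun x => rnd (act U x) := measurable_rnd.comp (continuous_act U).measurable
  have h1 : Integrable G (Measure.map (fun x => rnd (act U x)) volume) :=
    (integrable_map_measure (measurable_of_countable G).aestronglyMeasurable hm.aemeasurable).2 hG
  have h2 := integral_countable h1
  rw [integral_map hm.aemeasurable (measurable_of_countable G).aestronglyMeasurable] at h2
  rw [h2]
  refine tsum_congr fun k => ?_
  rw [Complex.real_smul]
  congr 2
  have h3 : (fun x => rnd (act U x)) ⁻¹' {k} = act U ⁻¹' ((fun x => x - pt k) ⁻¹' cube d) := by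
    ext x
    simp [sub_pt_mem_cube_iff]
  have h4 : MeasurableSet ((fun x : E d => x - pt k) ⁻¹' cube d) :=
    measurableSet_cube.preimage (measurable_sub_const _)
  rw [Measure.real, Measure.map_apply hm (measurableSet_singleton k), h3,
    ← Measure.map_apply (continuous_act U).measurable h4, map_act hU, Measure.smul_apply,
    (measurePreserving_sub_right volume (pt k)).measure_preimage measurableSet_cube.nullMeasurableSet,
    volume_cube, smul_eq_mul, mul_one, ENNReal.toReal_ofReal (by positivity)]

/-- The pairing of fine-scale coefficients as an integral of a step function. -/
lemma pair_coef_dilate {N : Matrix (Fin d) (Fin d) ℤ} (hN : (re N).det ≠ 0) {ψ₀ ψ₀' : Fin r → L2 d}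
    {f g : L2 d} {F G : E d → ℂ} (hf : f =ᵐ[volume] F) (hg : g =ᵐ[volume] G) (J : ℕ)
    (hi : Integrable (fun x => ∑ q, sample ((re N)⁻¹ ^ J) (ψ₀ q) F (rnd (act (re N ^ J) x)) *
      star (sample ((re N)⁻¹ ^ J) (ψ₀' q) G (rnd (act (re N ^ J) x)))) volume) :
    pair (coef (shifts ψ₀) ((dilateEquiv (re N) hN 0 ^ J)⁻¹ f))
        (coef (shifts ψ₀') ((dilateEquiv (re N) hN 0 ^ J)⁻¹ g)) =
      ∫ x, ∑ q, sample ((re N)⁻¹ ^ J) (ψ₀ q) F (rnd (act (re N ^ J) x)) *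
        star (sample ((re N)⁻¹ ^ J) (ψ₀' q) G (rnd (act (re N ^ J) x))) := by
  have hU : (re N ^ J).det ≠ 0 := by rw [Matrix.det_pow]; exact pow_ne_zero _ hN
  have hW := inv_pow_mul_pow hN J
  rw [integral_comp_rnd (G := fun k => ∑ q, sample ((re N)⁻¹ ^ J) (ψ₀ q) F k *
      star (sample ((re N)⁻¹ ^ J) (ψ₀' q) G k)) hU hi, pair]
  refine tsum_congr fun k => ?_
  rw [Fin.sum_univ_one, Finset.mul_sum]
  refine Finset.sum_congr rfl fun q _ => ?_
  simp only [coef, Matrix.of_apply]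
  rw [← inner_pow_left, ← inner_pow_left, shifts, shifts, ← dilate_pow_eq, ← dilate_pow_eq,
    inner_dilate hU hW _ hf, inner_dilate hU hW _ hg, star_mul', Complex.star_def, Complex.conj_ofReal]
  have hs : (((Real.sqrt |(re N ^ J).det|)⁻¹ : ℝ) : ℂ) * (((Real.sqrt |(re N ^ J).det|)⁻¹ : ℝ) : ℂ) =
      ((|(re N ^ J).det|⁻¹ : ℝ) : ℂ) := by
    rw [← Complex.ofReal_mul, ← mul_inv, Real.mul_self_sqrt (abs_nonneg _)]
  rw [← hs]
  ring

lemma exists_norm_bound {f : L2 d} (hf : IsCompactlySupported f) :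
    ∃ R : ℝ, 0 ≤ R ∧ ∀ᵐ y, R < ‖y‖ → f y = 0 := by
  obtain ⟨K, hK, h⟩ := hf
  obtain ⟨R, hR⟩ := hK.isBounded.exists_norm_le
  refine ⟨max R 0, le_max_right _ _, ?_⟩
  filter_upwards [h] with y hy hlt
  exact hy fun hyK => absurd hlt (not_lt.2 ((hR y hyK).trans (le_max_left _ _)))

/-- The limit of the fine-scale pairings, for continuous functions of compact support: the step
functions of `pair_coef_dilate` converge pointwise and are dominated by a bounded function of compact
support; the normalisation of the refinable functions at the origin identifies the limit. -/
lemma tendsto_pair_of_continuous {N : Matrix (Fin d) (Fin d) ℤ} (hN : IsDilationMatrix N)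
    {ψ₀ ψ₀' : Fin r → L2 d} (hsupp : ∀ q, IsCompactlySupported (ψ₀ q))
    (hsupp' : ∀ q, IsCompactlySupported (ψ₀' q))
    (hnorm : ∑ q, star (vecHat ψ₀ 0 q) * vecHat ψ₀' 0 q = 1)
    {f g : L2 d} {F G : E d → ℂ} (hf : f =ᵐ[volume] F) (hg : g =ᵐ[volume] G)
    (hF : Continuous F) (hFs : HasCompactSupport F) (hG : Continuous G) (hGs : HasCompactSupport G) :
    Tendsto (fun J : ℕ => pair
        (coef (shifts ψ₀) ((dilateEquiv (re N) hN.det_re_ne_zero 0 ^ J)⁻¹ f))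
        (coef (shifts ψ₀') ((dilateEquiv (re N) hN.det_re_ne_zero 0 ^ J)⁻¹ g)))
      atTop (𝓝 (inner ℂ g f)) := by
  obtain ⟨CF, hCF⟩ := hF.bounded_above_of_compact_support hFs
  obtain ⟨CG, hCG⟩ := hG.bounded_above_of_compact_support hGs
  obtain ⟨RF, hRF⟩ := hFs.isCompact.isBounded.exists_norm_le
  have hRF' : ∀ y, RF < ‖y‖ → F y = 0 := fun y hy => by
    by_contra h
    exact absurd hy (not_lt.2 (hRF y (subset_tsupport F h)))
  choose R hR0 hR using fun q => exists_norm_bound (hsupp q)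
  obtain ⟨n, hn, hn0, hWn⟩ := exists_norm_act_le hN
  obtain ⟨B, hB⟩ := hn.bddAbove_range
  have hB' : ∀ J, n J ≤ B := fun J => hB ⟨J, rfl⟩
  have hW : ∀ J, (re N)⁻¹ ^ J * re N ^ J = 1 := inv_pow_mul_pow hN.det_re_ne_zero
  have hint := fun q => (hsupp q).integrable
  have hint' := fun q => (hsupp' q).integrable
  set R₁ : ℝ := RF + B * ((∑ q, R q) + Real.sqrt d) with hR₁
  set S : ℕ → E d → ℂ := fun J x =>
    ∑ q, sample ((re N)⁻¹ ^ J) (ψ₀ q) F (rnd (act (re N ^ J) x)) *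
      star (sample ((re N)⁻¹ ^ J) (ψ₀' q) G (rnd (act (re N ^ J) x))) with hS
  set bound : E d → ℝ := (Metric.closedBall 0 R₁).indicator fun _ =>
    ∑ q, (CF * ∫ y, ‖ψ₀ q y‖) * (CG * ∫ y, ‖ψ₀' q y‖) with hbound
  have hbi : Integrable bound volume :=
    (integrable_indicator_iff Metric.isClosed_closedBall.measurableSet).2
      (integrableOn_const (isCompact_closedBall _ _).measure_lt_top.ne)
  have hSm : ∀ J, AEStronglyMeasurable (S J) volume := fun J =>
    ((measurable_of_countable fun k => ∑ q, sample ((re N)⁻¹ ^ J) (ψ₀ q) F k *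
      star (sample ((re N)⁻¹ ^ J) (ψ₀' q) G k)).comp
      (measurable_rnd.comp (continuous_act _).measurable)).aestronglyMeasurable
  have hSb : ∀ J x, ‖S J x‖ ≤ bound x := by
    intro J x
    by_cases hx : x ∈ Metric.closedBall (0 : E d) R₁
    · rw [hbound, Set.indicator_of_mem hx]
      refine (norm_sum_le _ _).trans (Finset.sum_le_sum fun q _ => ?_)
      rw [norm_mul, norm_star]
      exact mul_le_mul (norm_sample_le _ (hint q) hCF _) (norm_sample_le _ (hint' q) hCG _)
        (norm_nonneg _) ((norm_nonneg _).trans (norm_sample_le ((re N)⁻¹ ^ J) (hint q) hCF 0))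
    · rw [hbound, Set.indicator_of_notMem hx, hS]
      simp only
      rw [Finset.sum_eq_zero, norm_zero]
      intro q _
      rw [sample_rnd_eq_zero (hW J) (hn0 J) (hWn J) (hR q) hRF', zero_mul]
      rw [Metric.mem_closedBall, dist_zero_right, not_le] at hx
      refine lt_of_le_of_lt ?_ hx
      have h1 : R q ≤ ∑ q, R q := Finset.single_le_sum (fun q _ => hR0 q) (Finset.mem_univ q)
      have h2 : n J * (R q + Real.sqrt d) ≤ B * ((∑ q, R q) + Real.sqrt d) :=
        mul_le_mul (hB' J) (by linarith) (add_nonneg (hR0 q) (Real.sqrt_nonneg _))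
          ((hn0 J).trans (hB' J))
      linarith
  have hSi : ∀ J, Integrable (S J) volume := fun J =>
    hbi.mono' (hSm J) (Eventually.of_forall (hSb J))
  have hpair : ∀ J, pair
      (coef (shifts ψ₀) ((dilateEquiv (re N) hN.det_re_ne_zero 0 ^ J)⁻¹ f))
      (coef (shifts ψ₀') ((dilateEquiv (re N) hN.det_re_ne_zero 0 ^ J)⁻¹ g)) = ∫ x, S J x :=
    fun J => pair_coef_dilate hN.det_re_ne_zero hf hg J (hSi J)
  simp_rw [hpair]
  have hinner : inner ℂ g f = ∫ x, ∑ q, (star (∫ y, ψ₀ q y) * F x) *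
      star (star (∫ y, ψ₀' q y) * G x) := by
    rw [L2.inner_def]
    refine integral_congr_ae ?_
    filter_upwards [hf, hg] with x h1 h2
    have h3 : ∀ (φ : Fin r → L2 d) q, vecHat φ 0 q = ∫ y, φ q y := by
      intro φ q
      rw [vecHat, fourierIntegralHat_eq_integral_expo]
      simp [expo_zero_right]
    simp_rw [h3] at hnorm
    have h4 : ∑ q, (star (∫ y, ψ₀ q y) * F x) * star (star (∫ y, ψ₀' q y) * G x) =
        (∑ q, star (∫ y, ψ₀ q y) * ∫ y, ψ₀' q y) * (F x * star (G x)) := by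
      rw [Finset.sum_mul]
      refine Finset.sum_congr rfl fun q _ => ?_
      rw [star_mul', star_star]
      ring
    rw [h4, hnorm, one_mul, h1, h2]
    simp
  rw [hinner]
  refine tendsto_integral_of_dominated_convergence bound hSm hbi
    (fun J => Eventually.of_forall (hSb J)) (Eventually.of_forall fun x => ?_)
  exact tendsto_finsetSum _ fun q _ => (tendsto_sample hN (hint q) hF hCF x).mul
    ((tendsto_sample hN (hint' q) hG hCG x).star)

lemma pair_sub_left {u u' v : Z d → Matrix (Fin 1) (Fin r) ℂ} (hu : sqNorm u < ∞)
    (hu' : sqNorm u' < ∞) (hv : sqNorm v < ∞) : pair (u - u') v = pair u v - pair u' v := by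
  rw [pair, pair, pair, ← (summable_pair hu hv).tsum_sub (summable_pair hu' hv)]
  refine tsum_congr fun k => ?_
  simp [sub_mul]

lemma coef_sub {H : Type*} [NormedAddCommGroup H] [InnerProductSpace ℂ H] (φ : Fin r → Z d → H)
    (f g : H) : coef φ (f - g) = coef φ f - coef φ g := by
  funext k
  ext i q
  simp [coef]

/-- The pairings of the coefficients are uniformly Lipschitz functions. -/
lemma IsBessel.lipschitzWith_pair {H : Type*} [NormedAddCommGroup H] [InnerProductSpace ℂ H]
    {φ φ' : Fin r → Z d → H} (h : IsBessel φ) (h' : IsBessel φ') (g : H) :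
    ∃ K, ∀ U V : H ≃ₗᵢ[ℂ] H,
      LipschitzWith K fun f => pair (coef φ (U⁻¹ f)) (coef φ' (V⁻¹ g)) := by
  obtain ⟨B, hB, hB2⟩ := id h
  obtain ⟨B', hB', hB2'⟩ := id h'
  refine ⟨Real.toNNReal (Real.sqrt (B * B') * ‖g‖), fun U V => LipschitzWith.of_dist_le_mul fun x y => ?_⟩
  rw [dist_eq_norm, dist_eq_norm, ← pair_sub_left (h.lt_top _) (h.lt_top _) (h'.lt_top _),
    ← coef_sub, Real.coe_toNNReal _ (by positivity), ← map_sub]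
  have e : ∀ {B : ℝ} {φ : Fin r → Z d → H} (hB : 0 < B)
      (hB2 : ∀ f, sqNorm (coef φ f) ≤ ENNReal.ofReal B * ‖f‖ₑ ^ 2) (U : H ≃ₗᵢ[ℂ] H) (z : H),
      (sqNorm (coef φ (U⁻¹ z))).toReal ≤ B * ‖z‖ ^ 2 := by
    intro B φ hB hB2 U z
    have h1 := ENNReal.toReal_mono (ENNReal.mul_lt_top ENNReal.ofReal_lt_top (by simp)).ne
      (hB2 (U⁻¹ z))
    rwa [enorm_symm_apply, ENNReal.toReal_mul, ENNReal.toReal_ofReal hB.le, ENNReal.toReal_pow,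
      toReal_enorm] at h1
  refine (abs_le_of_sq_le_sq' ?_ (by positivity)).2
  refine (norm_pair_sq_le (h.lt_top _) (h'.lt_top _)).trans ?_
  refine (mul_le_mul (e hB hB2 _ _) (e hB' hB2' _ _) ENNReal.toReal_nonneg (by positivity)).trans_eq ?_
  rw [mul_pow, mul_pow, Real.sq_sqrt (by positivity)]
  ring

/-- The pairings of the coefficients at fine scales approximate the inner product. -/
theorem tendsto_pair_coef {N : Matrix (Fin d) (Fin d) ℤ} (hN : IsDilationMatrix N)
    {ψ₀ ψ₀' : Fin r → L2 d} (hsupp : ∀ q, IsCompactlySupported (ψ₀ q))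
    (hsupp' : ∀ q, IsCompactlySupported (ψ₀' q))
    (hnorm : ∑ q, star (vecHat ψ₀ 0 q) * vecHat ψ₀' 0 q = 1) (f g : L2 d) :
    Tendsto (fun J : ℕ => pair
        (coef (shifts ψ₀) ((dilateEquiv (re N) hN.det_re_ne_zero 0 ^ J)⁻¹ f))
        (coef (shifts ψ₀') ((dilateEquiv (re N) hN.det_re_ne_zero 0 ^ J)⁻¹ g)))
      atTop (𝓝 (inner ℂ g f)) := by
  have hB := isBessel_shifts hsupp
  have hB' := isBessel_shifts hsupp'
  have hdense := Lp.dense_hasCompactSupport_contDiff (E := E d) (F := ℂ) (μ := volume) (p := 2)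
    (by norm_num)
  set S := {f : L2 d | ∃ g : E d → ℂ, f =ᵐ[volume] g ∧ HasCompactSupport g ∧
    ContDiff ℝ (⊤ : ℕ∞) g} with hS
  -- both arguments are extended from a dense set by equicontinuity, one after the other
  have hleft : ∀ f : L2 d, ∀ g ∈ S, Tendsto (fun J : ℕ => pair
        (coef (shifts ψ₀) ((dilateEquiv (re N) hN.det_re_ne_zero 0 ^ J)⁻¹ f))
        (coef (shifts ψ₀') ((dilateEquiv (re N) hN.det_re_ne_zero 0 ^ J)⁻¹ g)))
      atTop (𝓝 (inner ℂ g f)) := by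
    intro f g hg
    obtain ⟨K, hK⟩ := hB.lipschitzWith_pair hB' g
    have heq := (LipschitzWith.uniformEquicontinuous (fun (J : ℕ) f => pair
        (coef (shifts ψ₀) ((dilateEquiv (re N) hN.det_re_ne_zero 0 ^ J)⁻¹ f))
        (coef (shifts ψ₀') ((dilateEquiv (re N) hN.det_re_ne_zero 0 ^ J)⁻¹ g))) K
        fun J => hK _ _).equicontinuous
    have hcl := heq.isClosed_setOfPred_tendsto (l := atTop) (f := fun f : L2 d => (inner ℂ g f : ℂ))
      (by fun_prop)
    refine closure_minimal ?_ hcl (hdense f)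
    rintro f ⟨F, hf, hFs, hF⟩
    obtain ⟨G, hg, hGs, hG⟩ := hg
    exact tendsto_pair_of_continuous hN hsupp hsupp' hnorm hf hg hF.continuous hFs hG.continuous hGs
  obtain ⟨K, hK⟩ := hB'.lipschitzWith_pair hB f
  have heq := (LipschitzWith.uniformEquicontinuous (fun (J : ℕ) g => pair
      (coef (shifts ψ₀') ((dilateEquiv (re N) hN.det_re_ne_zero 0 ^ J)⁻¹ g))
      (coef (shifts ψ₀) ((dilateEquiv (re N) hN.det_re_ne_zero 0 ^ J)⁻¹ f))) K
      fun J => hK _ _).equicontinuous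
  have hcl := heq.isClosed_setOfPred_tendsto (l := atTop) (f := fun g : L2 d => (inner ℂ f g : ℂ))
    (by fun_prop)
  have h1 : Tendsto (fun J : ℕ => pair
      (coef (shifts ψ₀') ((dilateEquiv (re N) hN.det_re_ne_zero 0 ^ J)⁻¹ g))
      (coef (shifts ψ₀) ((dilateEquiv (re N) hN.det_re_ne_zero 0 ^ J)⁻¹ f)))
      atTop (𝓝 (inner ℂ f g)) := by
    refine closure_minimal ?_ hcl (hdense g)
    intro g hg
    have := (hleft f g hg).star
    simp only [pair_star] at this
    rwa [Complex.star_def, inner_conj_symm] at this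
  have := h1.star
  simp only [pair_star] at this
  rwa [Complex.star_def, inner_conj_symm] at this

end FineScales

end MixedFramelet

open MixedFramelet

theorem mainTheorem1 {d r s : ℕ} (hd : 0 < d)
    -- dilation matrices `M₀, …, M_s` and filters
    (M : Fin (s + 1) → Matrix (Fin d) (Fin d) ℤ) (hM : ∀ l, IsDilationMatrix (M l))
    (b₀ b₀' : Filt d r r) (b b' : Fin s → Filt d 1 r)
    -- compactly supported standard refinable vector functions in `L₂`
    (ψ₀ ψ₀' : Fin r → L2 d)
    (hsupp : ∀ q, IsCompactlySupported (ψ₀ q)) (hsupp' : ∀ q, IsCompactlySupported (ψ₀' q))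
    (hstd : IsStandardRefinableHat (M 0) b₀ (vecHat ψ₀))
    (hstd' : IsStandardRefinableHat (M 0) b₀' (vecHat ψ₀'))
    (href : ∀ ξ : E d, vecHat ψ₀ (act (re (M 0)).transpose ξ) =
      (fourierSeries b₀ ξ).mulVec (vecHat ψ₀ ξ))
    (href' : ∀ ξ : E d, vecHat ψ₀' (act (re (M 0)).transpose ξ) =
      (fourierSeries b₀' ξ).mulVec (vecHat ψ₀' ξ))
    (hnorm : ∑ q, star (vecHat ψ₀ 0 q) * vecHat ψ₀' 0 q = 1)
    -- the generators given by the high-pass filters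
    (ψ ψ' : Fin s → L2 d)
    (hψ : ∀ l, ∀ᵐ ξ : E d, fourierL2Hat (ψ l) ξ =
      (fourierSeries (b l) (act ((re (M 0)).transpose)⁻¹ ξ)).mulVec
        (vecHat ψ₀ (act ((re (M 0)).transpose)⁻¹ ξ)) 0)
    (hψ' : ∀ l, ∀ᵐ ξ : E d, fourierL2Hat (ψ' l) ξ =
      (fourierSeries (b' l) (act ((re (M 0)).transpose)⁻¹ ξ)).mulVec
        (vecHat ψ₀' (act ((re (M 0)).transpose)⁻¹ ξ)) 0) :
    ((IsDualFrameletFilterBank M b₀ b b₀' b' ∧ HasStability M b₀ b ∧ HasStability M b₀' b') →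
      (IsDualFramelet M ψ₀ ψ ψ₀' ψ' ∧ BracketsBoundedAbove (vecHat ψ₀) (vecHat ψ₀')))
    ∧
    (BracketsBoundedBelow (vecHat ψ₀) (vecHat ψ₀') →
      (IsDualFramelet M ψ₀ ψ ψ₀' ψ' ∧ BracketsBoundedAbove (vecHat ψ₀) (vecHat ψ₀')) →
      (IsDualFrameletFilterBank M b₀ b b₀' b' ∧ HasStability M b₀ b ∧ HasStability M b₀' b')) := by
  have hdet : ∀ l, (M l).det ≠ 0 := fun l h => (hM l).det_re_ne_zero (by rw [det_re, h, Int.cast_zero])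
  have h0 := (hM 0).det_re_ne_zero
  have hφ := isRefined_shifts h0 hsupp b₀ href
  have hφ' := isRefined_shifts h0 hsupp' b₀' href'
  have hω := fun l => isRefined_waveletShifts h0 hsupp l (b l) (hψ l)
  have hω' := fun l => isRefined_waveletShifts h0 hsupp' l (b' l) (hψ' l)
  rw [isDualFrameletFilterBank_iff hdet, IsDualFramelet, affineSystem_eq_affine h0,
    affineSystem_eq_affine h0]
  constructor
  · rintro ⟨hPR, hs, hs'⟩
    exact ⟨dualFrame_of_filterBank hPR hφ hω hφ' hω' (isBessel_shifts hsupp)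
      (isBessel_shifts hsupp') hs.upper hs'.upper (tendsto_pair_coef (hM 0) hsupp hsupp' hnorm),
      bracketsBoundedAbove hsupp hsupp'⟩
  · rintro ⟨C, hC, hbr⟩ ⟨⟨hF, hF', hd⟩, -⟩
    have hI : HasBoundedInterpolation (shifts ψ₀) := hasBoundedInterpolation_of_le hC
      (le_enorm_synth_sq hsupp hC (hbr.mono fun _ h => h.1))
    have hI' : HasBoundedInterpolation (shifts ψ₀') := hasBoundedInterpolation_of_le hC
      (le_enorm_synth_sq hsupp' hC (hbr.mono fun _ h => h.2))
    have hPR := perfectReconstruction_of_dualFrame hφ hω hφ' hω' hI hI' hd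
    have hs := upperStability_of_isFrame hφ hω hI hF
    have hs' := upperStability_of_isFrame hφ' hω' hI' hF'
    exact ⟨hPR, hPR.hasStability hs hs', hPR.symm.hasStability hs' hs⟩
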